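/- An instance of prize-collecting Steiner tree consists of a finite simple undirected graph $G=(V,E)$ with $|V|=n$, a root $r\in V$, edge costs $c:E\to\mathbb{R}_{\ge 0}$ and penalties $\pi:V\to\mathbb{R}_{\ge 0}$. A solution is a tree $T\subseteq G$ with $r\in V(T)$; put $\mathrm{Length}(T)=\sum_{e\in E(T)}c(e)$, $\mathrm{Cost}(T)=\mathrm{Length}(T)+\sum_{v\notin V(T)}\pi(v)$, and let $\mathrm{OPT}$ be the minimum of $\mathrm{Cost}$ over all solutions. A terminal is a vertex with $\pi(v)\neq 0$. **Theorem.** There is an absolute constant $C>0$ such that the following holds for every instance and every $0<\varepsilon\le 1$. (1) Let $T$ be any output of the Goemans–Williamson primal-dual algorithm for prize-collecting Steiner tree (with any breaking of ties) on the graph $G$, root $r$, costs $c$ and the scaled penalties $\pi'(v)=\frac{2}{\varepsilon}\pi(v)$. Then $T$ is a solution with $\mathrm{Cost}(T)\le \frac{C}{\varepsilon}\,\mathrm{OPT}$, and there is a solution $T'$ which is $(1+\varepsilon)$-approximate when it is charged as connecting to the root only vertices of $T$: for some $U\subseteq V(T')\cap V(T)$, $$\mathrm{Length}(T')+\sum_{v\in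 V\setminus U}\pi(v)\le(1+\varepsilon)\,\mathrm{OPT}.$$ If moreover every terminal other than $r$ has degree at most $1$ in $G$, then the same $T'$ satisfies $\mathrm{Cost}(T')\le(1+\varepsilon)\,\mathrm{OPT}$ and every terminal in $V(T')$ lies in $V(T)$. (2) Such an output $T$ can be computed in polynomial time: there are one random-access program (with arithmetic operations $+,-,\times,/$ and comparisons on real numbers) and one polynomial $q$ such that on every input $(G,r,c,\pi,\varepsilon)$ the program outputs such a $T$ within time $q(n)$, where an operation on real numbers takes unit time and natural numbers are charged at their bit length; and if $\varepsilon$ and all $c(e)$ and $\pi(v)$ are rational, it does so within time $q(L)$ when every number is charged at its bit length, $L$ being $n$ plus the total bit length of $\varepsilon$, the costs and the penalties. -/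

import Mathlib

/-- An instance of prize-collecting Steiner tree on the vertex set `Fin n`: a finite simple graph,
a root, non-negative edge costs and non-negative vertex penalties.  Only the values of `cost` on
edges of `graph` matter. -/
structure PCST (n : ℕ) where
  graph : SimpleGraph (Fin n)
  root : Fin n
  cost : Sym2 (Fin n) → ℝ
  penalty : Fin n → ℝ
  cost_nonneg : ∀ e ∈ graph.edgeSet, 0 ≤ cost e
  penalty_nonneg : ∀ v, 0 ≤ penalty v

namespace PCST

variable {n : ℕ}

/-- A feasible solution: a subtree of the graph that contains the root. -/
def IsSolution (I : PCST n) (T : I.graph.Subgraph) : Prop :=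
  I.root ∈ T.verts ∧ T.coe.IsTree

open scoped Classical in
/-- Total cost of the edges of `T`. -/
noncomputable def length (I : PCST n) (T : I.graph.Subgraph) : ℝ :=
  ∑ e with e ∈ T.edgeSet, I.cost e

open scoped Classical in
/-- Total penalty of the vertices outside `U`. -/
noncomputable def penaltyOutside (I : PCST n) (U : Set (Fin n)) : ℝ :=
  ∑ v with v ∉ U, I.penalty v

/-- Objective value: edge costs plus the penalties of the vertices that are not in `T`. -/
noncomputable def totalCost (I : PCST n) (T : I.graph.Subgraph) : ℝ :=
  I.length T + I.penaltyOutside T.verts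

/-- The optimal value, the least objective value of a feasible solution
(an infimum over a finite non-empty set). -/
noncomputable def opt (I : PCST n) : ℝ :=
  sInf {x : ℝ | ∃ T : I.graph.Subgraph, I.IsSolution T ∧ x = I.totalCost T}

/-- Every terminal (a vertex of non-zero penalty) other than the root has degree at most one. -/
def TerminalsAreLeaves (I : PCST n) : Prop :=
  ∀ v, v ≠ I.root → I.penalty v ≠ 0 → (I.graph.neighborSet v).ncard ≤ 1

/-! ### The Goemans-Williamson primal-dual algorithm

The algorithm is run on the graph, root and edge costs of `I`, with a penalty vector `p` that need
not be the one of `I`. Ties are broken arbitrarily. -/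

/-- The edge `e` has exactly one endpoint in `S`. -/
def Cuts (S : Finset (Fin n)) (e : Sym2 (Fin n)) : Prop :=
  ∃ u ∈ S, ∃ v ∉ S, e = s(u, v)

/-- State of the growth phase: the dual variables, the current components, the active ones among
them, the edges chosen so far, and the label of each vertex, that is, the component that contained
the vertex when it first belonged to a deactivated component. -/
structure GWState (n : ℕ) where
  y : Finset (Fin n) → ℝ
  comps : Finset (Finset (Fin n))
  active : Finset (Finset (Fin n))
  forest : Finset (Sym2 (Fin n))
  label : Fin n → Option (Finset (Fin n))

/-- At the start every vertex is a component, and all but the root are active. -/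
def gwStart (I : PCST n) : GWState n where
  y := fun _ => 0
  comps := Finset.univ.image (fun v => {v})
  active := (Finset.univ.erase I.root).image (fun v => {v})
  forest := ∅
  label := fun _ => none

/-- Raise the dual variable of every active component by `d`. -/
def GWState.grow (s : GWState n) (d : ℝ) : GWState n :=
  { s with y := fun S => if S ∈ s.active then s.y S + d else s.y S }

open scoped Classical in
/-- The amount of the edge `e` that has been paid for by the dual variables. -/
noncomputable def GWState.paid (s : GWState n) (e : Sym2 (Fin n)) : ℝ :=
  ∑ S with Cuts S e, s.y S

/-- The remaining potential of the component `S`. -/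
noncomputable def GWState.potential (s : GWState n) (p : Fin n → ℝ) (S : Finset (Fin n)) : ℝ :=
  ∑ v ∈ S, p v - ∑ R ∈ S.powerset, s.y R

/-- No edge is overpaid and no active component has overspent its potential. -/
def GWState.Feasible (s : GWState n) (I : PCST n) (p : Fin n → ℝ) : Prop :=
  (∀ e ∈ I.graph.edgeSet, s.paid e ≤ I.cost e) ∧ ∀ S ∈ s.active, 0 ≤ s.potential p S

open scoped Classical in
/-- Merge the components `A` and `B` along the edge `e`. The new component is active
unless it contains the root. -/
noncomputable def GWState.merge (s : GWState n) (I : PCST n) (A B : Finset (Fin n))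
    (e : Sym2 (Fin n)) : GWState n :=
  { s with
    comps := insert (A ∪ B) ((s.comps.erase A).erase B)
    active := if I.root ∈ A ∪ B then (s.active.erase A).erase B
      else insert (A ∪ B) ((s.active.erase A).erase B)
    forest := insert e s.forest }

/-- Deactivate the component `S` and label its vertices that had no label. -/
def GWState.deactivate (s : GWState n) (S : Finset (Fin n)) : GWState n :=
  { s with
    active := s.active.erase S
    label := fun v => if v ∈ S ∧ s.label v = none then some S else s.label v }

/-- One iteration: grow all active components uniformly until an edge between two components,
at least one of them active, becomes tight, or an active component runs out of potential. -/
inductive GWStep (I : PCST n) (p : Fin n → ℝ) : GWState n → GWState n → Prop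
  | merge (s : GWState n) (d : ℝ) (A B : Finset (Fin n)) (u v : Fin n)
      (hd : 0 ≤ d) (hf : (s.grow d).Feasible I p)
      (hA : A ∈ s.comps) (hB : B ∈ s.comps) (hAB : A ≠ B)
      (hact : A ∈ s.active ∨ B ∈ s.active)
      (hu : u ∈ A) (hv : v ∈ B) (huv : I.graph.Adj u v)
      (htight : (s.grow d).paid s(u, v) = I.cost s(u, v)) :
      GWStep I p s ((s.grow d).merge I A B s(u, v))
  | deactivate (s : GWState n) (d : ℝ) (S : Finset (Fin n))
      (hd : 0 ≤ d) (hf : (s.grow d).Feasible I p)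
      (hS : S ∈ s.active) (hempty : (s.grow d).potential p S = 0) :
      GWStep I p s ((s.grow d).deactivate S)

/-- `v` is connected to the root by the edges in `F`. -/
def RootConnected (I : PCST n) (F : Finset (Sym2 (Fin n))) (v : Fin n) : Prop :=
  (SimpleGraph.fromEdgeSet (F : Set (Sym2 (Fin n)))).Reachable I.root v

/-- The condition kept by the deletion phase: unlabelled vertices are connected to the root, and if
a vertex with label `A` is connected to the root, then so is every vertex with a label that
contains `A`. -/
def KeepsRequired (I : PCST n) (s : GWState n) (F : Finset (Sym2 (Fin n))) : Prop :=
  (∀ v, s.label v = none → I.RootConnected F v) ∧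
  ∀ v w A B, s.label v = some A → s.label w = some B → A ⊆ B →
    I.RootConnected F v → I.RootConnected F w

/-- `T` is a possible output of the Goemans-Williamson algorithm with penalties `p`: run the growth
phase until no component is active, delete as many edges as possible, return the tree at the
root. -/
def IsGWOutput (I : PCST n) (p : Fin n → ℝ) (T : I.graph.Subgraph) : Prop :=
  ∃ (s : GWState n) (F : Finset (Sym2 (Fin n))),
    Relation.ReflTransGen (GWStep I p) I.gwStart s ∧ s.active = ∅ ∧
    Minimal (fun F' => F' ⊆ s.forest ∧ I.KeepsRequired s F') F ∧
    T.edgeSet = (F : Set (Sym2 (Fin n))) ∧ T.verts = {v | I.RootConnected F v}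

end PCST

/-! ### The machine model

Structured random-access programs. The memory consists of numbered arrays of natural numbers
and numbered arrays of real numbers; a program can load, store, compare and do arithmetic, and it
can address cells by computed natural numbers. No conversion goes from real numbers to natural
numbers except by comparison. -/

/-- Memory: `nats a k` and `reals a k` are the contents of cell `k` of the array number `a`. -/
structure Mem where
  nats : ℕ → ℕ → ℕ
  reals : ℕ → ℕ → ℝ

/-- Natural-number expressions. -/
inductive NatExpr
  | const (k : ℕ)
  | get (a : ℕ) (i : NatExpr)
  | plus (x y : NatExpr)
  | minus (x y : NatExpr)
  | times (x y : NatExpr)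

/-- Real-number expressions. The only constants are natural numbers. -/
inductive RealExpr
  | const (k : ℕ)
  | get (a : ℕ) (i : NatExpr)
  | plus (x y : RealExpr)
  | minus (x y : RealExpr)
  | times (x y : RealExpr)
  | quot (x y : RealExpr)

/-- Boolean tests. -/
inductive TestExpr
  | natLe (x y : NatExpr)
  | realLe (x y : RealExpr)
  | neg (t : TestExpr)
  | conj (t u : TestExpr)

/-- Programs. -/
inductive Prog
  | skip
  | setNat (a : ℕ) (i x : NatExpr)
  | setReal (a : ℕ) (i : NatExpr) (x : RealExpr)
  | seq (P Q : Prog)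
  | ite (t : TestExpr) (P Q : Prog)
  | loop (t : TestExpr) (P : Prog)

def NatExpr.eval (m : Mem) : NatExpr → ℕ
  | .const k => k
  | .get a i => m.nats a (i.eval m)
  | .plus x y => x.eval m + y.eval m
  | .minus x y => x.eval m - y.eval m
  | .times x y => x.eval m * y.eval m

noncomputable def RealExpr.eval (m : Mem) : RealExpr → ℝ
  | .const k => k
  | .get a i => m.reals a (i.eval m)
  | .plus x y => x.eval m + y.eval m
  | .minus x y => x.eval m - y.eval m
  | .times x y => x.eval m * y.eval m
  | .quot x y => x.eval m / y.eval m

def TestExpr.Holds (m : Mem) : TestExpr → Prop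
  | .natLe x y => x.eval m ≤ y.eval m
  | .realLe x y => x.eval m ≤ y.eval m
  | .neg t => ¬ t.Holds m
  | .conj t u => t.Holds m ∧ u.Holds m

/-- Time to evaluate an expression: each operation takes one unit plus the number of bits of its
result. Hence natural numbers are always charged at their bit length. -/
def NatExpr.time (m : Mem) : NatExpr → ℕ
  | .const k => 1 + k.size
  | .get a i => i.time m + 1 + (m.nats a (i.eval m)).size
  | .plus x y => x.time m + y.time m + 1 + (x.eval m + y.eval m).size
  | .minus x y => x.time m + y.time m + 1 + (x.eval m - y.eval m).size
  | .times x y => x.time m + y.time m + 1 + (x.eval m * y.eval m).size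

/-- As for natural numbers, where a real number `z` is charged `sz z` in addition to one unit. -/
noncomputable def RealExpr.time (sz : ℝ → ℕ) (m : Mem) : RealExpr → ℕ
  | .const k => 1 + sz k
  | .get a i => i.time m + 1 + sz (m.reals a (i.eval m))
  | .plus x y => x.time sz m + y.time sz m + 1 + sz (x.eval m + y.eval m)
  | .minus x y => x.time sz m + y.time sz m + 1 + sz (x.eval m - y.eval m)
  | .times x y => x.time sz m + y.time sz m + 1 + sz (x.eval m * y.eval m)
  | .quot x y => x.time sz m + y.time sz m + 1 + sz (x.eval m / y.eval m)

noncomputable def TestExpr.time (sz : ℝ → ℕ) (m : Mem) : TestExpr → ℕ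
  | .natLe x y => x.time m + y.time m + 1
  | .realLe x y => x.time sz m + y.time sz m + 1
  | .neg t => t.time sz m + 1
  | .conj t u => t.time sz m + u.time sz m + 1

def Mem.setNat (m : Mem) (a k x : ℕ) : Mem :=
  { m with nats := Function.update m.nats a (Function.update (m.nats a) k x) }

noncomputable def Mem.setReal (m : Mem) (a k : ℕ) (x : ℝ) : Mem :=
  { m with reals := Function.update m.reals a (Function.update (m.reals a) k x) }

/-- `Runs sz P m m' t`: started in memory `m`, the program `P` halts in memory `m'` after time `t`,
where handling a real number `z` is charged `1 + sz z`. -/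
inductive Runs (sz : ℝ → ℕ) : Prog → Mem → Mem → ℕ → Prop
  | skip (m : Mem) : Runs sz .skip m m 1
  | setNat (m : Mem) (a : ℕ) (i x : NatExpr) :
      Runs sz (.setNat a i x) m (m.setNat a (i.eval m) (x.eval m)) (i.time m + x.time m + 1)
  | setReal (m : Mem) (a : ℕ) (i : NatExpr) (x : RealExpr) :
      Runs sz (.setReal a i x) m (m.setReal a (i.eval m) (x.eval m)) (i.time m + x.time sz m + 1)
  | seq {P Q : Prog} {m₁ m₂ m₃ : Mem} {t₁ t₂ : ℕ} (hP : Runs sz P m₁ m₂ t₁)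
      (hQ : Runs sz Q m₂ m₃ t₂) : Runs sz (.seq P Q) m₁ m₃ (t₁ + t₂)
  | ite_true {t : TestExpr} {P Q : Prog} {m m' : Mem} {k : ℕ} (ht : t.Holds m)
      (hP : Runs sz P m m' k) : Runs sz (.ite t P Q) m m' (t.time sz m + k)
  | ite_false {t : TestExpr} {P Q : Prog} {m m' : Mem} {k : ℕ} (ht : ¬ t.Holds m)
      (hQ : Runs sz Q m m' k) : Runs sz (.ite t P Q) m m' (t.time sz m + k)
  | loop_exit {t : TestExpr} {P : Prog} {m : Mem} (ht : ¬ t.Holds m) :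
      Runs sz (.loop t P) m m (t.time sz m)
  | loop_step {t : TestExpr} {P : Prog} {m₁ m₂ m₃ : Mem} {k₁ k₂ : ℕ} (ht : t.Holds m₁)
      (hP : Runs sz P m₁ m₂ k₁) (hrest : Runs sz (.loop t P) m₂ m₃ k₂) :
      Runs sz (.loop t P) m₁ m₃ (t.time sz m₁ + k₁ + k₂)

/-- Unit cost: every operation on real numbers takes one unit of time. -/
def unitSize : ℝ → ℕ := fun _ => 0

/-- Number of bits of numerator and denominator of a fraction in lowest terms. -/
def ratSize (q : ℚ) : ℕ := q.num.natAbs.size + q.den.size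

open scoped Classical in
/-- Bit cost: a rational number is charged its number of bits. It is used only for runs on rational
inputs, in which all numbers that occur are rational. -/
noncomputable def bitSize (x : ℝ) : ℕ :=
  if h : ∃ q : ℚ, (q : ℝ) = x then ratSize h.choose else 0

namespace PCST

variable {n : ℕ}

open scoped Classical in
/-- The input for the instance `I` and the accuracy `ε`: the number of vertices, the root, the
adjacency matrix, `ε`, the matrix of edge costs (zero at non-edges), and the vector of penalties.
All other cells are zero. -/
noncomputable def input (I : PCST n) (ε : ℝ) : Mem where
  nats := fun a k =>
    match a with
    | 0 => if k = 0 then n else if k = 1 then I.root else 0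
    | 1 => if h : k < n * n then
        if I.graph.Adj (Fin.divNat ⟨k, h⟩) (Fin.modNat ⟨k, h⟩) then 1 else 0
      else 0
    | _ => 0
  reals := fun a k =>
    match a with
    | 0 => if k = 0 then ε else 0
    | 1 => if h : k < n * n then
        if I.graph.Adj (Fin.divNat ⟨k, h⟩) (Fin.modNat ⟨k, h⟩) then
          I.cost s(Fin.divNat ⟨k, h⟩, Fin.modNat ⟨k, h⟩) else 0
      else 0
    | 2 => if h : k < n then I.penalty ⟨k, h⟩ else 0
    | _ => 0

open scoped Classical in
/-- The memory `m` holds the output `T`: natural-number array 2 is the indicator vector of the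
vertices of `T`, array 3 is the adjacency matrix of `T`. -/
def IsOutput (I : PCST n) (m : Mem) (T : I.graph.Subgraph) : Prop :=
  (∀ i : Fin n, m.nats 2 i = if i ∈ T.verts then 1 else 0) ∧
  ∀ i j : Fin n, m.nats 3 (i * n + j) = if T.Adj i j then 1 else 0

/-- All numbers in the input are rational. -/
def IsRationalInput (I : PCST n) (ε : ℝ) : Prop :=
  (∃ q : ℚ, (q : ℝ) = ε) ∧ (∀ e ∈ I.graph.edgeSet, ∃ q : ℚ, (q : ℝ) = I.cost e) ∧
    ∀ v, ∃ q : ℚ, (q : ℝ) = I.penalty v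

open scoped Classical in
/-- Encoding length of a rational input. -/
noncomputable def inputBits (I : PCST n) (ε : ℝ) : ℕ :=
  n + bitSize ε + ∑ e with e ∈ I.graph.edgeSet, bitSize (I.cost e) +
    ∑ v, bitSize (I.penalty v)

end PCST

/-! The guarantee is a primal-dual argument. The growth phase produces a dual `y` on vertex sets
avoiding the root. No edge is overpaid, and for every vertex set `S` the total dual of the subsets
of `S` is at most the penalty of `S`, with equality when `S` is a label. Three facts about `y`
suffice.

Weak duality (`sum_y_powerset_le`): given a solution `S` and a vertex set `N`, the sets `R ⊆ N` that
meet `S` are crossed by edges of `S`, which pay for them; the other sets lie in `N \ S` and are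
bounded by its penalties.

Tightness (`sum_disconnected_le`): the set `N` of vertices left out of the output is a union of
labels, and tight sets are closed under union because the dual sum over subsets is supermodular. So
the penalty of `N` is at most the dual inside `N`. With weak duality, the scaled penalty of `N ∩ S`
is at most the length of `S`. The scaling factor `2 / ε` turns this into a loss of at most `ε / 2`
times that length. Applied to an optimal `S`, this gives the `(1 + ε)` bound; when terminals are
leaves, those outside `T` can be removed from `S` without disconnecting it.

Factor two (`sum_paid_le`): all edges of the output are tight, and their total payment is at most
twice the dual. At each moment the active components have average degree at most two in the output:
the output, with components contracted, is a tree, and by minimality its inactive components away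
from the root are not leaves. This bounds the cost of `T` by `6 / ε` times the optimum.

For the running time, a weakest-precondition calculus `Prog.wp` records a bound `N` on natural
numbers and loop counts and a set `L` containing all real values; `Prog.wp_sound` converts it into a
syntactic polynomial time bound. The memory does not store `y`. It stores for each vertex the dual
sum over sets containing it and the potential of its component, and `Represents` shows that this
determines every step. The minimal edge set of the deletion phase is obtained as the part of the
forest induced by a closure: start from the unlabelled vertices and add whatever labels and parent
pointers force (`minimal_of_closure`).

Bit lengths stay polynomial because denominators and magnitudes are both controlled. Event times are
differences of stored numbers divided by one or two, so after `k` rounds all numbers are multiples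
of `1 / (D * 2 ^ k)` for a common denominator `D`, and only `2 * n` rounds occur. All magnitudes are
bounded by the sum of the costs plus a multiple of the sum of the scaled penalties. `Regime`
packages both facts; the trivial regime covers arbitrary real input. -/

/-- A set closed under adjacency that contains `u` contains all vertices reachable from `u`. -/
theorem SimpleGraph.Reachable.mem_of_closed {V : Type*} {G : SimpleGraph V} {u v : V}
    (h : G.Reachable u v) {Z : Set V} (hu : u ∈ Z) (hZ : ∀ x ∈ Z, ∀ y, G.Adj x y → y ∈ Z) :
    v ∈ Z := by
  obtain ⟨w⟩ := h
  induction w with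
  | nil => exact hu
  | cons hadj _ ih => exact ih (hZ _ hu _ hadj)

/-! ### The invariant of the growth phase -/

namespace PCST

variable {n : ℕ}

/-- The invariant of the growth phase. -/
structure GWState.Inv (s : GWState n) (I : PCST n) (p : Fin n → ℝ) : Prop where
  y_nonneg : ∀ S, 0 ≤ s.y S
  y_supp : ∀ S, s.y S ≠ 0 → S.Nonempty ∧ I.root ∉ S ∧ ∃ C ∈ s.comps, S ⊆ C
  comps_cover : ∀ v, ∃ C ∈ s.comps, v ∈ C
  comps_nonempty : ∀ C ∈ s.comps, C.Nonempty
  comps_eq : ∀ C ∈ s.comps, ∀ D ∈ s.comps, ∀ v, v ∈ C → v ∈ D → C = D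
  active_comps : ∀ C ∈ s.active, C ∈ s.comps
  active_root : ∀ C ∈ s.active, I.root ∉ C
  paid_le : ∀ e ∈ I.graph.edgeSet, s.paid e ≤ I.cost e
  dual_le : ∀ S : Finset (Fin n), ∑ R ∈ S.powerset, s.y R ≤ ∑ v ∈ S, p v
  forest_edge : ∀ e ∈ s.forest, e ∈ I.graph.edgeSet
  forest_tight : ∀ e ∈ s.forest, s.paid e = I.cost e
  forest_comp : ∀ e ∈ s.forest, ∃ C ∈ s.comps, ∀ v ∈ e, v ∈ C
  forest_conn : ∀ C ∈ s.comps, ∀ u ∈ C, ∀ v ∈ C,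
    (SimpleGraph.fromEdgeSet (s.forest : Set (Sym2 (Fin n)))).Reachable u v
  forest_acyclic : (SimpleGraph.fromEdgeSet (s.forest : Set (Sym2 (Fin n)))).IsAcyclic
  label_mem : ∀ v A, s.label v = some A → v ∈ A
  label_root : ∀ v A, s.label v = some A → I.root ∉ A
  label_tight : ∀ v A, s.label v = some A → ∑ R ∈ A.powerset, s.y R = ∑ x ∈ A, p x
  label_sub : ∀ v A, s.label v = some A → ∀ w ∈ A, ∃ B, B ⊆ A ∧ s.label w = some B
  label_comp : ∀ v A, s.label v = some A → ∃ C ∈ s.comps, A ⊆ C ∧ (C ∈ s.active → A ≠ C)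
  inactive : ∀ C ∈ s.comps, C ∉ s.active → I.root ∉ C →
    ∀ w ∈ C, ∃ B, B ⊆ C ∧ s.label w = some B

namespace GWState.Inv

variable {s : GWState n} {I : PCST n} {p : Fin n → ℝ}

theorem comp_subset (h : s.Inv I p) {C D : Finset (Fin n)} (hC : C ∈ s.comps) (hD : D ∈ s.comps)
    (hCD : C ⊆ D) : C = D := by
  obtain ⟨v, hv⟩ := h.comps_nonempty C hC
  exact h.comps_eq C hC D hD v hv (hCD hv)

theorem start (I : PCST n) (p : Fin n → ℝ) (hp : ∀ v, 0 ≤ p v) : I.gwStart.Inv I p where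
  y_nonneg := fun _ => le_rfl
  y_supp := fun S h => absurd rfl h
  comps_cover := fun v => ⟨{v}, by simp [gwStart], by simp⟩
  comps_nonempty := by
    intro C hC
    simp only [gwStart, Finset.mem_image] at hC
    obtain ⟨a, -, rfl⟩ := hC
    simp
  comps_eq := by
    intro C hC D hD v hvC hvD
    simp only [gwStart, Finset.mem_image] at hC hD
    obtain ⟨a, -, rfl⟩ := hC
    obtain ⟨b, -, rfl⟩ := hD
    simp only [Finset.mem_singleton] at hvC hvD
    rw [← hvC, ← hvD]
  active_comps := by
    intro C hC
    simp only [gwStart, Finset.mem_image] at hC ⊢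
    obtain ⟨a, -, rfl⟩ := hC
    exact ⟨a, by simp, rfl⟩
  active_root := by
    intro C hC
    simp only [gwStart, Finset.mem_image, Finset.mem_erase] at hC
    obtain ⟨a, ha, rfl⟩ := hC
    simpa using ha.1.symm
  paid_le := by
    intro e he
    simpa [GWState.paid, gwStart] using I.cost_nonneg e he
  dual_le := by
    intro S
    simpa [gwStart] using Finset.sum_nonneg fun v _ => hp v
  forest_edge := by simp [gwStart]
  forest_tight := by simp [gwStart]
  forest_comp := by simp [gwStart]
  forest_conn := by
    intro C hC u hu v hv
    simp only [gwStart, Finset.mem_image] at hC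
    obtain ⟨a, -, rfl⟩ := hC
    simp only [Finset.mem_singleton] at hu hv
    rw [hu, hv]
  forest_acyclic := by
    simp [gwStart]
  label_mem := by simp [gwStart]
  label_root := by simp [gwStart]
  label_tight := by simp [gwStart]
  label_sub := by simp [gwStart]
  label_comp := by simp [gwStart]
  inactive := by
    intro C hC hCa hr
    simp only [gwStart, Finset.mem_image, Finset.mem_erase] at hC hCa
    obtain ⟨a, -, rfl⟩ := hC
    exact absurd ⟨a, ⟨fun h => hr (by simp [h]), by simp⟩, rfl⟩ hCa

open scoped Classical in
-- Each set in the support of `z` lies inside some component, hence is counted at least once on the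
-- right. Non-negativity makes repeated counting harmless.
theorem dual_decomp (z : Finset (Fin n) → ℝ) (hz : ∀ S, 0 ≤ z S)
    (hs : ∀ S, z S ≠ 0 → ∃ C ∈ s.comps, S ⊆ C) (S : Finset (Fin n)) :
    ∑ R ∈ S.powerset, z R ≤ ∑ C ∈ s.comps, ∑ R ∈ (S ∩ C).powerset, z R := by
  have h1 : ∀ C : Finset (Fin n), ∑ R ∈ (S ∩ C).powerset, z R =
      ∑ R ∈ S.powerset, if R ⊆ C then z R else 0 := by
    intro C
    rw [← Finset.sum_filter]
    congr 1
    ext R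
    simp only [Finset.mem_powerset, Finset.mem_filter, Finset.subset_inter_iff]
  simp_rw [h1]
  rw [Finset.sum_comm]
  refine Finset.sum_le_sum fun R _ => ?_
  by_cases hR : z R = 0
  · simp [hR]
  · obtain ⟨C, hC, hRC⟩ := hs R hR
    have := Finset.single_le_sum (s := s.comps) (f := fun C => if R ⊆ C then z R else 0)
      (fun C _ => by split_ifs <;> simp [hz]) hC
    simpa [hRC] using this

theorem weight_decomp (h : s.Inv I p) (hp : ∀ v, 0 ≤ p v) (S : Finset (Fin n)) :
    ∑ C ∈ s.comps, ∑ v ∈ S ∩ C, p v ≤ ∑ v ∈ S, p v := by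
  rw [← Finset.sum_biUnion]
  · apply Finset.sum_le_sum_of_subset_of_nonneg
    · intro v hv
      simp only [Finset.mem_biUnion, Finset.mem_inter] at hv
      tauto
    · intro v _ _
      exact hp v
  · intro C hC D hD hCD
    refine Finset.disjoint_left.2 fun v hv hv' => hCD ?_
    simp only [Finset.mem_inter] at hv hv'
    exact h.comps_eq C hC D hD v hv.2 hv'.2

open scoped Classical in
theorem paid_grow (s : GWState n) (d : ℝ) (e : Sym2 (Fin n)) :
    (s.grow d).paid e = s.paid e + d * (s.active.filter fun S => Cuts S e).card := by
  simp only [GWState.paid, GWState.grow]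
  have : ∀ S, (if S ∈ s.active then s.y S + d else s.y S) =
      s.y S + if S ∈ s.active then d else 0 := by
    intro S; split_ifs <;> simp
  simp_rw [this]
  rw [Finset.sum_add_distrib, ← Finset.sum_filter, Finset.sum_const, nsmul_eq_mul, mul_comm]
  congr 4
  ext S
  simp [and_comm]

theorem not_cuts_of_forall_mem {C : Finset (Fin n)} {e : Sym2 (Fin n)} (h : ∀ v ∈ e, v ∈ C) :
    ¬ Cuts C e := by
  rintro ⟨u, _, v, hv, rfl⟩
  exact hv (h v (by simp))

theorem not_cuts_of_forall_not_mem {C : Finset (Fin n)} {e : Sym2 (Fin n)}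
    (h : ∀ v ∈ e, v ∉ C) : ¬ Cuts C e := by
  rintro ⟨u, hu, v, hv, rfl⟩
  exact h u (by simp) hu

theorem not_cuts_forest (h : s.Inv I p) {e : Sym2 (Fin n)} (he : e ∈ s.forest)
    {D : Finset (Fin n)} (hD : D ∈ s.comps) : ¬ Cuts D e := by
  obtain ⟨C, hC, hCe⟩ := h.forest_comp e he
  by_cases hCD : C = D
  · exact hCD ▸ not_cuts_of_forall_mem hCe
  · exact not_cuts_of_forall_not_mem fun v hv hvD =>
      hCD (h.comps_eq C hC D hD v (hCe v hv) hvD)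

open scoped Classical in
-- Feasibility tests potentials of active components only, whereas the invariant bounds the dual
-- inside every vertex set. The gap is closed by cutting a set along the components.
theorem grow (h : s.Inv I p) (hp : ∀ v, 0 ≤ p v) {d : ℝ} (hd : 0 ≤ d)
    (hf : (s.grow d).Feasible I p) : (s.grow d).Inv I p := by
  have hy : ∀ S, S ∉ s.active → (s.grow d).y S = s.y S := by
    intro S hS; simp [GWState.grow, hS]
  have hnn : ∀ S, 0 ≤ (s.grow d).y S := by
    intro S
    simp only [GWState.grow]
    split_ifs
    · exact add_nonneg (h.y_nonneg S) hd
    · exact h.y_nonneg S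
  have hsupp : ∀ S, (s.grow d).y S ≠ 0 → S.Nonempty ∧ I.root ∉ S ∧ ∃ C ∈ s.comps, S ⊆ C := by
    intro S hS
    by_cases hSa : S ∈ s.active
    · exact ⟨h.comps_nonempty S (h.active_comps S hSa), h.active_root S hSa, S,
        h.active_comps S hSa, subset_rfl⟩
    · rw [hy S hSa] at hS
      exact h.y_supp S hS
  have hcongr : ∀ A : Finset (Fin n), (∀ C ∈ s.active, ¬ C ⊆ A) →
      ∑ R ∈ A.powerset, (s.grow d).y R = ∑ R ∈ A.powerset, s.y R := by
    intro A hA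
    refine Finset.sum_congr rfl fun R hR => hy R fun hRa => hA R hRa (Finset.mem_powerset.1 hR)
  refine
    { h with
      y_nonneg := hnn
      y_supp := hsupp
      paid_le := hf.1
      dual_le := ?_
      forest_tight := ?_
      label_tight := ?_ }
  · intro S
    refine (dual_decomp (s := s) _ hnn (fun S hS => (hsupp S hS).2.2) S).trans
      (le_trans (Finset.sum_le_sum fun C hC => ?_) (h.weight_decomp hp S))
    -- The piece `S ∩ C` contains a set that has grown only if it is the whole active component `C`.
    -- In all other cases its dual sum is the old one.
    by_cases hCa : C ∈ s.active ∧ C ⊆ S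
    · have := hf.2 C hCa.1
      rw [GWState.potential, sub_nonneg] at this
      rwa [Finset.inter_eq_right.2 hCa.2]
    · rw [hcongr]
      · exact h.dual_le _
      · intro D hD hDS
        have hDC := h.comp_subset (h.active_comps D hD) hC (hDS.trans Finset.inter_subset_right)
        subst hDC
        exact hCa ⟨hD, hDS.trans Finset.inter_subset_left⟩
  · intro e he
    rw [paid_grow, Finset.filter_false_of_mem, Finset.card_empty]
    · simpa using h.forest_tight e he
    · intro D hD
      exact h.not_cuts_forest he (h.active_comps D hD)
  -- A label inside an active component is a proper subset of it, so no subset of the label grows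
  -- and the label stays tight.
  · intro v A hA
    rw [hcongr]
    · exact h.label_tight v A hA
    · intro C hC hCA
      obtain ⟨D, hD, hAD, hne⟩ := h.label_comp v A hA
      have hCD := h.comp_subset (h.active_comps C hC) hD (hCA.trans hAD)
      subst hCD
      exact hne hC (Finset.Subset.antisymm hAD hCA)

theorem merge (h : s.Inv I p) {A B : Finset (Fin n)} {u v : Fin n} (hA : A ∈ s.comps)
    (hB : B ∈ s.comps) (hAB : A ≠ B) (hu : u ∈ A) (hv : v ∈ B) (huv : I.graph.Adj u v)
    (ht : s.paid s(u, v) = I.cost s(u, v)) : (s.merge I A B s(u, v)).Inv I p := by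
  have hdisj : ∀ x, x ∈ A → x ∉ B := fun x hxA hxB => hAB (h.comps_eq A hA B hB x hxA hxB)
  have hcomps : ∀ C, C ∈ (s.merge I A B s(u, v)).comps ↔
      C = A ∪ B ∨ (C ≠ B ∧ C ≠ A ∧ C ∈ s.comps) := by
    intro C; simp [GWState.merge]
  have hAB' : A ∪ B ∈ (s.merge I A B s(u, v)).comps := (hcomps _).2 (Or.inl rfl)
  have hact : ∀ C, C ∈ (s.merge I A B s(u, v)).active ↔
      (C = A ∪ B ∧ I.root ∉ A ∪ B) ∨ (C ≠ B ∧ C ≠ A ∧ C ∈ s.active) := by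
    intro C
    simp only [GWState.merge]
    split_ifs with hr <;> simp [hr]
  have hup : ∀ C ∈ s.comps, ∃ D ∈ (s.merge I A B s(u, v)).comps, C ⊆ D := by
    intro C hC
    by_cases hCA : C = A
    · exact ⟨A ∪ B, hAB', hCA ▸ Finset.subset_union_left⟩
    by_cases hCB : C = B
    · exact ⟨A ∪ B, hAB', hCB ▸ Finset.subset_union_right⟩
    exact ⟨C, (hcomps _).2 (Or.inr ⟨hCB, hCA, hC⟩), subset_rfl⟩
  have hgraph : SimpleGraph.fromEdgeSet ((s.merge I A B s(u, v)).forest : Set (Sym2 (Fin n))) =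
      SimpleGraph.fromEdgeSet (s.forest : Set (Sym2 (Fin n))) ⊔ SimpleGraph.edge u v := by
    simp only [GWState.merge, Finset.coe_insert]
    rw [Set.insert_eq, SimpleGraph.fromEdgeSet_union, sup_comm]
    rfl
  have hmono : SimpleGraph.fromEdgeSet (s.forest : Set (Sym2 (Fin n))) ≤
      SimpleGraph.fromEdgeSet ((s.merge I A B s(u, v)).forest : Set (Sym2 (Fin n))) :=
    hgraph ▸ le_sup_left
  have huvr : (SimpleGraph.fromEdgeSet
      ((s.merge I A B s(u, v)).forest : Set (Sym2 (Fin n)))).Reachable u v := by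
    refine SimpleGraph.Adj.reachable ?_
    rw [hgraph]
    simp [SimpleGraph.edge_adj, huv.ne]
  refine
    { h with
      y_supp := ?_
      comps_cover := ?_
      comps_nonempty := ?_
      comps_eq := ?_
      active_comps := ?_
      active_root := ?_
      forest_edge := ?_
      forest_tight := ?_
      forest_comp := ?_
      forest_conn := ?_
      forest_acyclic := ?_
      label_comp := ?_
      inactive := ?_ }
  · intro S hS
    obtain ⟨h1, h2, C, hC, h3⟩ := h.y_supp S hS
    obtain ⟨D, hD, h4⟩ := hup C hC
    exact ⟨h1, h2, D, hD, h3.trans h4⟩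
  · intro x
    obtain ⟨C, hC, hx⟩ := h.comps_cover x
    obtain ⟨D, hD, h4⟩ := hup C hC
    exact ⟨D, hD, h4 hx⟩
  · intro C hC
    rcases (hcomps C).1 hC with rfl | hC
    · exact ⟨u, by simp [hu]⟩
    · exact h.comps_nonempty C hC.2.2
  · intro C hC D hD x hxC hxD
    rcases (hcomps C).1 hC with rfl | ⟨hC1, hC2, hC3⟩ <;>
      rcases (hcomps D).1 hD with rfl | ⟨hD1, hD2, hD3⟩
    · rfl
    · rcases Finset.mem_union.1 hxC with hx | hx
      · exact absurd (h.comps_eq D hD3 A hA x hxD hx) hD2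
      · exact absurd (h.comps_eq D hD3 B hB x hxD hx) hD1
    · rcases Finset.mem_union.1 hxD with hx | hx
      · exact absurd (h.comps_eq C hC3 A hA x hxC hx) hC2
      · exact absurd (h.comps_eq C hC3 B hB x hxC hx) hC1
    · exact h.comps_eq C hC3 D hD3 x hxC hxD
  · intro C hC
    rcases (hact C).1 hC with ⟨rfl, -⟩ | ⟨h1, h2, h3⟩
    · exact hAB'
    · exact (hcomps C).2 (Or.inr ⟨h1, h2, h.active_comps C h3⟩)
  · intro C hC
    rcases (hact C).1 hC with ⟨rfl, hr⟩ | ⟨h1, h2, h3⟩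
    · exact hr
    · exact h.active_root C h3
  · intro e he
    rcases Finset.mem_insert.1 he with rfl | he
    · exact huv
    · exact h.forest_edge e he
  · intro e he
    rcases Finset.mem_insert.1 he with rfl | he
    · exact ht
    · exact h.forest_tight e he
  · intro e he
    rcases Finset.mem_insert.1 he with rfl | he
    · refine ⟨A ∪ B, hAB', fun x hx => ?_⟩
      rcases Sym2.mem_iff.1 hx with rfl | rfl
      · exact Finset.mem_union_left _ hu
      · exact Finset.mem_union_right _ hv
    · obtain ⟨C, hC, hCe⟩ := h.forest_comp e he
      obtain ⟨D, hD, hCD⟩ := hup C hC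
      exact ⟨D, hD, fun x hx => hCD (hCe x hx)⟩
  · intro C hC x hx y hy
    rcases (hcomps C).1 hC with rfl | hC
    · have key : ∀ z ∈ A ∪ B, (SimpleGraph.fromEdgeSet
          ((s.merge I A B s(u, v)).forest : Set (Sym2 (Fin n)))).Reachable u z := by
        intro z hz
        rcases Finset.mem_union.1 hz with hz | hz
        · exact (h.forest_conn A hA u hu z hz).mono hmono
        · exact huvr.trans ((h.forest_conn B hB v hv z hz).mono hmono)
      exact (key x hx).symm.trans (key y hy)
    · exact (h.forest_conn C hC.2.2 x hx y hy).mono hmono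
  -- No forest edge leaves the component `A`, so `v` is not reachable from `u` before the edge is
  -- added.
  · rw [hgraph]
    refine h.forest_acyclic.sup_edge_of_not_reachable fun hr => hdisj v ?_ hv
    refine hr.mem_of_closed (Z := (A : Set (Fin n))) hu fun x hx y hxy => ?_
    rw [SimpleGraph.fromEdgeSet_adj] at hxy
    obtain ⟨C, hC, hCe⟩ := h.forest_comp _ (Finset.mem_coe.1 hxy.1)
    have := h.comps_eq C hC A hA x (hCe x (by simp)) hx
    exact this ▸ hCe y (by simp)
  -- A label inside `A` misses `v` and a label inside `B` misses `u`, so it is proper in the union,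
  -- which may be active.
  · intro x S hS
    obtain ⟨C, hC, hSC, hne⟩ := h.label_comp x S hS
    by_cases hCA : C = A
    · refine ⟨A ∪ B, hAB', hSC.trans (hCA ▸ Finset.subset_union_left), fun _ he => ?_⟩
      exact hdisj v (hCA ▸ hSC (he ▸ Finset.mem_union_right _ hv)) hv
    by_cases hCB : C = B
    · refine ⟨A ∪ B, hAB', hSC.trans (hCB ▸ Finset.subset_union_right), fun _ he => ?_⟩
      exact hdisj u hu (hCB ▸ hSC (he ▸ Finset.mem_union_left _ hu))
    refine ⟨C, (hcomps _).2 (Or.inr ⟨hCB, hCA, hC⟩), hSC, fun hCact => ?_⟩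
    rcases (hact C).1 hCact with ⟨rfl, -⟩ | h3
    · exact absurd (h.comp_subset hA hC Finset.subset_union_left).symm hCA
    · exact hne h3.2.2
  · intro C hC hCa hr
    rcases (hcomps C).1 hC with rfl | ⟨h1, h2, h3⟩
    · exact absurd ((hact _).2 (Or.inl ⟨rfl, hr⟩)) hCa
    · exact h.inactive C h3 (fun h4 => hCa ((hact C).2 (Or.inr ⟨h1, h2, h4⟩))) hr

theorem deactivate (h : s.Inv I p) {S : Finset (Fin n)} (hS : S ∈ s.active)
    (hpot : s.potential p S = 0) : (s.deactivate S).Inv I p := by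
  have hSc := h.active_comps S hS
  have hold : ∀ w A, s.label w = some A → (s.deactivate S).label w = some A := by
    intro w A hw
    simp [GWState.deactivate, hw]
  have hlab : ∀ w A, (s.deactivate S).label w = some A →
      s.label w = some A ∨ (w ∈ S ∧ A = S) := by
    intro w A hw
    simp only [GWState.deactivate] at hw
    split_ifs at hw with hc
    · exact Or.inr ⟨hc.1, (Option.some.inj hw).symm⟩
    · exact Or.inl hw
  -- An older label lies in the current component of its vertex, and for a vertex of `S` this is
  -- `S`.
  have hfull : ∀ w ∈ S, ∃ B, B ⊆ S ∧ (s.deactivate S).label w = some B := by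
    intro w hw
    rcases hl : s.label w with _ | B
    · exact ⟨S, subset_rfl, by simp [GWState.deactivate, hw, hl]⟩
    · obtain ⟨C, hC, hBC, -⟩ := h.label_comp w B hl
      have := h.comps_eq C hC S hSc w (hBC (h.label_mem w B hl)) hw
      exact ⟨B, this ▸ hBC, hold w B hl⟩
  refine
    { h with
      active_comps := fun C hC => h.active_comps C (Finset.mem_of_mem_erase hC)
      active_root := fun C hC => h.active_root C (Finset.mem_of_mem_erase hC)
      label_mem := ?_
      label_root := ?_
      label_tight := ?_
      label_sub := ?_
      label_comp := ?_
      inactive := ?_ }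
  · intro w A hw
    rcases hlab w A hw with hw | ⟨hw, rfl⟩
    · exact h.label_mem w A hw
    · exact hw
  · intro w A hw
    rcases hlab w A hw with hw | ⟨hw, rfl⟩
    · exact h.label_root w A hw
    · exact h.active_root _ hS
  · intro w A hw
    rcases hlab w A hw with hw | ⟨hw, rfl⟩
    · exact h.label_tight w A hw
    · rw [GWState.potential, sub_eq_zero] at hpot
      exact hpot.symm
  · intro w A hw x hx
    rcases hlab w A hw with hw | ⟨hw, rfl⟩
    · obtain ⟨B, hB, hxB⟩ := h.label_sub w A hw x hx
      exact ⟨B, hB, hold x B hxB⟩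
    · exact hfull x hx
  · intro w A hw
    rcases hlab w A hw with hw | ⟨hw, rfl⟩
    · obtain ⟨C, hC, hAC, hne⟩ := h.label_comp w A hw
      exact ⟨C, hC, hAC, fun hCa => hne (Finset.mem_of_mem_erase hCa)⟩
    · exact ⟨_, hSc, subset_rfl, fun hCa => absurd hCa (by simp [GWState.deactivate])⟩
  · intro C hC hCa hr w hw
    by_cases hCS : C = S
    · subst hCS
      exact hfull w hw
    · obtain ⟨B, hB, hwB⟩ := h.inactive C hC
        (fun h1 => hCa (Finset.mem_erase.2 ⟨hCS, h1⟩)) hr w hw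
      exact ⟨B, hB, hold w B hwB⟩

theorem step (h : s.Inv I p) (hp : ∀ v, 0 ≤ p v) {s' : GWState n} (hs : GWStep I p s s') :
    s'.Inv I p := by
  cases hs with
  | merge d A B u v hd hf hA hB hAB hact hu hv huv ht =>
    exact (h.grow hp hd hf).merge hA hB hAB hu hv huv ht
  | deactivate d S hd hf hS he =>
    exact (h.grow hp hd hf).deactivate hS he

theorem run (h : s.Inv I p) (hp : ∀ v, 0 ≤ p v) {s' : GWState n}
    (hs : Relation.ReflTransGen (GWStep I p) s s') : s'.Inv I p := by
  induction hs with
  | refl => exact h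
  | tail _ hstep ih => exact ih.step hp hstep

theorem of_run (hp : ∀ v, 0 ≤ p v) (hs : Relation.ReflTransGen (GWStep I p) I.gwStart s) :
    s.Inv I p :=
  (start I p hp).run hp hs

end GWState.Inv

end PCST

/-! ### Edges of the output against active components: the factor two -/

namespace PCST

variable {n : ℕ} {I : PCST n} {p : Fin n → ℝ}

theorem GWStep.label_mono {s s' : GWState n} (hs : GWStep I p s s') {v : Fin n}
    {A : Finset (Fin n)} (h : s.label v = some A) : s'.label v = some A := by
  cases hs with
  | merge d A B u v hd hf hA hB hAB hact hu hv huv ht => exact h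
  | deactivate d S hd hf hS he => simp [GWState.deactivate, GWState.grow, h]

theorem label_mono_of_run {s s' : GWState n} (hs : Relation.ReflTransGen (GWStep I p) s s')
    {v : Fin n} {A : Finset (Fin n)} (h : s.label v = some A) : s'.label v = some A := by
  induction hs with
  | refl => exact h
  | tail _ hstep ih => exact hstep.label_mono ih

open scoped Classical in
/-- The edges of the final tree that are still to be bought are at most as many as the non-root
components that meet the tree. -/
theorem card_edges_le_card_comps (hp : ∀ v, 0 ≤ p v) {s sf : GWState n} (h : s.Inv I p)
    (hs : Relation.ReflTransGen (GWStep I p) s sf) {F : Finset (Sym2 (Fin n))}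
    (hF : F ⊆ sf.forest) (hFr : ∀ e ∈ F, ∀ v ∈ e, I.RootConnected F v) :
    (F \ s.forest).card ≤
      (s.comps.filter fun C => I.root ∉ C ∧ ∃ v ∈ C, I.RootConnected F v).card := by
  -- The induction runs backwards from the final state, where all of `F` lies in the forest and no
  -- edge remains to be bought.
  induction hs using Relation.ReflTransGen.head_induction_on with
  | refl => simp [Finset.sdiff_eq_empty_iff_subset.2 hF]
  | head hstep _ ih =>
    have ih := ih (h.step hp hstep)
    cases hstep with
    | deactivate d S hd hf hS he => exact ih
    | merge d A B u v hd hf hA hB hAB hact hu hv huv ht =>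
      rename_i s _ _
      have hA' : A ∈ s.comps := hA
      have hB' : B ∈ s.comps := hB
      have hdisj : ∀ x, x ∈ A → x ∉ B := fun x hxA hxB => hAB (h.comps_eq A hA' B hB' x hxA hxB)
      set m : Finset (Fin n) → ℕ :=
        fun C => if I.root ∉ C ∧ ∃ v ∈ C, I.RootConnected F v then 1 else 0 with hm
      rw [Finset.card_filter] at ih ⊢
      have e1 : ∑ C ∈ s.comps, m C = m A + (m B + ∑ C ∈ (s.comps.erase A).erase B, m C) := by
        rw [Finset.add_sum_erase _ _ (Finset.mem_erase.2 ⟨hAB.symm, hB'⟩),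
          Finset.add_sum_erase _ _ hA']
      have e2 : ∑ C ∈ insert (A ∪ B) ((s.comps.erase A).erase B), m C ≤
          m (A ∪ B) + ∑ C ∈ (s.comps.erase A).erase B, m C := by
        by_cases hin : A ∪ B ∈ (s.comps.erase A).erase B
        · rw [Finset.insert_eq_of_mem hin]; omega
        · rw [Finset.sum_insert hin]
      have e3 : (F \ s.forest).card ≤ (F \ insert s(u, v) s.forest).card +
          if s(u, v) ∈ F then 1 else 0 := by
        split_ifs with he
        · refine (Finset.card_le_card (t := insert s(u, v) (F \ insert s(u, v) s.forest))
            fun x hx => ?_).trans (Finset.card_insert_le _ _)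
          simp only [Finset.mem_insert, Finset.mem_sdiff] at hx ⊢
          tauto
        · refine Finset.card_le_card fun x hx => ?_
          simp only [Finset.mem_insert, Finset.mem_sdiff] at hx ⊢
          refine ⟨hx.1, ?_⟩
          rintro (rfl | h1)
          · exact he hx.1
          · exact hx.2 h1
      -- If the edge is in `F`, both components meet the tree and at most one holds the root.
      -- Merging them lowers the count by one, which pays for the edge.
      have e4 : m (A ∪ B) + (if s(u, v) ∈ F then 1 else 0) ≤ m A + m B := by
        simp only [hm]
        by_cases he : s(u, v) ∈ F
        · have h1 : ∃ x ∈ A, I.RootConnected F x := ⟨u, hu, hFr _ he u (by simp)⟩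
          have h2 : ∃ x ∈ B, I.RootConnected F x := ⟨v, hv, hFr _ he v (by simp)⟩
          simp only [he, h1, h2, and_true, if_true, Finset.mem_union]
          by_cases hrA : I.root ∈ A
          · simp [hrA, hdisj _ hrA]
          · by_cases hrB : I.root ∈ B
            · simp [hrA, hrB]
            · simp only [hrA, hrB, or_self, not_false_eq_true, true_and, if_true]
              split_ifs <;> omega
        · simp only [he, if_false, add_zero, Finset.mem_union]
          by_cases h3 : (¬ (I.root ∈ A ∨ I.root ∈ B)) ∧ ∃ x, (x ∈ A ∨ x ∈ B) ∧
            I.RootConnected F x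
          · obtain ⟨hr, x, hx, hxr⟩ := id h3
            push Not at hr
            rw [if_pos h3]
            rcases hx with hx | hx
            · rw [if_pos ⟨hr.1, x, hx, hxr⟩]; omega
            · rw [if_pos (c := _ ∧ ∃ y ∈ B, _) ⟨hr.2, x, hx, hxr⟩]; omega
          · rw [if_neg h3]; omega
      change (F \ insert s(u, v) s.forest).card ≤
        ∑ C ∈ insert (A ∪ B) ((s.comps.erase A).erase B), m C at ih
      change _ ≤ ∑ C ∈ s.comps, m C
      omega

theorem RootConnected.mono {F F' : Finset (Sym2 (Fin n))} (hF : F ⊆ F') {v : Fin n}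
    (h : I.RootConnected F v) : I.RootConnected F' v :=
  SimpleGraph.Reachable.mono (SimpleGraph.fromEdgeSet_mono (Finset.coe_subset.2 hF)) h

theorem rootConnected_root (F : Finset (Sym2 (Fin n))) : I.RootConnected F I.root :=
  SimpleGraph.Reachable.refl _

theorem RootConnected.of_mem {F : Finset (Sym2 (Fin n))} {u v : Fin n}
    (h : I.RootConnected F u) (he : s(u, v) ∈ F) : I.RootConnected F v := by
  by_cases huv : u = v
  · exact huv ▸ h
  · exact h.trans (SimpleGraph.Adj.reachable (by simp [huv, he]))

theorem RootConnected.mem_of_closed {F : Finset (Sym2 (Fin n))} {v : Fin n}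
    (h : I.RootConnected F v) {Z : Set (Fin n)} (hr : I.root ∈ Z)
    (hZ : ∀ x ∈ Z, ∀ y, s(x, y) ∈ F → y ∈ Z) : v ∈ Z := by
  refine SimpleGraph.Reachable.mem_of_closed h hr fun x hx y hxy => hZ x hx y ?_
  rw [SimpleGraph.fromEdgeSet_adj] at hxy
  exact Finset.mem_coe.1 hxy.1

open scoped Classical in
/-- In a minimal solution of the deletion phase, an inactive component that meets the tree is not a
leaf. -/
theorem two_le_card_cut {s sf : GWState n} (h : s.Inv I p) (hsf : sf.Inv I p)
    (hs : Relation.ReflTransGen (GWStep I p) s sf) {F : Finset (Sym2 (Fin n))}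
    (hF : Minimal (fun F' => F' ⊆ sf.forest ∧ I.KeepsRequired sf F') F)
    {C : Finset (Fin n)} (hC : C ∈ s.comps) (hCa : C ∉ s.active) (hr : I.root ∉ C)
    (hCF : ∃ v ∈ C, I.RootConnected F v) : 2 ≤ (F.filter fun e => Cuts C e).card := by
  obtain ⟨v, hvC, hv⟩ := hCF
  have hpos : (F.filter fun e => Cuts C e).Nonempty := by
    by_contra hne
    rw [Finset.not_nonempty_iff_eq_empty, Finset.filter_eq_empty_iff] at hne
    refine (hv.mem_of_closed (Z := {x | x ∉ C}) hr fun x hx y hxy hy => ?_) hvC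
    exact hne hxy ⟨y, hy, x, hx, Sym2.eq_swap⟩
  by_contra hlt
  have hcard : (F.filter fun e => Cuts C e).card = 1 := by
    have := Finset.card_pos.2 hpos
    omega
  obtain ⟨e, he⟩ := Finset.card_eq_one.1 hcard
  have heF : e ∈ F ∧ Cuts C e := by
    have : e ∈ F.filter fun e => Cuts C e := by simp [he]
    simpa using this
  have huniq : ∀ f ∈ F, Cuts C f → f = e := by
    intro f hf hfC
    have : f ∈ F.filter fun e => Cuts C e := by simp [hf, hfC]
    simpa [he] using this
  have hout : ∀ x, I.RootConnected (F.erase e) x → x ∉ C := by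
    intro x hx
    refine hx.mem_of_closed (Z := {x | x ∉ C}) hr fun x hx y hxy hy => ?_
    rw [Finset.mem_erase] at hxy
    exact hxy.1 (huniq _ hxy.2 ⟨y, hy, x, hx, Sym2.eq_swap⟩)
  obtain ⟨heF, a, ha, b, hb, rfl⟩ := heF
  -- The tree enters `C` only through this edge, so its outer end is reached without it.
  have hbr : I.RootConnected (F.erase s(a, b)) b := by
    by_contra hbr
    refine hout v (hv.mem_of_closed (Z := {x | I.RootConnected (F.erase s(a, b)) x})
      (rootConnected_root _) fun x hx y hxy => ?_) hvC
    by_cases hf : s(x, y) = s(a, b)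
    · rcases Sym2.eq_iff.1 hf with ⟨rfl, rfl⟩ | ⟨rfl, rfl⟩
      · exact absurd ha (hout _ hx)
      · exact absurd hx hbr
    · exact RootConnected.of_mem hx (Finset.mem_erase.2 ⟨hf, hxy⟩)
  -- With a single crossing edge, nothing outside `C` is reached by passing through `C`.
  have hiff : ∀ x, I.RootConnected F x → x ∉ C → I.RootConnected (F.erase s(a, b)) x := by
    intro x hx hxC
    have : x ∈ {x | I.RootConnected (F.erase s(a, b)) x} ∪ (C : Set (Fin n)) := by
      refine hx.mem_of_closed (Or.inl (rootConnected_root _)) fun x hx y hxy => ?_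
      by_cases hf : s(x, y) = s(a, b)
      · rcases Sym2.eq_iff.1 hf with ⟨rfl, rfl⟩ | ⟨rfl, rfl⟩
        · exact Or.inl hbr
        · exact Or.inr ha
      · rcases hx with hx | hx
        · exact Or.inl (RootConnected.of_mem hx (Finset.mem_erase.2 ⟨hf, hxy⟩))
        · refine Or.inr ?_
          by_contra hy
          exact hf (huniq _ hxy ⟨x, hx, y, hy, rfl⟩)
    exact this.resolve_right hxC
  have hlabC := h.inactive C hC hCa hr
  -- Every vertex of `C` has a label contained in `C`. It could be required only because of a
  -- connected vertex with a smaller label; that vertex would lie in `C`, where nothing is connected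
  -- any more. So the edge can be deleted, against minimality.
  have hkeep : I.KeepsRequired sf (F.erase s(a, b)) := by
    refine ⟨fun x hx => hiff x (hF.prop.2.1 x hx) fun hxC => ?_,
      fun x w A B hA hB hAB hx => hiff w (hF.prop.2.2 x w A B hA hB hAB
        (hx.mono (Finset.erase_subset _ _))) fun hwC => ?_⟩
    · obtain ⟨B, -, hB⟩ := hlabC x hxC
      rw [label_mono_of_run hs hB] at hx
      cases hx
    · obtain ⟨B', hB'C, hB'⟩ := hlabC w hwC
      rw [label_mono_of_run hs hB'] at hB
      cases hB
      exact hout x hx (hB'C (hAB (hsf.label_mem x A hA)))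
  have := hF.le_of_le ⟨(Finset.erase_subset _ _).trans hF.prop.1, hkeep⟩ (Finset.erase_subset _ _)
  exact absurd (this heF) (Finset.notMem_erase _ _)

open scoped Classical in
theorem card_cuts_le_two {s : GWState n} (h : s.Inv I p) (e : Sym2 (Fin n)) :
    (s.comps.filter fun C => Cuts C e).card ≤ 2 := by
  induction e using Sym2.ind with
  | _ u v =>
    obtain ⟨A, hA, huA⟩ := h.comps_cover u
    obtain ⟨B, hB, hvB⟩ := h.comps_cover v
    refine (Finset.card_le_card (t := {A, B}) fun C hC => ?_).trans Finset.card_le_two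
    simp only [Finset.mem_filter] at hC
    obtain ⟨hC, a, ha, b, hb, hab⟩ := hC
    simp only [Finset.mem_insert, Finset.mem_singleton]
    rcases Sym2.eq_iff.1 hab with ⟨rfl, rfl⟩ | ⟨rfl, rfl⟩
    · exact Or.inl (h.comps_eq C hC A hA _ ha huA)
    · exact Or.inr (h.comps_eq C hC B hB _ ha hvB)

open scoped Classical in
/-- The average degree of the active components in the final tree is at most two. -/
theorem sum_card_cut_active_le (hp : ∀ v, 0 ≤ p v) {s sf : GWState n} (h : s.Inv I p)
    (hs : Relation.ReflTransGen (GWStep I p) s sf) (hsf : sf.Inv I p)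
    {F : Finset (Sym2 (Fin n))}
    (hF : Minimal (fun F' => F' ⊆ sf.forest ∧ I.KeepsRequired sf F') F)
    (hFr : ∀ e ∈ F, ∀ v ∈ e, I.RootConnected F v) :
    ∑ C ∈ s.active, (F.filter fun e => Cuts C e).card ≤ 2 * s.active.card := by
  have h1 := card_edges_le_card_comps hp h hs hF.prop.1 hFr
  set X := s.comps.filter fun C => I.root ∉ C ∧ ∃ v ∈ C, I.RootConnected F v with hX
  have h2 : ∑ C ∈ s.comps, (F.filter fun e => Cuts C e).card ≤ 2 * (F \ s.forest).card := by
    have : ∀ C ∈ s.comps, (F.filter fun e => Cuts C e).card =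
        ((F \ s.forest).filter fun e => Cuts C e).card := by
      intro C hC
      congr 1
      ext e
      simp only [Finset.mem_filter, Finset.mem_sdiff]
      refine ⟨fun he => ⟨⟨he.1, fun hef => h.not_cuts_forest hef hC he.2⟩, he.2⟩,
        fun he => ⟨he.1.1, he.2⟩⟩
    rw [Finset.sum_congr rfl this]
    simp_rw [Finset.card_filter]
    rw [Finset.sum_comm]
    simp_rw [← Finset.card_filter]
    refine (Finset.sum_le_card_nsmul _ _ 2 fun e _ => card_cuts_le_two h e).trans ?_
    rw [smul_eq_mul, mul_comm]
  have h3 : ∑ C ∈ s.active, (F.filter fun e => Cuts C e).card +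
      ∑ C ∈ X \ s.active, (F.filter fun e => Cuts C e).card ≤
      ∑ C ∈ s.comps, (F.filter fun e => Cuts C e).card := by
    rw [← Finset.sum_union Finset.disjoint_sdiff]
    refine Finset.sum_le_sum_of_subset fun C hC => ?_
    simp only [hX, Finset.mem_union, Finset.mem_sdiff, Finset.mem_filter] at hC
    rcases hC with hC | hC
    · exact h.active_comps C hC
    · exact hC.1.1
  -- The degrees of all components sum to at most `2 * X.card`. The inactive ones in `X` use up two
  -- each, which leaves at most two per active component, whether or not it meets the tree.
  have h4 : 2 * (X \ s.active).card ≤ ∑ C ∈ X \ s.active, (F.filter fun e => Cuts C e).card := by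
    rw [mul_comm, ← smul_eq_mul]
    refine Finset.card_nsmul_le_sum _ _ _ fun C hC => ?_
    simp only [hX, Finset.mem_sdiff, Finset.mem_filter] at hC
    exact two_le_card_cut h hsf hs hF hC.1.1 hC.2 hC.1.2.1 hC.1.2.2
  have h5 : X.card ≤ (X \ s.active).card + s.active.card := by
    have := Finset.le_card_sdiff s.active X
    omega
  omega

open scoped Classical in
-- When the active duals rise by `d`, the left side gains `d` times the sum of the degrees of the
-- active components in `F`, and the right side gains `2 * d` per active component. `F` comes from
-- the final state, but the degree bound holds for it at every intermediate state.
theorem sum_paid_le (hp : ∀ v, 0 ≤ p v) {s sf : GWState n}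
    (h0 : Relation.ReflTransGen (GWStep I p) I.gwStart s)
    (hs : Relation.ReflTransGen (GWStep I p) s sf)
    {F : Finset (Sym2 (Fin n))}
    (hF : Minimal (fun F' => F' ⊆ sf.forest ∧ I.KeepsRequired sf F') F)
    (hFr : ∀ e ∈ F, ∀ v ∈ e, I.RootConnected F v) :
    ∑ e ∈ F, s.paid e ≤ 2 * ∑ S, s.y S := by
  have hgrow : ∀ (s : GWState n) (d : ℝ), s.Inv I p → 0 ≤ d →
      Relation.ReflTransGen (GWStep I p) s sf →
      ∑ e ∈ F, s.paid e ≤ 2 * ∑ S, s.y S →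
      ∑ e ∈ F, (s.grow d).paid e ≤ 2 * ∑ S, (s.grow d).y S := by
    intro s d h hd hs hle
    have hsf : sf.Inv I p := h.run hp hs
    have hdeg := sum_card_cut_active_le hp h hs hsf hF hFr
    simp_rw [GWState.Inv.paid_grow]
    rw [Finset.sum_add_distrib, ← Finset.mul_sum]
    have e1 : ∑ e ∈ F, ((s.active.filter fun S => Cuts S e).card : ℝ) =
        ((∑ C ∈ s.active, (F.filter fun e => Cuts C e).card : ℕ) : ℝ) := by
      rw [← Nat.cast_sum]
      congr 1
      simp_rw [Finset.card_filter]
      rw [Finset.sum_comm]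
    have e2 : ∑ S, (s.grow d).y S = ∑ S, s.y S + d * s.active.card := by
      have : ∀ S, (s.grow d).y S = s.y S + if S ∈ s.active then d else 0 := by
        intro S; simp only [GWState.grow]; split_ifs <;> simp
      simp_rw [this]
      rw [Finset.sum_add_distrib, Finset.sum_ite_mem, Finset.univ_inter, Finset.sum_const,
        nsmul_eq_mul, mul_comm d]
    rw [e1, e2]
    have := mul_le_mul_of_nonneg_left (Nat.cast_le (α := ℝ).2 hdeg) hd
    push_cast at this ⊢
    linarith
  induction h0 with
  | refl => simp [GWState.paid, gwStart]
  | tail h1 hstep ih =>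
    have ih := ih (Relation.ReflTransGen.head hstep hs)
    have hi := GWState.Inv.of_run hp h1
    cases hstep with
    | merge d A B u v hd hf hA hB hAB hact hu hv huv ht =>
      exact hgrow _ d hi hd
        (Relation.ReflTransGen.head (GWStep.merge _ d A B u v hd hf hA hB hAB hact hu hv huv ht) hs)
        ih
    | deactivate d S hd hf hS he =>
      exact hgrow _ d hi hd
        (Relation.ReflTransGen.head (GWStep.deactivate _ d S hd hf hS he) hs) ih

end PCST

/-! ### Weak duality and the approximation guarantees -/

namespace PCST

variable {n : ℕ} {I : PCST n} {p : Fin n → ℝ}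

/-- Uncrossing: the dual sum over subsets is supermodular, the penalty sum is modular, and `dual_le`
controls the intersection. -/
theorem sum_union_le_of_tight {s : GWState n} (h : s.Inv I p) {A B : Finset (Fin n)}
    (hA : ∑ x ∈ A, p x ≤ ∑ R ∈ A.powerset, s.y R) (hB : ∑ x ∈ B, p x ≤ ∑ R ∈ B.powerset, s.y R) :
    ∑ x ∈ A ∪ B, p x ≤ ∑ R ∈ (A ∪ B).powerset, s.y R := by
  have h1 := Finset.sum_union_inter (s₁ := A) (s₂ := B) (f := p)
  have h2 := Finset.sum_union_inter (s₁ := A.powerset) (s₂ := B.powerset) (f := s.y)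
  have h3 : A.powerset ∩ B.powerset = (A ∩ B).powerset := by
    ext R; simp only [Finset.mem_inter, Finset.mem_powerset, Finset.subset_inter_iff]
  have h4 : ∑ R ∈ A.powerset ∪ B.powerset, s.y R ≤ ∑ R ∈ (A ∪ B).powerset, s.y R := by
    refine Finset.sum_le_sum_of_subset_of_nonneg (fun R hR => ?_) fun R _ _ => h.y_nonneg R
    simp only [Finset.mem_union, Finset.mem_powerset] at hR ⊢
    rcases hR with hR | hR
    · exact hR.trans Finset.subset_union_left
    · exact hR.trans Finset.subset_union_right
  have h5 := h.dual_le (A ∩ B)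
  rw [h3] at h2
  linarith

open scoped Classical in
/-- The vertices that are not connected to the root have spent all their potential. -/
theorem sum_disconnected_le {s : GWState n} (h : s.Inv I p) {F : Finset (Sym2 (Fin n))}
    (hF : I.KeepsRequired s F) :
    ∑ v with ¬ I.RootConnected F v, p v ≤
      ∑ R ∈ (Finset.univ.filter fun v => ¬ I.RootConnected F v).powerset, s.y R := by
  set N := Finset.univ.filter fun v => ¬ I.RootConnected F v with hN
  have key : ∀ V : Finset (Fin n), V ⊆ N →
      ∑ x ∈ V.biUnion (fun v => (s.label v).getD ∅), p x ≤
        ∑ R ∈ (V.biUnion fun v => (s.label v).getD ∅).powerset, s.y R := by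
    intro V
    induction V using Finset.induction_on with
    | empty => intro _; simpa using h.y_nonneg ∅
    | insert v V _ ih =>
      intro hV
      rw [Finset.biUnion_insert]
      refine sum_union_le_of_tight h ?_ (ih ((Finset.subset_insert _ _).trans hV))
      rcases hl : s.label v with _ | A
      · simpa using h.y_nonneg ∅
      · exact (h.label_tight v A hl).ge
  -- If the label of `v` contained a connected vertex, the label of that vertex would be a subset of
  -- it, and the condition of the deletion phase would connect `v` as well.
  have hU : N.biUnion (fun v => (s.label v).getD ∅) = N := by
    ext x
    simp only [Finset.mem_biUnion, hN, Finset.mem_filter, Finset.mem_univ, true_and]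
    constructor
    · rintro ⟨v, hv, hx⟩ hxr
      rcases hl : s.label v with _ | A
      · simp [hl] at hx
      · simp only [hl, Option.getD_some] at hx
        obtain ⟨B, hBA, hB⟩ := h.label_sub v A hl x hx
        exact hv (hF.2 x v B A hB hl hBA hxr)
    · intro hx
      refine ⟨x, hx, ?_⟩
      rcases hl : s.label x with _ | A
      · exact absurd (hF.1 x hl) hx
      · simpa using h.label_mem x A hl
  have := key N subset_rfl
  rwa [hU] at this

open scoped Classical in
/-- The dual variables of the sets that meet a solution are paid for by its edges. -/
theorem sum_meeting_le_length {s : GWState n} (h : s.Inv I p) {T : I.graph.Subgraph}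
    (hT : I.IsSolution T) :
    ∑ R with ∃ v ∈ R, v ∈ T.verts, s.y R ≤ I.length T := by
  -- Support sets avoid the root, so the path in `T` from a vertex of `R` to the root has to leave
  -- `R`.
  have hcut : ∀ R, s.y R ≠ 0 → (∃ v ∈ R, v ∈ T.verts) → ∃ e ∈ T.edgeSet, Cuts R e := by
    rintro R hR ⟨v, hvR, hvT⟩
    have hroot := (h.y_supp R hR).2.1
    by_contra hne
    have hr := hT.2.connected.preconnected ⟨v, hvT⟩ ⟨I.root, hT.1⟩
    refine hroot (hr.mem_of_closed (Z := {x | x.1 ∈ R}) hvR fun x hx y hxy => ?_)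
    by_contra hy
    exact hne ⟨s(x.1, y.1), hxy, x.1, hx, y.1, hy, rfl⟩
  have h1 : ∑ R with ∃ v ∈ R, v ∈ T.verts, s.y R ≤ ∑ e with e ∈ T.edgeSet, s.paid e := by
    simp only [GWState.paid]
    simp_rw [Finset.sum_filter (fun S => Cuts S _)]
    rw [Finset.sum_comm, Finset.sum_filter]
    refine Finset.sum_le_sum fun R _ => ?_
    have hnn : ∀ e ∈ Finset.univ.filter (fun e => e ∈ T.edgeSet),
        0 ≤ if Cuts R e then s.y R else 0 := by
      intro e _; split_ifs <;> simp [h.y_nonneg]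
    split_ifs with hm
    · by_cases hR : s.y R = 0
      · simp [hR]
      · obtain ⟨e, he, hc⟩ := hcut R hR hm
        have := Finset.single_le_sum hnn (Finset.mem_filter.2 ⟨Finset.mem_univ e, he⟩)
        simpa [hc] using this
    · exact Finset.sum_nonneg hnn
  refine h1.trans (Finset.sum_le_sum fun e he => h.paid_le e ?_)
  exact T.edgeSet_subset (Finset.mem_filter.1 he).2

open scoped Classical in
-- Weak duality localised to `N`. With `N` everything it bounds the whole dual by the scaled cost of
-- a solution; with `N` the vertices left out of the output it isolates the penalties lost there.
theorem sum_y_powerset_le {s : GWState n} (h : s.Inv I p) {T : I.graph.Subgraph}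
    (hT : I.IsSolution T) (N : Finset (Fin n)) :
    ∑ R ∈ N.powerset, s.y R ≤ I.length T + ∑ v ∈ N with v ∉ T.verts, p v := by
  rw [← Finset.sum_filter_add_sum_filter_not N.powerset fun R => ∃ v ∈ R, v ∈ T.verts]
  refine add_le_add ((Finset.sum_le_sum_of_subset_of_nonneg (fun R hR => ?_)
    fun R _ _ => h.y_nonneg R).trans (sum_meeting_le_length h hT)) ?_
  · simpa using (Finset.mem_filter.1 hR).2
  · refine (Finset.sum_le_sum_of_subset_of_nonneg (fun R hR => ?_)
      fun R _ _ => h.y_nonneg R).trans (h.dual_le _)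
    simp only [Finset.mem_filter, Finset.mem_powerset, not_exists, not_and] at hR ⊢
    exact fun v hv => Finset.mem_filter.2 ⟨hR.1 hv, hR.2 v hv⟩

theorem isSolution_of_edgeSet {s : GWState n} (h : s.Inv I p) {F : Finset (Sym2 (Fin n))}
    (hF : F ⊆ s.forest) {T : I.graph.Subgraph} (hTe : T.edgeSet = (F : Set (Sym2 (Fin n))))
    (hTv : T.verts = {v | I.RootConnected F v}) : I.IsSolution T := by
  have hroot : I.root ∈ T.verts := by
    rw [hTv]; exact rootConnected_root F
  refine ⟨hroot, ?_⟩
  have hadj : ∀ {x y}, s(x, y) ∈ F → T.Adj x y := by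
    intro x y hxy
    rw [← SimpleGraph.Subgraph.mem_edgeSet, hTe]
    exact hxy
  have hreach : ∀ v, ∀ hv : v ∈ T.verts, T.coe.Reachable ⟨I.root, hroot⟩ ⟨v, hv⟩ := by
    intro v hv
    have hv' : I.RootConnected F v := by rwa [hTv] at hv
    have := hv'.mem_of_closed
      (Z := {x | ∃ hx : x ∈ T.verts, T.coe.Reachable ⟨I.root, hroot⟩ ⟨x, hx⟩})
      ⟨hroot, SimpleGraph.Reachable.refl _⟩ ?_
    · obtain ⟨_, h⟩ := this
      exact h
    · rintro x ⟨hx, hxr⟩ y hxy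
      have ha := hadj hxy
      exact ⟨T.edge_vert ha.symm, hxr.trans (SimpleGraph.Adj.reachable (by simpa using ha))⟩
  constructor
  · have : Nonempty T.verts := ⟨⟨I.root, hroot⟩⟩
    exact ⟨fun a b => (hreach a a.2).symm.trans (hreach b b.2)⟩
  · refine SimpleGraph.IsAcyclic.comap
      (G' := SimpleGraph.fromEdgeSet (s.forest : Set (Sym2 (Fin n))))
      ⟨fun x => x.1, fun {x y} hxy => ?_⟩ Subtype.val_injective h.forest_acyclic
    have hxy : T.Adj x.1 y.1 := by simpa using hxy
    rw [SimpleGraph.fromEdgeSet_adj]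
    refine ⟨hF ?_, hxy.ne⟩
    rw [← SimpleGraph.Subgraph.mem_edgeSet, hTe] at hxy
    exact hxy

open scoped Classical in
theorem exists_opt {T : I.graph.Subgraph} (hT : I.IsSolution T) :
    ∃ S : I.graph.Subgraph, I.IsSolution S ∧ I.opt = I.totalCost S := by
  have hfin : {x : ℝ | ∃ T : I.graph.Subgraph, I.IsSolution T ∧ x = I.totalCost T}.Finite :=
    (Set.finite_range I.totalCost).subset (by rintro x ⟨T, -, rfl⟩; exact ⟨T, rfl⟩)
  exact Set.Nonempty.csInf_mem (s := {x : ℝ | ∃ T : I.graph.Subgraph, I.IsSolution T ∧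
    x = I.totalCost T}) ⟨_, T, hT, rfl⟩ hfin

theorem length_nonneg (T : I.graph.Subgraph) : 0 ≤ I.length T := by
  classical
  refine Finset.sum_nonneg fun e he => I.cost_nonneg e (T.edgeSet_subset ?_)
  exact (Finset.mem_filter.1 he).2

theorem penaltyOutside_nonneg (U : Set (Fin n)) : 0 ≤ I.penaltyOutside U :=
  Finset.sum_nonneg fun v _ => I.penalty_nonneg v

/-- Deleting vertices of degree at most one, other than the root, from a solution. -/
theorem isSolution_delete_leaves {S : I.graph.Subgraph} (hS : I.IsSolution S) (X : Set (Fin n))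
    (hr : I.root ∉ X) (hX : ∀ v ∈ X, (I.graph.neighborSet v).ncard ≤ 1) :
    I.IsSolution (S.deleteVerts X) := by
  have hroot : I.root ∈ (S.deleteVerts X).verts := ⟨hS.1, hr⟩
  have huniq : ∀ v ∈ X, ∀ x y, I.graph.Adj v x → I.graph.Adj v y → x = y := by
    intro v hv x y hx hy
    exact (Set.ncard_le_one (Set.toFinite _)).1 (hX v hv) x hx y hy
  have hreach : ∀ v, ∀ hv : v ∈ (S.deleteVerts X).verts,
      (S.deleteVerts X).coe.Reachable ⟨I.root, hroot⟩ ⟨v, hv⟩ := by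
    intro v hv
    -- A walk in `S` may visit a deleted vertex, but it must return to the unique neighbour of that
    -- vertex. `Z` remembers that this neighbour has been reached.
    set Z : Set S.verts := {x | (∃ hx : x.1 ∈ (S.deleteVerts X).verts,
      (S.deleteVerts X).coe.Reachable ⟨I.root, hroot⟩ ⟨x.1, hx⟩) ∨ (x.1 ∈ X ∧
        ∃ y, ∃ hy : y ∈ (S.deleteVerts X).verts, I.graph.Adj x.1 y ∧
        (S.deleteVerts X).coe.Reachable ⟨I.root, hroot⟩ ⟨y, hy⟩)} with hZ
    have h1 := (hS.2.connected.preconnected ⟨I.root, hS.1⟩ ⟨v, hv.1⟩).mem_of_closed (Z := Z)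
      (Or.inl ⟨hroot, SimpleGraph.Reachable.refl _⟩) ?_
    · rcases h1 with ⟨_, h⟩ | h
      · exact h
      · exact absurd h.1 hv.2
    · rintro x hx y hxy
      have hxy : S.Adj x.1 y.1 := by simpa using hxy
      rcases hx with ⟨hx, hxr⟩ | ⟨hxX, z, hz, hxz, hzr⟩
      · by_cases hy : y.1 ∈ X
        · exact Or.inr ⟨hy, x.1, hx, hxy.adj_sub.symm, hxr⟩
        · have hy' : y.1 ∈ (S.deleteVerts X).verts := ⟨y.2, hy⟩
          refine Or.inl ⟨hy', hxr.trans (SimpleGraph.Adj.reachable ?_)⟩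
          simp only [SimpleGraph.Subgraph.coe_adj, SimpleGraph.Subgraph.deleteVerts_adj]
          exact ⟨x.2, hx.2, y.2, hy, hxy⟩
      · have := huniq _ hxX _ _ hxz hxy.adj_sub
        subst this
        exact Or.inl ⟨hz, hzr⟩
  refine ⟨hroot, ?_, ?_⟩
  · have : Nonempty (S.deleteVerts X).verts := ⟨⟨I.root, hroot⟩⟩
    exact ⟨fun a b => (hreach a a.2).symm.trans (hreach b b.2)⟩
  · refine SimpleGraph.IsAcyclic.comap (G' := S.coe)
      ⟨fun x => ⟨x.1, x.2.1⟩, fun {x y} hxy => ?_⟩ (fun x y hxy => ?_) hS.2.isAcyclic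
    · simp only [SimpleGraph.Subgraph.coe_adj, SimpleGraph.Subgraph.deleteVerts_adj] at hxy
      simpa using hxy.2.2.2.2
    · simpa [Subtype.ext_iff] using hxy

open scoped Classical in
/-- The penalty of the vertices of a solution that are not in the output is small. -/
theorem sum_penalty_lost_le {ε : ℝ} (hε : 0 < ε) {s : GWState n}
    (h : s.Inv I fun v => 2 / ε * I.penalty v) {F : Finset (Sym2 (Fin n))}
    (hF : I.KeepsRequired s F) {S : I.graph.Subgraph} (hS : I.IsSolution S) :
    ∑ v with ¬ I.RootConnected F v ∧ v ∈ S.verts, I.penalty v ≤ ε / 2 * I.length S := by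
  have h1 := (sum_disconnected_le h hF).trans (sum_y_powerset_le h hS _)
  rw [← Finset.sum_filter_add_sum_filter_not _ fun v => v ∈ S.verts, Finset.filter_filter] at h1
  -- The penalties of left-out vertices outside `S` occur on both sides and cancel. Undoing the
  -- scaling then produces the factor `ε / 2`.
  have h2 := le_of_add_le_add_right h1
  rw [← Finset.mul_sum] at h2
  have h3 := mul_le_mul_of_nonneg_left h2 (half_pos hε).le
  rw [← mul_assoc] at h3
  rwa [show ε / 2 * (2 / ε) = 1 by field_simp, one_mul] at h3

open scoped Classical in
-- Charging `S` only for output vertices adds the lost penalty, at most `ε / 2` times the length of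
-- `S`; half of the allowed error is not needed.
theorem penaltyOutside_inter_le {ε : ℝ} (hε : 0 < ε) {s : GWState n}
    (h : s.Inv I fun v => 2 / ε * I.penalty v) {F : Finset (Sym2 (Fin n))}
    (hF : I.KeepsRequired s F) {S : I.graph.Subgraph} (hS : I.IsSolution S) :
    I.length S + I.penaltyOutside (S.verts ∩ {v | I.RootConnected F v}) ≤
      (1 + ε) * I.totalCost S := by
  have h1 := sum_penalty_lost_le hε h hF hS
  have h2 : I.penaltyOutside (S.verts ∩ {v | I.RootConnected F v}) = I.penaltyOutside S.verts +
      ∑ v with ¬ I.RootConnected F v ∧ v ∈ S.verts, I.penalty v := by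
    simp only [penaltyOutside]
    rw [← Finset.sum_union]
    · congr 1
      ext v
      simp only [Set.mem_inter_iff, Set.mem_ofPred_eq, Finset.mem_filter, Finset.mem_univ,
        true_and, Finset.mem_union]
      tauto
    · refine Finset.disjoint_left.2 fun v hv hv' => ?_
      simp only [Finset.mem_filter, Finset.mem_univ, true_and] at hv hv'
      exact hv hv'.2
  have h3 := penaltyOutside_nonneg (I := I) S.verts
  have h4 := length_nonneg S
  rw [h2, totalCost]
  nlinarith

open scoped Classical in
-- The edges of `T` cost at most twice the dual, which is at most the length of `S` plus `2 / ε`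
-- times its penalties. The penalties of `T` exceed those of `S` by at most `ε / 2` times the length
-- of `S`. The sum is below `5 / ε` times the cost of `S`, so `6` is not tight.
theorem totalCost_le {ε : ℝ} (hε : 0 < ε) (hε1 : ε ≤ 1) {s : GWState n}
    (hs : Relation.ReflTransGen (GWStep I fun v => 2 / ε * I.penalty v) I.gwStart s)
    {F : Finset (Sym2 (Fin n))}
    (hF : Minimal (fun F' => F' ⊆ s.forest ∧ I.KeepsRequired s F') F) {T : I.graph.Subgraph}
    (hTe : T.edgeSet = (F : Set (Sym2 (Fin n)))) (hTv : T.verts = {v | I.RootConnected F v})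
    {S : I.graph.Subgraph} (hS : I.IsSolution S) :
    I.totalCost T ≤ 6 / ε * I.totalCost S := by
  have hp : ∀ v, 0 ≤ 2 / ε * I.penalty v := fun v =>
    mul_nonneg (div_nonneg zero_le_two hε.le) (I.penalty_nonneg v)
  have h := GWState.Inv.of_run hp hs
  have hFr : ∀ e ∈ F, ∀ v ∈ e, I.RootConnected F v := by
    intro e he v hv
    have he' : e ∈ T.edgeSet := by rw [hTe]; exact he
    have := T.mem_verts_of_mem_edge he' hv
    rwa [hTv] at this
  have h1 := sum_paid_le hp hs Relation.ReflTransGen.refl hF hFr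
  have h2 : I.length T = ∑ e ∈ F, s.paid e := by
    rw [length]
    refine Finset.sum_congr ?_ fun e he => (h.forest_tight e (hF.prop.1 he)).symm
    ext e
    simp [hTe]
  have h3 := sum_y_powerset_le h hS Finset.univ
  rw [Finset.powerset_univ, ← Finset.mul_sum] at h3
  have h4 := sum_penalty_lost_le hε h hF.prop.2 hS
  have h5 : I.penaltyOutside T.verts ≤ I.penaltyOutside S.verts +
      ∑ v with ¬ I.RootConnected F v ∧ v ∈ S.verts, I.penalty v := by
    simp only [penaltyOutside]
    rw [← Finset.sum_union]
    · refine Finset.sum_le_sum_of_subset_of_nonneg (fun v hv => ?_)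
        fun v _ _ => I.penalty_nonneg v
      simp only [hTv, Set.mem_ofPred_eq, Finset.mem_filter, Finset.mem_univ,
        true_and, Finset.mem_union] at hv ⊢
      tauto
    · refine Finset.disjoint_left.2 fun v hv hv' => ?_
      simp only [Finset.mem_filter, Finset.mem_univ, true_and] at hv hv'
      exact hv hv'.2
  have h6 := penaltyOutside_nonneg (I := I) S.verts
  have h7 := length_nonneg S
  change _ ≤ I.length S + 2 / ε * I.penaltyOutside S.verts at h3
  simp only [totalCost]
  rw [h2]
  have h8 : 1 ≤ 1 / ε := (one_le_div hε).2 hε1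
  have h9 : 2 / ε = 2 * (1 / ε) := by ring
  have h10 : 6 / ε = 6 * (1 / ε) := by ring
  rw [h9] at h3
  rw [h10]
  nlinarith [mul_le_mul_of_nonneg_right h8 h6, mul_le_mul_of_nonneg_right h8 h7,
    mul_le_mul_of_nonneg_right hε1 h7]

open scoped Classical in
/-- The approximation guarantees of the Goemans-Williamson algorithm with scaled penalties. -/
theorem IsGWOutput.guarantee {ε : ℝ} (hε : 0 < ε) (hε1 : ε ≤ 1) {T : I.graph.Subgraph}
    (hT : I.IsGWOutput (fun v => 2 / ε * I.penalty v) T) :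
    I.IsSolution T ∧ I.totalCost T ≤ 6 / ε * I.opt ∧
      ∃ T' : I.graph.Subgraph, I.IsSolution T' ∧
        (∃ U : Set (Fin n), U ⊆ T'.verts ∧ U ⊆ T.verts ∧
          I.length T' + I.penaltyOutside U ≤ (1 + ε) * I.opt) ∧
        (I.TerminalsAreLeaves →
          I.totalCost T' ≤ (1 + ε) * I.opt ∧
          ∀ v ∈ T'.verts, I.penalty v ≠ 0 → v ∈ T.verts) := by
  obtain ⟨s, F, hs, -, hF, hTe, hTv⟩ := hT
  have hp : ∀ v, 0 ≤ 2 / ε * I.penalty v := fun v =>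
    mul_nonneg (div_nonneg zero_le_two hε.le) (I.penalty_nonneg v)
  have h := GWState.Inv.of_run hp hs
  have hsol := isSolution_of_edgeSet h hF.prop.1 hTe hTv
  obtain ⟨S, hS, hopt⟩ := exists_opt hsol
  refine ⟨hsol, hopt ▸ totalCost_le hε hε1 hs hF hTe hTv hS, ?_⟩
  have hmain := penaltyOutside_inter_le hε h hF.prop.2 hS
  rw [← hTv, ← hopt] at hmain
  by_cases hL : I.TerminalsAreLeaves
  · set X : Set (Fin n) := {v | v ∉ T.verts ∧ I.penalty v ≠ 0} with hX
    have hrX : I.root ∉ X := fun hr => hr.1 hsol.1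
    have hS' := isSolution_delete_leaves hS X hrX fun v hv =>
      hL v (fun hvr => hrX (hvr ▸ hv)) hv.2
    have hlen : I.length (S.deleteVerts X) ≤ I.length S := by
      refine Finset.sum_le_sum_of_subset_of_nonneg (fun e he => ?_) fun e he _ =>
        I.cost_nonneg e (S.edgeSet_subset (Finset.mem_filter.1 he).2)
      simp only [Finset.mem_filter, Finset.mem_univ, true_and] at he ⊢
      exact SimpleGraph.Subgraph.edgeSet_mono SimpleGraph.Subgraph.deleteVerts_le he
    have hpen : I.penaltyOutside (S.deleteVerts X).verts =
        I.penaltyOutside (S.verts ∩ T.verts) := by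
      simp only [penaltyOutside]
      rw [Finset.sum_filter, Finset.sum_filter]
      refine Finset.sum_congr rfl fun v _ => ?_
      by_cases hv : I.penalty v = 0
      · simp [hv]
      · simp [hX, hv]
    refine ⟨_, hS', ⟨S.verts ∩ T.verts, fun v hv => ⟨hv.1, fun hvX => hvX.1 hv.2⟩,
      Set.inter_subset_right, ?_⟩, fun _ => ⟨?_, ?_⟩⟩
    · linarith
    · rw [totalCost, hpen]
      linarith
    · intro v hv hpv
      by_contra hvT
      exact hv.2 ⟨hvT, hpv⟩
  · exact ⟨S, hS, ⟨S.verts ∩ T.verts, Set.inter_subset_left, Set.inter_subset_right, hmain⟩,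
      fun hL' => absurd hL' hL⟩

end PCST

/-! ### A program logic for the machine model -/

/-- All natural numbers in memory are at most `N`, all reals are in `L`. -/
def Mem.Bounded (N : ℕ) (L : Set ℝ) (m : Mem) : Prop :=
  (∀ a k, m.nats a k ≤ N) ∧ ∀ a k, m.reals a k ∈ L

/-- All values of compound subexpressions are in `L`. -/
def RealExpr.Within (L : Set ℝ) (m : Mem) : RealExpr → Prop
  | .const k => (k : ℝ) ∈ L
  | .get _ _ => True
  | .plus x y => x.Within L m ∧ y.Within L m ∧ x.eval m + y.eval m ∈ L
  | .minus x y => x.Within L m ∧ y.Within L m ∧ x.eval m - y.eval m ∈ L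
  | .times x y => x.Within L m ∧ y.Within L m ∧ x.eval m * y.eval m ∈ L
  | .quot x y => x.Within L m ∧ y.Within L m ∧ x.eval m / y.eval m ∈ L

/-- A conjunction is charged for both parts even when the first fails, so guards do not exempt the
second part. -/
def TestExpr.Within (L : Set ℝ) (m : Mem) : TestExpr → Prop
  | .natLe _ _ => True
  | .realLe x y => x.Within L m ∧ y.Within L m
  | .neg t => t.Within L m
  | .conj t u => t.Within L m ∧ u.Within L m

/-- Weakest precondition of a loop that takes at most `k` iterations, where `W` is the transformer
of the body. -/
def loopWp (L : Set ℝ) (t : TestExpr) (W : (Mem → Prop) → Mem → Prop) (Q : Mem → Prop) :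
    ℕ → Mem → Prop
  | 0, m => t.Within L m ∧ ¬ t.Holds m ∧ Q m
  | k + 1, m => t.Within L m ∧ (t.Holds m → W (loopWp L t W Q k) m) ∧ (¬ t.Holds m → Q m)

/-- Weakest precondition: started in `m`, the program halts in a memory that satisfies `Q`, no loop
takes more than `N` iterations, all natural numbers stored are at most `N`, and all values of real
expressions are in `L`. -/
def Prog.wp (N : ℕ) (L : Set ℝ) : Prog → (Mem → Prop) → Mem → Prop
  | .skip, Q, m => Q m
  | .setNat a i x, Q, m => x.eval m ≤ N ∧ Q (m.setNat a (i.eval m) (x.eval m))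
  | .setReal a i x, Q, m => x.Within L m ∧ Q (m.setReal a (i.eval m) (x.eval m))
  | .seq P R, Q, m => P.wp N L (R.wp N L Q) m
  | .ite t P R, Q, m => t.Within L m ∧ (t.Holds m → P.wp N L Q m) ∧ (¬ t.Holds m → R.wp N L Q m)
  | .loop t P, Q, m => loopWp L t (fun Q => P.wp N L Q) Q N m

open Polynomial in
/-- A bound for the value of an expression, in terms of a bound for the numbers in memory. -/
noncomputable def NatExpr.valueBound : NatExpr → ℕ[X]
  | .const k => C k
  | .get _ _ => X
  | .plus x y => x.valueBound + y.valueBound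
  | .minus x _ => x.valueBound
  | .times x y => x.valueBound * y.valueBound

open Polynomial in
noncomputable def NatExpr.timeBound : NatExpr → ℕ[X]
  | .const k => 1 + C k
  | .get _ i => i.timeBound + 1 + X
  | .plus x y => x.timeBound + y.timeBound + 1 + (x.valueBound + y.valueBound)
  | .minus x y => x.timeBound + y.timeBound + 1 + x.valueBound
  | .times x y => x.timeBound + y.timeBound + 1 + x.valueBound * y.valueBound

open Polynomial in
-- Sizes of real numbers are left out here; they enter through the factor `K + 1` in
-- `RealExpr.time_le`.
noncomputable def RealExpr.timeBound : RealExpr → ℕ[X]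
  | .const _ => 1
  | .get _ i => i.timeBound + 1
  | .plus x y => x.timeBound + y.timeBound + 1
  | .minus x y => x.timeBound + y.timeBound + 1
  | .times x y => x.timeBound + y.timeBound + 1
  | .quot x y => x.timeBound + y.timeBound + 1

open Polynomial in
noncomputable def TestExpr.timeBound : TestExpr → ℕ[X]
  | .natLe x y => x.timeBound + y.timeBound + 1
  | .realLe x y => x.timeBound + y.timeBound + 1
  | .neg t => t.timeBound + 1
  | .conj t u => t.timeBound + u.timeBound + 1

open Polynomial in
noncomputable def Prog.timeBound : Prog → ℕ[X]
  | .skip => 1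
  | .setNat _ i x => i.timeBound + x.timeBound + 1
  | .setReal _ i x => i.timeBound + x.timeBound + 1
  | .seq P Q => P.timeBound + Q.timeBound
  | .ite t P Q => t.timeBound + P.timeBound + Q.timeBound
  | .loop t P => (X + 1) * (t.timeBound + P.timeBound)

theorem Nat.size_le_self (k : ℕ) : k.size ≤ k :=
  Nat.size_le.2 Nat.lt_two_pow_self

section Soundness

variable {N K : ℕ} {L : Set ℝ} {sz : ℝ → ℕ} {m : Mem}

theorem NatExpr.eval_le (hm : m.Bounded N L) (x : NatExpr) : x.eval m ≤ x.valueBound.eval N := by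
  induction x with
  | const k => simp [NatExpr.eval, NatExpr.valueBound]
  | get a i => simpa [NatExpr.eval, NatExpr.valueBound] using hm.1 _ _
  | plus x y hx hy =>
    simp only [NatExpr.eval, NatExpr.valueBound, Polynomial.eval_add]; omega
  | minus x y hx hy =>
    simp only [NatExpr.eval, NatExpr.valueBound]; omega
  | times x y hx hy =>
    simp only [NatExpr.eval, NatExpr.valueBound, Polynomial.eval_mul]
    exact Nat.mul_le_mul hx hy

theorem NatExpr.time_le (hm : m.Bounded N L) (x : NatExpr) : x.time m ≤ x.timeBound.eval N := by
  induction x with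
  | const k => simpa [NatExpr.time, NatExpr.timeBound] using Nat.size_le_self k
  | get a i hi =>
    have := Nat.size_le_self (m.nats a (i.eval m))
    have := hm.1 a (i.eval m)
    simp only [NatExpr.time, NatExpr.timeBound, Polynomial.eval_add, Polynomial.eval_X,
      Polynomial.eval_one]
    omega
  | plus x y hx hy =>
    have := Nat.size_le_self (x.eval m + y.eval m)
    have := x.eval_le hm
    have := y.eval_le hm
    simp only [NatExpr.time, NatExpr.timeBound, Polynomial.eval_add, Polynomial.eval_one]
    omega
  | minus x y hx hy =>
    have := Nat.size_le_self (x.eval m - y.eval m)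
    have := x.eval_le hm
    simp only [NatExpr.time, NatExpr.timeBound, Polynomial.eval_add, Polynomial.eval_one]
    omega
  | times x y hx hy =>
    have := Nat.size_le_self (x.eval m * y.eval m)
    have := Nat.mul_le_mul (x.eval_le hm) (y.eval_le hm)
    simp only [NatExpr.time, NatExpr.timeBound, Polynomial.eval_add, Polynomial.eval_one,
      Polynomial.eval_mul]
    omega

theorem NatExpr.time_le_mul (hm : m.Bounded N L) (x : NatExpr) :
    x.time m ≤ x.timeBound.eval N * (K + 1) :=
  (x.time_le hm).trans (Nat.le_mul_of_pos_right _ (Nat.succ_pos K))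

theorem RealExpr.eval_mem (hm : m.Bounded N L) (x : RealExpr) (hx : x.Within L m) :
    x.eval m ∈ L := by
  cases x with
  | const k => exact hx
  | get a i => exact hm.2 _ _
  | plus x y => exact hx.2.2
  | minus x y => exact hx.2.2
  | times x y => exact hx.2.2
  | quot x y => exact hx.2.2

theorem RealExpr.time_le (hsz : ∀ x ∈ L, sz x ≤ K) (hm : m.Bounded N L) (x : RealExpr)
    (hx : x.Within L m) : x.time sz m ≤ x.timeBound.eval N * (K + 1) := by
  induction x with
  | const k =>
    have := hsz _ hx
    simp only [RealExpr.time, RealExpr.timeBound, Polynomial.eval_one]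
    omega
  | get a i =>
    have := i.time_le_mul (K := K) hm
    have := hsz _ (hm.2 a (i.eval m))
    simp only [RealExpr.time, RealExpr.timeBound, Polynomial.eval_one, Polynomial.eval_add, add_mul]
    omega
  | plus x y hx' hy' =>
    obtain ⟨h1, h2, h3⟩ := hx
    have := hx' h1
    have := hy' h2
    have := hsz _ h3
    simp only [RealExpr.time, RealExpr.timeBound, Polynomial.eval_one, Polynomial.eval_add, add_mul]
    omega
  | minus x y hx' hy' =>
    obtain ⟨h1, h2, h3⟩ := hx
    have := hx' h1
    have := hy' h2
    have := hsz _ h3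
    simp only [RealExpr.time, RealExpr.timeBound, Polynomial.eval_one, Polynomial.eval_add, add_mul]
    omega
  | times x y hx' hy' =>
    obtain ⟨h1, h2, h3⟩ := hx
    have := hx' h1
    have := hy' h2
    have := hsz _ h3
    simp only [RealExpr.time, RealExpr.timeBound, Polynomial.eval_one, Polynomial.eval_add, add_mul]
    omega
  | quot x y hx' hy' =>
    obtain ⟨h1, h2, h3⟩ := hx
    have := hx' h1
    have := hy' h2
    have := hsz _ h3
    simp only [RealExpr.time, RealExpr.timeBound, Polynomial.eval_one, Polynomial.eval_add, add_mul]
    omega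

theorem TestExpr.time_le (hsz : ∀ x ∈ L, sz x ≤ K) (hm : m.Bounded N L) (t : TestExpr)
    (ht : t.Within L m) : t.time sz m ≤ t.timeBound.eval N * (K + 1) := by
  induction t with
  | natLe x y =>
    have := x.time_le_mul (K := K) hm
    have := y.time_le_mul (K := K) hm
    simp only [TestExpr.time, TestExpr.timeBound, Polynomial.eval_one, Polynomial.eval_add, add_mul]
    omega
  | realLe x y =>
    have := x.time_le hsz hm ht.1
    have := y.time_le hsz hm ht.2
    simp only [TestExpr.time, TestExpr.timeBound, Polynomial.eval_one, Polynomial.eval_add, add_mul]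
    omega
  | neg t ih =>
    have := ih ht
    simp only [TestExpr.time, TestExpr.timeBound, Polynomial.eval_one, Polynomial.eval_add, add_mul]
    omega
  | conj t u iht ihu =>
    have := iht ht.1
    have := ihu ht.2
    simp only [TestExpr.time, TestExpr.timeBound, Polynomial.eval_one, Polynomial.eval_add, add_mul]
    omega

theorem Mem.Bounded.setNat (hm : m.Bounded N L) (a k : ℕ) {x : ℕ} (hx : x ≤ N) :
    (m.setNat a k x).Bounded N L := by
  refine ⟨fun b j => ?_, hm.2⟩
  simp only [Mem.setNat, Function.update_apply]
  split_ifs with h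
  · rw [Function.update_apply]
    split_ifs
    · exact hx
    · exact hm.1 _ _
  · exact hm.1 _ _

theorem Mem.Bounded.setReal (hm : m.Bounded N L) (a k : ℕ) {x : ℝ} (hx : x ∈ L) :
    (m.setReal a k x).Bounded N L := by
  refine ⟨hm.1, fun b j => ?_⟩
  simp only [Mem.setReal, Function.update_apply]
  split_ifs with h
  · rw [Function.update_apply]
    split_ifs
    · exact hx
    · exact hm.2 _ _
  · exact hm.2 _ _

/-- The weakest precondition implies termination within the syntactic time bound. -/
theorem Prog.wp_sound (hsz : ∀ x ∈ L, sz x ≤ K) (P : Prog) {Q : Mem → Prop} {m : Mem}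
    (hm : m.Bounded N L) (h : P.wp N L Q m) :
    ∃ m' t, Runs sz P m m' t ∧ t ≤ P.timeBound.eval N * (K + 1) ∧ m'.Bounded N L ∧ Q m' := by
  induction P generalizing Q m with
  | skip => exact ⟨m, 1, .skip m, by simp [Prog.timeBound], hm, h⟩
  | setNat a i x =>
    refine ⟨_, _, .setNat m a i x, ?_, hm.setNat _ _ h.1, h.2⟩
    have := i.time_le_mul (K := K) hm
    have := x.time_le_mul (K := K) hm
    simp only [Prog.timeBound, Polynomial.eval_one, Polynomial.eval_add, add_mul]
    omega
  | setReal a i x =>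
    refine ⟨_, _, .setReal m a i x, ?_, hm.setReal _ _ (x.eval_mem hm h.1), h.2⟩
    have := i.time_le_mul (K := K) hm
    have := x.time_le hsz hm h.1
    simp only [Prog.timeBound, Polynomial.eval_one, Polynomial.eval_add, add_mul]
    omega
  | seq P R ihP ihR =>
    obtain ⟨m₁, t₁, h1, h2, h3, h4⟩ := ihP hm h
    obtain ⟨m₂, t₂, h5, h6, h7, h8⟩ := ihR h3 h4
    refine ⟨m₂, _, .seq h1 h5, ?_, h7, h8⟩
    simp only [Prog.timeBound, Polynomial.eval_add, add_mul]
    omega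
  | ite t P R ihP ihR =>
    have h0 := t.time_le hsz hm h.1
    by_cases ht : t.Holds m
    · obtain ⟨m₁, t₁, h1, h2, h3, h4⟩ := ihP hm (h.2.1 ht)
      refine ⟨m₁, _, .ite_true ht h1, ?_, h3, h4⟩
      simp only [Prog.timeBound, Polynomial.eval_add, add_mul]
      omega
    · obtain ⟨m₁, t₁, h1, h2, h3, h4⟩ := ihR hm (h.2.2 ht)
      refine ⟨m₁, _, .ite_false ht h1, ?_, h3, h4⟩
      simp only [Prog.timeBound, Polynomial.eval_add, add_mul]
      omega
  | loop t P ih =>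
    -- The number `k` of remaining iterations is separated from the memory bound `N`, so that the
    -- induction can vary it alone.
    have key : ∀ (k : ℕ) (m : Mem), m.Bounded N L →
        loopWp L t (fun Q => P.wp N L Q) Q k m →
        ∃ m' t', Runs sz (.loop t P) m m' t' ∧
          t' ≤ (k + 1) * ((t.timeBound.eval N + P.timeBound.eval N) * (K + 1)) ∧
          m'.Bounded N L ∧ Q m' := by
      intro k
      induction k with
      | zero =>
        rintro m hm ⟨h1, h2, h3⟩
        refine ⟨m, _, .loop_exit h2, ?_, hm, h3⟩
        have := t.time_le hsz hm h1
        rw [zero_add, one_mul, add_mul]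
        omega
      | succ k ihk =>
        rintro m hm ⟨h1, h2, h3⟩
        have h0 := t.time_le hsz hm h1
        by_cases ht : t.Holds m
        · obtain ⟨m₁, t₁, h4, h5, h6, h7⟩ := ih hm (h2 ht)
          obtain ⟨m₂, t₂, h8, h9, h10, h11⟩ := ihk m₁ h6 h7
          refine ⟨m₂, _, .loop_step ht h4 h8, ?_, h10, h11⟩
          rw [Nat.add_mul (k + 1) 1, one_mul, add_mul (t.timeBound.eval N)]
          rw [add_mul (t.timeBound.eval N)] at h9
          omega
        · refine ⟨m, _, .loop_exit ht, ?_, hm, h3 ht⟩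
          have : 1 * ((t.timeBound.eval N + P.timeBound.eval N) * (K + 1)) ≤
              (k + 1 + 1) * ((t.timeBound.eval N + P.timeBound.eval N) * (K + 1)) :=
            Nat.mul_le_mul_right _ (by omega)
          have := add_mul (t.timeBound.eval N) (P.timeBound.eval N) (K + 1)
          omega
    obtain ⟨m', t', h1, h2, h3, h4⟩ := key N m hm h
    refine ⟨m', t', h1, ?_, h3, h4⟩
    simpa [Prog.timeBound, mul_assoc] using h2

end Soundness

/-- The final memory does not depend on how real numbers are charged. -/
theorem Runs.deterministic {sz sz' : ℝ → ℕ} {P : Prog} {m m₁ m₂ : Mem} {t₁ t₂ : ℕ}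
    (h : Runs sz P m m₁ t₁) (h' : Runs sz' P m m₂ t₂) : m₁ = m₂ := by
  induction h generalizing m₂ t₂ with
  | skip => cases h'; rfl
  | setNat => cases h'; rfl
  | setReal => cases h'; rfl
  | seq _ _ ih1 ih2 =>
    cases h' with
    | seq g1 g2 =>
      have := ih1 g1
      subst this
      exact ih2 g2
  | ite_true ht _ ih =>
    cases h' with
    | ite_true _ g => exact ih g
    | ite_false hf _ => exact absurd ht hf
  | ite_false hf _ ih =>
    cases h' with
    | ite_true ht _ => exact absurd ht hf
    | ite_false _ g => exact ih g
  | loop_exit hf =>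
    cases h' with
    | loop_exit => rfl
    | loop_step ht => exact absurd ht hf
  | loop_step ht _ _ ih1 ih2 =>
    cases h' with
    | loop_exit hf => exact absurd ht hf
    | loop_step _ g1 g2 =>
      have := ih1 g1
      subst this
      exact ih2 g2

/-! ### Frames and rules for counting loops -/

/-- The program contains an assignment to the array number `a` of natural numbers. -/
def Prog.writesNat (a : ℕ) : Prog → Bool
  | .skip => false
  | .setNat b _ _ => a == b
  | .setReal _ _ _ => false
  | .seq P Q => P.writesNat a || Q.writesNat a
  | .ite _ P Q => P.writesNat a || Q.writesNat a
  | .loop _ P => P.writesNat a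

/-- The program contains an assignment to the array number `a` of real numbers. -/
def Prog.writesReal (a : ℕ) : Prog → Bool
  | .skip => false
  | .setNat _ _ _ => false
  | .setReal b _ _ => a == b
  | .seq P Q => P.writesReal a || Q.writesReal a
  | .ite _ P Q => P.writesReal a || Q.writesReal a
  | .loop _ P => P.writesReal a

/-- The memories agree outside the arrays that `P` writes. -/
def Prog.Frame (P : Prog) (m m' : Mem) : Prop :=
  (∀ a, P.writesNat a = false → m'.nats a = m.nats a) ∧
  ∀ a, P.writesReal a = false → m'.reals a = m.reals a

theorem Prog.Frame.refl (P : Prog) (m : Mem) : P.Frame m m := ⟨fun _ _ => rfl, fun _ _ => rfl⟩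

theorem Prog.Frame.trans {P : Prog} {m₁ m₂ m₃ : Mem} (h : P.Frame m₁ m₂) (h' : P.Frame m₂ m₃) :
    P.Frame m₁ m₃ :=
  ⟨fun a ha => (h'.1 a ha).trans (h.1 a ha), fun a ha => (h'.2 a ha).trans (h.2 a ha)⟩

namespace Prog

variable {N : ℕ} {L : Set ℝ}

/-- What a program syntactically cannot write may be added to any postcondition, so specifications
need to mention only what changes. -/
theorem wp_frame {P : Prog} {Q Q' : Mem → Prop} {m : Mem} (h : P.wp N L Q m)
    (hQ : ∀ m', P.Frame m m' → Q m' → Q' m') : P.wp N L Q' m := by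
  induction P generalizing Q Q' m with
  | skip => exact hQ _ (Frame.refl _ _) h
  | setNat a i x =>
    refine ⟨h.1, hQ _ ⟨fun b hb => ?_, fun b _ => rfl⟩ h.2⟩
    simp only [writesNat, beq_eq_false_iff_ne] at hb
    simp [Mem.setNat, hb]
  | setReal a i x =>
    refine ⟨h.1, hQ _ ⟨fun b _ => rfl, fun b hb => ?_⟩ h.2⟩
    simp only [writesReal, beq_eq_false_iff_ne] at hb
    simp [Mem.setReal, hb]
  | seq P R ihP ihR =>
    refine ihP h fun m₁ h1 h' => ihR h' fun m₂ h2 h3 => hQ m₂ ?_ h3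
    refine ⟨fun a ha => ?_, fun a ha => ?_⟩
    · simp only [writesNat, Bool.or_eq_false_iff] at ha
      exact (h2.1 a ha.2).trans (h1.1 a ha.1)
    · simp only [writesReal, Bool.or_eq_false_iff] at ha
      exact (h2.2 a ha.2).trans (h1.2 a ha.1)
  | ite t P R ihP ihR =>
    refine ⟨h.1, fun ht => ihP (h.2.1 ht) fun m' h1 h2 => hQ m' ⟨fun a ha => ?_, fun a ha => ?_⟩ h2,
      fun ht => ihR (h.2.2 ht) fun m' h1 h2 => hQ m' ⟨fun a ha => ?_, fun a ha => ?_⟩ h2⟩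
    all_goals simp only [writesNat, writesReal, Bool.or_eq_false_iff] at ha
    · exact h1.1 a ha.1
    · exact h1.2 a ha.1
    · exact h1.1 a ha.2
    · exact h1.2 a ha.2
  | loop t P ih =>
    have key : ∀ (k : ℕ) (m : Mem), loopWp L t (fun Q => P.wp N L Q) Q k m →
        (∀ m', P.Frame m m' → Q m' → Q' m') → loopWp L t (fun Q => P.wp N L Q) Q' k m := by
      intro k
      induction k with
      | zero => exact fun m h hQ => ⟨h.1, h.2.1, hQ m (Frame.refl _ _) h.2.2⟩
      | succ k ihk =>
        exact fun m h hQ => ⟨h.1, fun ht => ih (h.2.1 ht) fun m₁ h1 h2 =>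
          ihk m₁ h2 fun m₂ h3 h4 => hQ m₂ (h1.trans h3) h4,
          fun ht => hQ m (Frame.refl _ _) (h.2.2 ht)⟩
    exact key N m h hQ

theorem wp_mono {P : Prog} {Q Q' : Mem → Prop} {m : Mem} (h : P.wp N L Q m)
    (hQ : ∀ m', Q m' → Q' m') : P.wp N L Q' m :=
  wp_frame h fun m' _ => hQ m'

end Prog

/-- The variable `a`, which is cell `0` of the array `a`. -/
def NatExpr.var (a : ℕ) : NatExpr := .get a (.const 0)

/-- `for i = 0, …, e - 1 do P`. -/
def Prog.forLoop (i : ℕ) (e : NatExpr) (P : Prog) : Prog :=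
  .seq (.setNat i (.const 0) (.const 0))
    (.loop (.natLe (.plus (.var i) (.const 1)) e)
      (.seq P (.setNat i (.const 0) (.plus (.var i) (.const 1)))))

section MemLemmas

variable (m : Mem) (a b k x : ℕ) (z : ℝ)

@[simp] theorem Mem.setNat_reals : (m.setNat a k x).reals = m.reals := rfl

@[simp] theorem Mem.setReal_nats : (m.setReal a k z).nats = m.nats := rfl

@[simp] theorem Mem.setNat_nats_self :
    (m.setNat a k x).nats a = Function.update (m.nats a) k x := by
  simp [Mem.setNat]

@[simp] theorem Mem.setReal_reals_self :
    (m.setReal a k z).reals a = Function.update (m.reals a) k z := by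
  simp [Mem.setReal]

variable {a b}

theorem Mem.setNat_nats_of_ne (h : b ≠ a) : (m.setNat a k x).nats b = m.nats b := by
  simp [Mem.setNat, h]

theorem Mem.setReal_reals_of_ne (h : b ≠ a) : (m.setReal a k z).reals b = m.reals b := by
  simp [Mem.setReal, h]

end MemLemmas

namespace Prog

variable {N : ℕ} {L : Set ℝ}

/-- The rule for counting loops. The body does not write the loop variable, and the invariant does
not depend on it. -/
theorem wp_forLoop {i : ℕ} {e : NatExpr} {P : Prog} {Q : Mem → Prop} {m : Mem} (c : ℕ)
    (Inv : ℕ → Mem → Prop) (hc : c ≤ N) (hi : P.writesNat i = false)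
    (he : ∀ m', (forLoop i e P).Frame m m' → e.eval m' = c)
    (hst : ∀ k m' x, Inv k m' → Inv k (m'.setNat i 0 x))
    (h0 : Inv 0 m)
    (hstep : ∀ k, k < c → ∀ m', (forLoop i e P).Frame m m' → m'.nats i 0 = k → Inv k m' →
      P.wp N L (Inv (k + 1)) m')
    (hQ : ∀ m', (forLoop i e P).Frame m m' → Inv c m' → Q m') :
    (forLoop i e P).wp N L Q m := by
  have hset : ∀ m' x, (forLoop i e P).Frame m m' → (forLoop i e P).Frame m (m'.setNat i 0 x) := by
    intro m' x h
    refine ⟨fun a ha => ?_, h.2⟩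
    rw [← h.1 a ha]
    simp only [forLoop, writesNat, Bool.or_eq_false_iff, beq_eq_false_iff_ne] at ha
    exact Mem.setNat_nats_of_ne _ _ _ ha.1
  -- Here `j` is the remaining fuel of the loop and `k` its counter; `c ≤ k + j` says that the fuel
  -- lasts.
  have key : ∀ (j k : ℕ) (m' : Mem), c ≤ k + j → k ≤ c → (forLoop i e P).Frame m m' →
      m'.nats i 0 = k → Inv k m' →
      loopWp L (.natLe (.plus (.var i) (.const 1)) e) (fun Q => (Prog.seq P
        (.setNat i (.const 0) (.plus (.var i) (.const 1)))).wp N L Q) Q j m' := by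
    intro j
    induction j with
    | zero =>
      intro k m' h1 h2 h3 h4 h5
      have : k = c := by omega
      subst this
      refine ⟨trivial, ?_, hQ m' h3 h5⟩
      simp [TestExpr.Holds, NatExpr.var, NatExpr.eval, h4, he m' h3]
    | succ j ih =>
      intro k m' h1 h2 h3 h4 h5
      refine ⟨trivial, fun ht => ?_, fun ht => ?_⟩
      · have hk : k < c := by
          simpa [TestExpr.Holds, NatExpr.var, NatExpr.eval, h4, he m' h3] using ht
        refine wp_frame (P := P) (hstep k hk m' h3 h4 h5) fun m₁ hf h6 => ?_
        have h7 : m₁.nats i 0 = k := by rw [hf.1 i hi, h4]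
        have h8 : (forLoop i e P).Frame m m₁ := by
          refine h3.trans ⟨fun a ha => hf.1 a ?_, fun a ha => hf.2 a ?_⟩
          · simp only [forLoop, writesNat, Bool.or_eq_false_iff] at ha
            exact ha.2.1
          · simp only [forLoop, writesReal, Bool.or_eq_false_iff] at ha
            exact ha.2.1
        simp only [wp, NatExpr.eval, NatExpr.var, h7]
        exact ⟨by omega, ih (k + 1) _ (by omega) (by omega) (hset _ _ h8) (by simp)
          (hst _ _ _ h6)⟩
      · have hk : k = c := by
          have : ¬ k < c := by
            simpa [TestExpr.Holds, NatExpr.var, NatExpr.eval, h4, he m' h3] using ht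
          omega
        subst hk
        exact hQ m' h3 h5
  simp only [forLoop, wp, NatExpr.eval]
  exact ⟨Nat.zero_le _, key N 0 _ (by omega) (Nat.zero_le _) (hset _ _ (Frame.refl _ _)) (by simp)
    (hst _ _ _ h0)⟩

end Prog

namespace Prog

variable {N : ℕ} {L : Set ℝ}

theorem wp_seq {P R : Prog} {Q Q' : Mem → Prop} {m : Mem} (h : P.wp N L Q m)
    (hQ : ∀ m', P.Frame m m' → Q m' → R.wp N L Q' m') : (seq P R).wp N L Q' m :=
  wp_frame (P := P) h hQ

/-- The rule for two nested counting loops with the same bound. -/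
theorem wp_forLoop_forLoop {i j : ℕ} {e : NatExpr} {P : Prog} {Q : Mem → Prop} {m : Mem} (c : ℕ)
    (Inv : ℕ → ℕ → Mem → Prop) (hc : c ≤ N) (hij : i ≠ j) (hi : P.writesNat i = false)
    (hj : P.writesNat j = false)
    (he : ∀ m', (forLoop i e (forLoop j e P)).Frame m m' → e.eval m' = c)
    (hsti : ∀ a b m' x, Inv a b m' → Inv a b (m'.setNat i 0 x))
    (hstj : ∀ a b m' x, Inv a b m' → Inv a b (m'.setNat j 0 x))
    (h0 : Inv 0 0 m)
    (hstep : ∀ a, a < c → ∀ b, b < c → ∀ m', (forLoop i e (forLoop j e P)).Frame m m' →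
      m'.nats i 0 = a → m'.nats j 0 = b → Inv a b m' → P.wp N L (Inv a (b + 1)) m')
    (hnext : ∀ a, a < c → ∀ m', Inv a c m' → Inv (a + 1) 0 m')
    (hQ : ∀ m', (forLoop i e (forLoop j e P)).Frame m m' → Inv c 0 m' → Q m') :
    (forLoop i e (forLoop j e P)).wp N L Q m := by
  have hframe : ∀ m₁ m₂ m₃, (forLoop i e (forLoop j e P)).Frame m₁ m₂ →
      (forLoop j e P).Frame m₂ m₃ → (forLoop i e (forLoop j e P)).Frame m₁ m₃ := by
    intro m₁ m₂ m₃ h1 h2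
    refine h1.trans ⟨fun a ha => h2.1 a ?_, fun a ha => h2.2 a ?_⟩
    · rw [forLoop] at ha
      simp only [writesNat, Bool.or_eq_false_iff] at ha
      exact ha.2.1
    · rw [forLoop] at ha
      simp only [writesReal, Bool.or_eq_false_iff] at ha
      exact ha.2.1
  have hi' : (forLoop j e P).writesNat i = false := by
    simp [forLoop, writesNat, hi, hij]
  refine wp_forLoop c (fun a => Inv a 0) hc hi' he (fun a m' x => hsti a 0 m' x) h0 ?_ hQ
  intro a ha m₁ hf1 h1 h2
  refine wp_forLoop c (fun b => Inv a b) hc hj (fun m' h => he m' (hframe _ _ _ hf1 h))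
    (fun b m' x => hstj a b m' x) h2 ?_ (fun m' _ h => hnext a ha m' h)
  intro b hb m₂ hf2 h3 h4
  exact hstep a ha b hb m₂ (hframe _ _ _ hf1 hf2) (by rw [hf2.1 i hi', h1]) h3 h4

end Prog

/-! ### The program -/

namespace GWProgram

/-- Cell `i * n + j` of the array `a`, where `i` and `j` are variables. -/
def cellIndex (i j : ℕ) : NatExpr := .plus (.times (.var i) (.var 0)) (.var j)

def natEq (x y : NatExpr) : TestExpr := .conj (.natLe x y) (.natLe y x)

def disj (s t : TestExpr) : TestExpr := .neg (.conj (.neg s) (.neg t))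

/-- Entry of the array `a` of natural numbers at the variable `i`. -/
def natAt (a i : ℕ) : NatExpr := .get a (.var i)

/-- Entry of the array `a` of real numbers at the variable `i`. -/
def realAt (a i : ℕ) : RealExpr := .get a (.var i)

def realVar (a : ℕ) : RealExpr := .get a (.const 0)

def positive (x : NatExpr) : TestExpr := .natLe (.const 1) x

/-- Every vertex is a component (array 7) with its potential (real array 3); all but the
root are active (real array 5). -/
def setup : Prog :=
  .seq (.forLoop 4 (.var 0)
    (.seq (.setNat 7 (.var 4) (.var 4))
      (.seq (.setReal 3 (.var 4) (.times (.quot (.const 2) (realVar 0)) (realAt 2 4)))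
        (.setReal 5 (.var 4) (.const 1)))))
    (.setReal 5 (.get 0 (.const 1)) (.const 0))

/-- Find an active vertex (variable 11) of least remaining potential (real variable 6). -/
def selectVertex : Prog :=
  .seq (.setNat 13 (.const 0) (.const 0))
    (.forLoop 4 (.var 0)
      (.ite (.conj (.realLe (.const 1) (realAt 5 4))
          (.neg (.conj (positive (.var 13)) (.realLe (realVar 6) (realAt 3 4)))))
        (.seq (.setNat 13 (.const 0) (.const 1))
          (.seq (.setReal 6 (.const 0) (realAt 3 4)) (.setNat 11 (.const 0) (.var 4))))
        .skip))

/-- The time at which the edge between the variables 4 and 5 becomes tight. -/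
def slack : RealExpr :=
  .quot (.minus (.minus (.get 1 (cellIndex 4 5)) (realAt 4 4)) (realAt 4 5))
    (.plus (realAt 5 4) (realAt 5 5))

/-- Find an edge that becomes tight before the potential of a component is spent. -/
def selectEdge : Prog :=
  .forLoop 4 (.var 0) (.forLoop 5 (.var 0)
    (.ite (.conj (.conj (positive (.get 1 (cellIndex 4 5)))
          (.neg (natEq (natAt 7 4) (natAt 7 5))))
        (.conj (.realLe (.const 1) (realAt 5 4)) (.neg (.realLe (realVar 6) slack))))
      (.seq (.setNat 13 (.const 0) (.const 2))
        (.seq (.setReal 6 (.const 0) slack)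
          (.seq (.setNat 11 (.const 0) (.var 4)) (.setNat 12 (.const 0) (.var 5)))))
      .skip))

/-- Real array 4 holds for each vertex the total dual of the sets containing it. The activity in
real array 5 is a real number because it serves as growth rate. -/
def growDuals : Prog :=
  .forLoop 4 (.var 0)
    (.seq (.setReal 4 (.var 4) (.plus (realAt 4 4) (.times (realVar 6) (realAt 5 4))))
      (.setReal 3 (.var 4) (.minus (realAt 3 4) (.times (realVar 6) (realAt 5 4)))))

/-- Deactivate the component of the vertex in variable 11. The label of a vertex is a row of the
matrix in array 8, array 9 tells which vertices have a label. -/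
def deactivateComp : Prog :=
  .seq (.setNat 16 (.const 0) (natAt 7 11))
    (.seq (.forLoop 4 (.var 0) (.forLoop 5 (.var 0)
      (.ite (.conj (.natLe (natAt 9 4) (.const 0))
          (.conj (natEq (natAt 7 4) (.var 16)) (natEq (natAt 7 5) (.var 16))))
        (.setNat 8 (cellIndex 4 5) (.const 1)) .skip)))
    (.forLoop 4 (.var 0)
      (.ite (natEq (natAt 7 4) (.var 16))
        (.seq (.setNat 9 (.var 4) (.const 1)) (.setReal 5 (.var 4) (.const 0))) .skip)))

/-- Merge the components of the vertices in the variables 11 and 12; the forest is in array 10. -/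
def mergeComps : Prog :=
  .seq (.seq (.setNat 16 (.const 0) (natAt 7 11)) (.setNat 17 (.const 0) (natAt 7 12)))
    (.seq (.setReal 7 (.const 0) (.plus (realAt 3 11) (realAt 3 12)))
    (.seq (.ite (disj (natEq (.var 16) (.get 7 (.get 0 (.const 1))))
        (natEq (.var 17) (.get 7 (.get 0 (.const 1)))))
      (.setReal 8 (.const 0) (.const 0)) (.setReal 8 (.const 0) (.const 1)))
    (.seq (.forLoop 4 (.var 0)
      (.ite (disj (natEq (natAt 7 4) (.var 16)) (natEq (natAt 7 4) (.var 17)))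
        (.seq (.setNat 7 (.var 4) (.var 16))
          (.seq (.setReal 3 (.var 4) (realVar 7)) (.setReal 5 (.var 4) (realVar 8)))) .skip))
    (.seq (.setNat 10 (cellIndex 11 12) (.const 1)) (.setNat 10 (cellIndex 12 11) (.const 1))))))

/-- One iteration of the growth phase. -/
def round : Prog :=
  -- Variable 13 records the next event: 0 for none, 1 for a deactivation, 2 for a merge.
  .seq selectVertex (.ite (.natLe (.var 13) (.const 0)) .skip
    (.seq selectEdge (.seq growDuals
      (.ite (.natLe (.var 13) (.const 1)) deactivateComp mergeComps))))

/-- Components and active components number at most `n` each, and every step lowers the sum of the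
two counts. Surplus rounds leave the state alone. -/
def growth : Prog := .forLoop 6 (.plus (.var 0) (.var 0)) round

/-- Orient the component of the root; array 15 tells which vertices have been reached, array 14
holds the parents. -/
def findParents : Prog :=
  .seq (.seq (.setNat 15 (.get 0 (.const 1)) (.const 1))
      (.setNat 14 (.get 0 (.const 1)) (.get 0 (.const 1))))
    (.forLoop 6 (.var 0) (.forLoop 4 (.var 0) (.forLoop 5 (.var 0)
      (.ite (.conj (positive (natAt 15 4)) (.conj (.natLe (natAt 15 5) (.const 0))
          (positive (.get 10 (cellIndex 4 5)))))
        (.seq (.setNat 15 (.var 5) (.const 1)) (.setNat 14 (.var 5) (.var 4))) .skip))))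

/-- Compute the vertices of the output: the closure of the unlabelled vertices. -/
def closeVertices : Prog :=
  .seq (.forLoop 4 (.var 0) (.ite (positive (natAt 9 4)) .skip (.setNat 2 (.var 4) (.const 1))))
    (.forLoop 6 (.var 0) (.forLoop 4 (.var 0) (.forLoop 5 (.var 0)
      (.ite (.conj (positive (natAt 2 4)) (disj (positive (.get 8 (cellIndex 5 4)))
          (natEq (natAt 14 4) (.var 5))))
        (.setNat 2 (.var 5) (.const 1)) .skip))))

def writeEdges : Prog :=
  .forLoop 4 (.var 0) (.forLoop 5 (.var 0)
    (.setNat 3 (cellIndex 4 5)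
      (.times (.times (natAt 2 4) (natAt 2 5)) (.get 10 (cellIndex 4 5)))))

def program : Prog :=
  .seq setup (.seq growth (.seq findParents (.seq closeVertices writeEdges)))

attribute [simp] Prog.wp NatExpr.var NatExpr.eval RealExpr.eval TestExpr.Holds TestExpr.Within
  RealExpr.Within Mem.setNat_nats_of_ne Mem.setReal_reals_of_ne cellIndex natEq disj natAt realAt
  realVar positive slack

/-! ### Effect of the procedures on raw memory -/

variable {N n : ℕ} {L : Set ℝ} {m : Mem}

theorem setup_spec (hn : m.nats 0 0 = n) (hN : n ≤ N) {r : ℕ} (hr : m.nats 0 1 = r)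
    (h0 : (0 : ℝ) ∈ L) (h1 : (1 : ℝ) ∈ L) (h2 : (2 : ℝ) ∈ L)
    (hε : 2 / m.reals 0 0 ∈ L) (hp : ∀ v < n, 2 / m.reals 0 0 * m.reals 2 v ∈ L) :
    setup.wp N L (fun m' => ∀ v < n, m'.nats 7 v = v ∧
      m'.reals 3 v = 2 / m.reals 0 0 * m.reals 2 v ∧
      m'.reals 5 v = if v = r then 0 else 1) m := by
  refine Prog.wp_forLoop n (fun k m' => ∀ v < k, m'.nats 7 v = v ∧
      m'.reals 3 v = 2 / m.reals 0 0 * m.reals 2 v ∧ m'.reals 5 v = 1) hN rfl ?_ ?_ ?_ ?_ ?_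
  · intro m' h
    simp [h.1 0 rfl, hn]
  · intro k m' x h
    simpa using h
  · simp
  · intro k hk m' hf hi h
    have e1 := hf.2 0 rfl
    have e2 := hf.2 2 rfl
    have := hp k hk
    simp only [Prog.wp, NatExpr.var, NatExpr.eval, RealExpr.Within, RealExpr.eval, realAt, realVar,
      Mem.setNat_reals, Mem.setReal_nats, hi]
    refine ⟨by omega, ?_, ?_, ?_⟩
    · simp [h2, e1, e2, hi, hε, this]
    · simpa using h1
    · intro v hv
      rcases lt_or_eq_of_le (by omega : v ≤ k) with hv | rfl
      · simpa [hi, hv.ne] using h v hv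
      · simp [hi, e1, e2]
  · intro m' hf h
    have e1 := hf.1 0 rfl
    refine ⟨by simpa using h0, fun v hv => ?_⟩
    obtain ⟨h3, h4, h5⟩ := h v hv
    simp [e1, hr, Function.update_apply, h3, h4, h5]

theorem selectVertex_spec (hn : m.nats 0 0 = n) (hN : n + 2 ≤ N) (h1 : (1 : ℝ) ∈ L) :
    selectVertex.wp N L (fun m' =>
      (m'.nats 13 0 = 0 ∧ ∀ u < n, ¬ 1 ≤ m.reals 5 u) ∨
      (m'.nats 13 0 = 1 ∧ m'.nats 11 0 < n ∧ 1 ≤ m.reals 5 (m'.nats 11 0) ∧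
        m'.reals 6 0 = m.reals 3 (m'.nats 11 0) ∧
        ∀ u < n, 1 ≤ m.reals 5 u → m'.reals 6 0 ≤ m.reals 3 u)) m := by
  refine ⟨by simp, ?_⟩
  refine Prog.wp_forLoop n (fun k m' =>
      (m'.nats 13 0 = 0 ∧ ∀ u < k, ¬ 1 ≤ m.reals 5 u) ∨
      (m'.nats 13 0 = 1 ∧ m'.nats 11 0 < n ∧ 1 ≤ m.reals 5 (m'.nats 11 0) ∧
        m'.reals 6 0 = m.reals 3 (m'.nats 11 0) ∧
        ∀ u < k, 1 ≤ m.reals 5 u → m'.reals 6 0 ≤ m.reals 3 u)) (by omega) rfl ?_ ?_ ?_ ?_ ?_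
  · intro m' h
    simp [h.1 0 rfl, hn]
  · intro k m' x h
    simpa using h
  · simp
  · intro k hk m' hf hi h
    have e1 : m'.reals 3 = m.reals 3 := hf.2 3 rfl
    have e2 : m'.reals 5 = m.reals 5 := hf.2 5 rfl
    refine ⟨by simpa using h1, fun ht => ?_, fun ht => ?_⟩
    · simp [hi, e1, e2] at ht ⊢
      refine ⟨by omega, by omega, hk, ht.1, fun u hu h2 => ?_⟩
      rcases lt_or_eq_of_le (by omega : u ≤ k) with hu | rfl
      · rcases h with ⟨_, h⟩ | ⟨h3, _, _, _, h⟩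
        · exact absurd h2 (h u hu)
        · exact (ht.2 (by omega)).le.trans (h u hu h2)
      · exact le_rfl
    · simp [hi, e1, e2] at ht ⊢
      rcases h with ⟨h3, h⟩ | ⟨h3, h4, h5, h6, h⟩
      · refine Or.inl ⟨h3, fun u hu => ?_⟩
        rcases lt_or_eq_of_le (by omega : u ≤ k) with hu | rfl
        · simpa using h u hu
        · by_contra h7
          have := ht (not_lt.1 h7)
          omega
      · refine Or.inr ⟨h3, h4, h5, h6, fun u hu h7 => ?_⟩
        rcases lt_or_eq_of_le (by omega : u ≤ k) with hu | rfl
        · exact h u hu h7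
        · exact (ht h7).2
  · intro m' hf h
    exact h

/-- The time at which the edge between `u` and `v` becomes tight. -/
noncomputable def slackAt (n : ℕ) (m : Mem) (u v : ℕ) : ℝ :=
  (m.reals 1 (u * n + v) - m.reals 4 u - m.reals 4 v) / (m.reals 5 u + m.reals 5 v)

/-- There is an edge between the active component of `u` and the component of `v`. -/
def IsCandidate (n : ℕ) (m : Mem) (u v : ℕ) : Prop :=
  1 ≤ m.nats 1 (u * n + v) ∧ m.nats 7 u ≠ m.nats 7 v ∧ 1 ≤ m.reals 5 u

/-- Membership in `L` is demanded for all pairs, because the slack is evaluated also at pairs that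
are not candidates. The comparison is strict, so a deactivation wins a tie against a merge. -/
theorem selectEdge_spec (hn : m.nats 0 0 = n) (hN : n + 2 ≤ N) (h1 : (1 : ℝ) ∈ L)
    (hL : ∀ u < n, ∀ v < n, m.reals 1 (u * n + v) - m.reals 4 u ∈ L ∧
      m.reals 1 (u * n + v) - m.reals 4 u - m.reals 4 v ∈ L ∧
      m.reals 5 u + m.reals 5 v ∈ L ∧ slackAt n m u v ∈ L)
    (h13 : m.nats 13 0 = 1) (h11 : m.nats 11 0 < n) :
    selectEdge.wp N L (fun m' =>
      ((m'.nats 13 0 = 1 ∧ m'.nats 11 0 = m.nats 11 0 ∧ m'.reals 6 0 = m.reals 6 0) ∨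
      (m'.nats 13 0 = 2 ∧ m'.nats 11 0 < n ∧ m'.nats 12 0 < n ∧
        IsCandidate n m (m'.nats 11 0) (m'.nats 12 0) ∧
        m'.reals 6 0 = slackAt n m (m'.nats 11 0) (m'.nats 12 0))) ∧
      m'.reals 6 0 ≤ m.reals 6 0 ∧
      ∀ u < n, ∀ v < n, IsCandidate n m u v → m'.reals 6 0 ≤ slackAt n m u v) m := by
  refine Prog.wp_forLoop_forLoop n (fun a b m' =>
      ((m'.nats 13 0 = 1 ∧ m'.nats 11 0 = m.nats 11 0 ∧ m'.reals 6 0 = m.reals 6 0) ∨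
      (m'.nats 13 0 = 2 ∧ m'.nats 11 0 < n ∧ m'.nats 12 0 < n ∧
        IsCandidate n m (m'.nats 11 0) (m'.nats 12 0) ∧
        m'.reals 6 0 = slackAt n m (m'.nats 11 0) (m'.nats 12 0))) ∧
      m'.reals 6 0 ≤ m.reals 6 0 ∧
      ∀ u < n, ∀ v < n, (u < a ∨ u = a ∧ v < b) → IsCandidate n m u v →
        m'.reals 6 0 ≤ slackAt n m u v) (by omega) (by decide) rfl rfl ?_ ?_ ?_ ?_ ?_ ?_ ?_
  · intro m' h
    simp [h.1 0 rfl, hn]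
  · intro a b m' x h
    simpa using h
  · intro a b m' x h
    simpa using h
  · simp [h13]
  · intro a ha b hb m' hf hi hj h
    have e0 : m'.nats 0 0 = n := by rw [hf.1 0 rfl, hn]
    have e1 : m'.reals 1 = m.reals 1 := hf.2 1 rfl
    have e4 : m'.reals 4 = m.reals 4 := hf.2 4 rfl
    have e5 : m'.reals 5 = m.reals 5 := hf.2 5 rfl
    have e7 : m'.nats 7 = m.nats 7 := hf.1 7 rfl
    have e8 : m'.nats 1 = m.nats 1 := hf.1 1 rfl
    obtain ⟨g1, g2, g3, g4⟩ := hL a ha b hb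
    obtain ⟨h2, h3, h4⟩ := h
    refine ⟨?_, fun ht => ?_, fun ht => ?_⟩
    · simp [hi, hj, e0, e1, e4, e5, h1, g1, g2, g3]
      exact g4
    · simp only [TestExpr.Holds, positive, natEq, natAt, realAt, realVar, NatExpr.eval,
        cellIndex, NatExpr.var, RealExpr.eval, slack, hi, hj, e0, e1, e4, e5, e7, e8] at ht
      rw [← le_antisymm_iff, Nat.cast_one, not_le] at ht
      have hlt : slackAt n m a b < m'.reals 6 0 := ht.2.2
      have hcand : IsCandidate n m a b := ⟨ht.1.1, ht.1.2, ht.2.1⟩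
      have hs : (m.reals 1 (a * n + b) - m.reals 4 a - m.reals 4 b) /
        (m.reals 5 a + m.reals 5 b) = slackAt n m a b := rfl
      simp [hi, hj, e0, e1, e4, e5, g1, g2, g3, hs, g4]
      refine ⟨by omega, by omega, by omega, ⟨ha, hb, hcand⟩, by linarith, ?_⟩
      intro u hu v hv huv hc
      rcases huv with huv | ⟨huv, hvb⟩
      · exact hlt.le.trans (h4 u hu v hv (Or.inl huv) hc)
      · rcases lt_or_eq_of_le (by omega : v ≤ b) with hvb | rfl
        · exact hlt.le.trans (h4 u hu v hv (Or.inr ⟨huv, hvb⟩) hc)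
        · rw [huv]
    · refine ⟨h2, h3, fun u hu v hv huv hc => ?_⟩
      simp only [TestExpr.Holds, positive, natEq, natAt, realAt, realVar, NatExpr.eval,
        cellIndex, NatExpr.var, RealExpr.eval, slack, hi, hj, e0, e1, e4, e5, e7, e8] at ht
      rw [← le_antisymm_iff, Nat.cast_one] at ht
      rcases huv with huv | ⟨huv, hvb⟩
      · exact h4 u hu v hv (Or.inl huv) hc
      · rcases lt_or_eq_of_le (by omega : v ≤ b) with hvb | rfl
        · exact h4 u hu v hv (Or.inr ⟨huv, hvb⟩) hc
        · subst huv
          by_contra hlt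
          exact ht ⟨⟨hc.1, hc.2.1⟩, hc.2.2, hlt⟩
  · rintro a ha m' ⟨h2, h3, h4⟩
    refine ⟨h2, h3, fun u hu v hv huv hc => h4 u hu v hv ?_ hc⟩
    omega
  · rintro m' hf ⟨h2, h3, h4⟩
    exact ⟨h2, h3, fun u hu v hv hc => h4 u hu v hv (Or.inl hu) hc⟩

theorem growDuals_spec (hn : m.nats 0 0 = n) (hN : n ≤ N)
    (hL : ∀ v < n, m.reals 6 0 * m.reals 5 v ∈ L ∧
      m.reals 4 v + m.reals 6 0 * m.reals 5 v ∈ L ∧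
      m.reals 3 v - m.reals 6 0 * m.reals 5 v ∈ L) :
    growDuals.wp N L (fun m' => ∀ v < n,
      m'.reals 4 v = m.reals 4 v + m.reals 6 0 * m.reals 5 v ∧
      m'.reals 3 v = m.reals 3 v - m.reals 6 0 * m.reals 5 v) m := by
  refine Prog.wp_forLoop n (fun k m' =>
    (∀ v < k, m'.reals 4 v = m.reals 4 v + m.reals 6 0 * m.reals 5 v ∧
      m'.reals 3 v = m.reals 3 v - m.reals 6 0 * m.reals 5 v) ∧
    ∀ v, k ≤ v → m'.reals 4 v = m.reals 4 v ∧ m'.reals 3 v = m.reals 3 v) hN rfl ?_ ?_ ?_ ?_ ?_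
  · intro m' h
    simp [h.1 0 rfl, hn]
  · intro k m' x h
    simpa using h
  · simp
  · rintro k hk m' hf hi ⟨h2, h3⟩
    have e5 : m'.reals 5 = m.reals 5 := hf.2 5 rfl
    have e6 : m'.reals 6 = m.reals 6 := hf.2 6 rfl
    obtain ⟨g1, g2, g3⟩ := hL k hk
    obtain ⟨g4, g5⟩ := h3 k le_rfl
    simp [hi, e5, e6, g4, g5, g1, g2, g3]
    refine ⟨fun v hv => ?_, fun v hv => ?_⟩
    · rcases lt_or_eq_of_le (by omega : v ≤ k) with hv | rfl
      · simpa [hv.ne] using h2 v hv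
      · simp
    · have : v ≠ k := by omega
      simpa [this] using h3 v (by omega)
  · exact fun m' hf h => h.1

theorem cell_inj {a b c d : ℕ} (hb : b < n) (hd : d < n) :
    a * n + b = c * n + d ↔ a = c ∧ b = d := by
  constructor
  · intro h
    have hn : 0 < n := by omega
    have h1 : (a * n + b) / n = a := by
      rw [mul_comm, Nat.mul_add_div hn, Nat.div_eq_of_lt hb, add_zero]
    have h2 : (c * n + d) / n = c := by
      rw [mul_comm, Nat.mul_add_div hn, Nat.div_eq_of_lt hd, add_zero]
    have h3 : a = c := by rw [← h1, ← h2, h]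
    subst h3
    exact ⟨rfl, by omega⟩
  · rintro ⟨rfl, rfl⟩
    rfl

/-- The label rows are written before array 9 changes, so the test for a missing label sees the old
marks. -/
theorem deactivateComp_spec (hn : m.nats 0 0 = n) (hN : n + 2 ≤ N) (h0 : (0 : ℝ) ∈ L)
    (h11 : m.nats 7 (m.nats 11 0) < n) :
    deactivateComp.wp N L (fun m' =>
      (∀ v < n, ∀ w < n, m'.nats 8 (v * n + w) =
        if m.nats 9 v = 0 ∧ m.nats 7 v = m.nats 7 (m.nats 11 0) ∧
          m.nats 7 w = m.nats 7 (m.nats 11 0) then 1 else m.nats 8 (v * n + w)) ∧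
      ∀ v < n, m'.nats 9 v = (if m.nats 7 v = m.nats 7 (m.nats 11 0) then 1 else m.nats 9 v) ∧
        m'.reals 5 v = if m.nats 7 v = m.nats 7 (m.nats 11 0) then 0 else m.reals 5 v) m := by
  set c := m.nats 7 (m.nats 11 0) with hc
  have hloop1 : ∀ m₁ : Mem, m₁.nats 0 = m.nats 0 → m₁.nats 7 = m.nats 7 → m₁.nats 8 = m.nats 8 →
      m₁.nats 9 = m.nats 9 → m₁.nats 16 0 = c → (Prog.forLoop 4 (.var 0) (.forLoop 5 (.var 0)
      (.ite (.conj (.natLe (natAt 9 4) (.const 0))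
          (.conj (natEq (natAt 7 4) (.var 16)) (natEq (natAt 7 5) (.var 16))))
        (.setNat 8 (cellIndex 4 5) (.const 1)) .skip))).wp N L (fun m' =>
      ∀ v < n, ∀ w < n, m'.nats 8 (v * n + w) =
        if m.nats 9 v = 0 ∧ m.nats 7 v = c ∧
          m.nats 7 w = c then 1 else m.nats 8 (v * n + w)) m₁ := by
    intro m₁ q0 q7 q8 q9 q16
    refine Prog.wp_forLoop_forLoop n (fun a b m' => ∀ v < n, ∀ w < n, m'.nats 8 (v * n + w) =
        if (v < a ∨ v = a ∧ w < b) ∧ m.nats 9 v = 0 ∧ m.nats 7 v = c ∧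
          m.nats 7 w = c then 1 else m.nats 8 (v * n + w)) (by omega) (by decide) rfl rfl
        ?_ ?_ ?_ ?_ ?_ ?_ ?_
    · intro m' h
      simp [h.1 0 rfl, hn, q0]
    · intro a b m' x h
      simpa using h
    · intro a b m' x h
      simpa using h
    · simp [q8]
    · intro a ha b hb m' hf hi hj h
      have e0 : m'.nats 0 0 = n := by rw [hf.1 0 rfl, q0, hn]
      have e7 : m'.nats 7 = m.nats 7 := by rw [hf.1 7 rfl, q7]
      have e9 : m'.nats 9 = m.nats 9 := by rw [hf.1 9 rfl, q9]
      have e16 : m'.nats 16 0 = c := by rw [hf.1 16 rfl, q16]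
      refine ⟨by simp, fun ht => ?_, fun ht => ?_⟩
      · simp [hi, hj, e7, e9, e16, ← le_antisymm_iff] at ht
        simp [hi, hj, e0]
        refine ⟨by omega, fun v hv w hw => ?_⟩
        simp only [Function.update_apply, cell_inj hw hb]
        split_ifs with h2 h3 h3
        · rfl
        · exact absurd ⟨by omega, by rw [h2.1]; exact ht.1, by rw [h2.1]; exact ht.2.1,
            by rw [h2.2]; exact ht.2.2⟩ h3
        · rw [h v hv w hw, if_pos ⟨by omega, h3.2⟩]
        · rw [h v hv w hw, if_neg]
          exact fun h4 => h3 ⟨by omega, h4.2⟩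
      · simp [hi, hj, e7, e9, e16, ← le_antisymm_iff] at ht ⊢
        intro v hv w hw
        rw [h v hv w hw]
        by_cases h2 : v = a ∧ w = b
        · obtain ⟨rfl, rfl⟩ := h2
          have h3 : ¬ (m.nats 9 v = 0 ∧ m.nats 7 v = c ∧ m.nats 7 w = c) := by tauto
          simp only [h3, and_false, if_false]
        · congr 1
          rw [eq_iff_iff]
          have : (v < a ∨ v = a ∧ w < b) ↔ (v < a ∨ v = a ∧ w ≤ b) := by omega
          rw [this]
    · intro a ha m' h v hv w hw
      rw [h v hv w hw]
      congr 1
      rw [eq_iff_iff]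
      have : (v < a ∨ v = a ∧ w < n) ↔ (v < a + 1 ∨ v = a + 1 ∧ w < 0) := by omega
      rw [this]
    · intro m' hf h v hv w hw
      rw [h v hv w hw]
      simp [hv]
  refine ⟨by simp [← hc]; omega, ?_⟩
  refine Prog.wp_seq (hloop1 _ ?_ ?_ ?_ ?_ ?_) ?_
  · simp
  · simp
  · simp
  · simp
  · simp [hc]
  · intro m₂ hf2 h2
    have q0 : m₂.nats 0 = m.nats 0 := by rw [hf2.1 0 rfl]; simp
    have q7 : m₂.nats 7 = m.nats 7 := by rw [hf2.1 7 rfl]; simp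
    have q9 : m₂.nats 9 = m.nats 9 := by rw [hf2.1 9 rfl]; simp
    have q16 : m₂.nats 16 0 = c := by rw [hf2.1 16 rfl]; simp [hc]
    have q5 : m₂.reals 5 = m.reals 5 := by rw [hf2.2 5 rfl]; simp
    refine Prog.wp_forLoop n (fun k m' =>
      (∀ v < n, m'.nats 9 v = (if v < k ∧ m.nats 7 v = c then 1 else m.nats 9 v) ∧
        m'.reals 5 v = if v < k ∧ m.nats 7 v = c then 0 else m.reals 5 v)) (by omega) rfl
      ?_ ?_ ?_ ?_ ?_
    · intro m' h
      simp [h.1 0 rfl, hn, q0]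
    · intro k m' x h
      simpa using h
    · simp [q9, q5]
    · intro k hk m' hf hi h
      have e7 : m'.nats 7 = m.nats 7 := by rw [hf.1 7 rfl, q7]
      have e16 : m'.nats 16 0 = c := by rw [hf.1 16 rfl, q16]
      refine ⟨by simp, fun ht => ?_, fun ht => ?_⟩
      · simp [hi, e7, e16, ← le_antisymm_iff] at ht
        simp [hi, h0]
        refine ⟨by omega, fun v hv => ?_⟩
        simp only [Function.update_apply]
        by_cases hvk : v = k
        · subst hvk
          simp [ht]
        · have : v < k ↔ v < k + 1 := by omega
          simpa [hvk, this] using h v hv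
      · simp [hi, e7, e16, ← le_antisymm_iff] at ht ⊢
        intro v hv
        by_cases hvk : v = k
        · subst hvk
          simpa [ht] using h v hv
        · have : v < k ↔ v < k + 1 := by omega
          simpa [this] using h v hv
    · intro m' hf h
      refine ⟨?_, fun v hv => by simpa [hv] using h v hv⟩
      rw [hf.1 8 rfl]
      exact h2

/-- Name, potential and activity of the union are put into scalars beforehand, because the loop
overwrites the arrays they come from. -/
theorem mergeComps_spec (hn : m.nats 0 0 = n) (hN : n + 2 ≤ N) (h0 : (0 : ℝ) ∈ L)
    (h1 : (1 : ℝ) ∈ L) (hL : m.reals 3 (m.nats 11 0) + m.reals 3 (m.nats 12 0) ∈ L)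
    (h7 : ∀ v < n, m.nats 7 v < n)
    (h11 : m.nats 11 0 < n) (h12 : m.nats 12 0 < n) {r : ℕ} (hr : m.nats 0 1 = r) :
    mergeComps.wp N L (fun m' =>
      (∀ v < n,
        m'.nats 7 v = (if m.nats 7 v = m.nats 7 (m.nats 11 0) ∨ m.nats 7 v = m.nats 7 (m.nats 12 0)
          then m.nats 7 (m.nats 11 0) else m.nats 7 v) ∧
        m'.reals 3 v = (if m.nats 7 v = m.nats 7 (m.nats 11 0) ∨
            m.nats 7 v = m.nats 7 (m.nats 12 0)
          then m.reals 3 (m.nats 11 0) + m.reals 3 (m.nats 12 0) else m.reals 3 v) ∧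
        m'.reals 5 v = if m.nats 7 v = m.nats 7 (m.nats 11 0) ∨ m.nats 7 v = m.nats 7 (m.nats 12 0)
          then (if m.nats 7 (m.nats 11 0) = m.nats 7 r ∨ m.nats 7 (m.nats 12 0) = m.nats 7 r
            then 0 else 1) else m.reals 5 v) ∧
      ∀ v < n, ∀ w < n, m'.nats 10 (v * n + w) =
        if (v = m.nats 11 0 ∧ w = m.nats 12 0) ∨ (v = m.nats 12 0 ∧ w = m.nats 11 0) then 1
        else m.nats 10 (v * n + w)) m := by
  set c := m.nats 7 (m.nats 11 0) with hc
  set d := m.nats 7 (m.nats 12 0) with hd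
  set W := m.reals 3 (m.nats 11 0) + m.reals 3 (m.nats 12 0) with hW
  set z : ℝ := if c = m.nats 7 r ∨ d = m.nats 7 r then 0 else 1 with hz
  have hcn : c < n := h7 _ h11
  have hdn : d < n := h7 _ h12
  have hloop : ∀ m₁ : Mem, (∀ a, a ≠ 16 → a ≠ 17 → m₁.nats a = m.nats a) → m₁.nats 16 0 = c →
      m₁.nats 17 0 = d → m₁.reals 3 = m.reals 3 → m₁.reals 5 = m.reals 5 → m₁.reals 7 0 = W →
      m₁.reals 8 0 = z → (Prog.forLoop 4 (.var 0)
      (.ite (disj (natEq (natAt 7 4) (.var 16)) (natEq (natAt 7 4) (.var 17)))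
        (.seq (.setNat 7 (.var 4) (.var 16))
          (.seq (.setReal 3 (.var 4) (realVar 7)) (.setReal 5 (.var 4) (realVar 8)))) .skip)).wp
      N L (fun m' => ∀ v < n,
        m'.nats 7 v = (if m.nats 7 v = c ∨ m.nats 7 v = d then c else m.nats 7 v) ∧
        m'.reals 3 v = (if m.nats 7 v = c ∨ m.nats 7 v = d then W else m.reals 3 v) ∧
        m'.reals 5 v = if m.nats 7 v = c ∨ m.nats 7 v = d then z else m.reals 5 v) m₁ := by
    intro m₁ q q16 q17 q3 q5 q7' q8
    refine Prog.wp_forLoop n (fun k m' =>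
      (∀ v < k,
        m'.nats 7 v = (if m.nats 7 v = c ∨ m.nats 7 v = d then c else m.nats 7 v) ∧
        m'.reals 3 v = (if m.nats 7 v = c ∨ m.nats 7 v = d then W else m.reals 3 v) ∧
        m'.reals 5 v = if m.nats 7 v = c ∨ m.nats 7 v = d then z else m.reals 5 v) ∧
      ∀ v, k ≤ v → m'.nats 7 v = m.nats 7 v ∧ m'.reals 3 v = m.reals 3 v ∧
        m'.reals 5 v = m.reals 5 v) (by omega) rfl ?_ ?_ ?_ ?_ ?_
    · intro m' h
      simp [h.1 0 rfl, hn, q]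
    · intro k m' x h
      simpa using h
    · simp [q, q3, q5]
    · rintro k hk m' hf hi ⟨h2, h3⟩
      have e16 : m'.nats 16 0 = c := by rw [hf.1 16 rfl, q16]
      have e17 : m'.nats 17 0 = d := by rw [hf.1 17 rfl, q17]
      have e7 : m'.reals 7 0 = W := by rw [hf.2 7 rfl, q7']
      have e8 : m'.reals 8 0 = z := by rw [hf.2 8 rfl, q8]
      obtain ⟨g1, g2, g3⟩ := h3 k le_rfl
      refine ⟨by simp, fun ht => ?_, fun ht => ?_⟩
      · simp [hi, g1, e16, e17, ← le_antisymm_iff, ← or_iff_not_imp_left] at ht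
        simp [hi, e16, e7, e8]
        refine ⟨by omega, fun v hv => ?_, fun v hv => ?_⟩
        · rcases lt_or_eq_of_le (by omega : v ≤ k) with hv | rfl
          · simpa [hv.ne] using h2 v hv
          · simp [ht]
        · have : v ≠ k := by omega
          simpa [this] using h3 v (by omega)
      · simp [hi, g1, e16, e17, ← le_antisymm_iff] at ht ⊢
        refine ⟨fun v hv => ?_, fun v hv => h3 v (by omega)⟩
        rcases lt_or_eq_of_le (by omega : v ≤ k) with hv | rfl
        · exact h2 v hv
        · simpa [ht] using ⟨g1, g2, g3⟩
    · exact fun m' hf h => h.1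
  refine ⟨by simp [← hc]; omega, by simp [← hd]; omega, by simpa using hL, ?_⟩
  refine Prog.wp_seq (Q := fun m' => m'.reals 8 0 = z) ⟨by simp, fun ht => ?_, fun ht => ?_⟩ ?_
  · simp [hr, ← le_antisymm_iff, ← or_iff_not_imp_left, ← hc, ← hd] at ht
    simp [h0, hz, ht]
  · simp [hr, ← le_antisymm_iff, ← or_iff_not_imp_left, ← hc, ← hd] at ht
    simp [h1, hz, ht]
  · intro m₁ hf1 h8
    refine Prog.wp_seq (hloop m₁ ?_ ?_ ?_ ?_ ?_ ?_ h8) ?_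
    · intro a ha hb
      rw [hf1.1 a rfl]
      simp [ha, hb]
    · rw [hf1.1 16 rfl]
      simp [hc]
    · rw [hf1.1 17 rfl]
      simp [hd]
    · rw [hf1.2 3 rfl]
      simp
    · rw [hf1.2 5 rfl]
      simp
    · rw [hf1.2 7 rfl]
      simp [hW]
    · intro m₂ hf2 h2
      have q0 : m₂.nats 0 0 = n := by rw [hf2.1 0 rfl, hf1.1 0 rfl]; simp [hn]
      have q11 : m₂.nats 11 = m.nats 11 := by rw [hf2.1 11 rfl, hf1.1 11 rfl]; simp
      have q12 : m₂.nats 12 = m.nats 12 := by rw [hf2.1 12 rfl, hf1.1 12 rfl]; simp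
      have q10 : m₂.nats 10 = m.nats 10 := by rw [hf2.1 10 rfl, hf1.1 10 rfl]; simp
      simp [q0, q11, q12, q10]
      refine ⟨by omega, h2, fun v hv w hw => ?_⟩
      simp only [Function.update_apply, cell_inj hw h11, cell_inj hw h12]
      split_ifs <;> first | rfl | tauto

end GWProgram

/-! ### Memory as a representation of the growth state -/

namespace PCST

variable {n : ℕ} {I : PCST n} {p : Fin n → ℝ}

/-- The class of `v` if `c` assigns a name to the class of each vertex. -/
def classOf (c : ℕ → ℕ) (v : Fin n) : Finset (Fin n) := Finset.univ.filter fun w => c w = c v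

@[simp] theorem mem_classOf {c : ℕ → ℕ} {v w : Fin n} : w ∈ classOf c v ↔ c w = c v := by
  simp [classOf]

theorem classOf_eq_iff {c : ℕ → ℕ} {v w : Fin n} :
    classOf c v = classOf c w ↔ c v = c w := by
  constructor
  · intro h
    have : v ∈ classOf c w := h ▸ mem_classOf.2 rfl
    exact mem_classOf.1 this
  · intro h
    ext x
    simp [h]

open scoped Classical in
/-- The total dual value of the sets that contain `v`. -/
noncomputable def GWState.dualAt (s : GWState n) (v : Fin n) : ℝ := ∑ R with v ∈ R, s.y R

open scoped Classical in
/-- The memory holds the state `s` of the growth phase. -/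
structure Represents (p : Fin n → ℝ) (m : Mem) (s : GWState n) : Prop where
  comps : ∀ C, C ∈ s.comps ↔ ∃ v, C = classOf (m.nats 7) v
  name_lt : ∀ v : Fin n, m.nats 7 v < n
  active : ∀ v : Fin n, m.reals 5 v = if classOf (m.nats 7) v ∈ s.active then 1 else 0
  potential : ∀ v : Fin n, m.reals 3 v = s.potential p (classOf (m.nats 7) v)
  dual : ∀ v : Fin n, m.reals 4 v = s.dualAt v
  labelled : ∀ v : Fin n, m.nats 9 v = if s.label v = none then 0 else 1
  label : ∀ v w : Fin n, m.nats 8 (v * n + w) = if ∃ A, s.label v = some A ∧ w ∈ A then 1 else 0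
  forest : ∀ v w : Fin n, m.nats 10 (v * n + w) = if s(v, w) ∈ s.forest then 1 else 0

section States

variable {s : GWState n}

open scoped Classical in
-- A support set lies inside one component, so it cannot contain both ends of an edge between two
-- components; it is cut exactly when it contains one of them. Hence vertex sums replace the
-- exponentially many dual variables.
theorem GWState.paid_eq_of_supp (h : s.Inv I p) (z : GWState n)
    (hz : ∀ R, z.y R ≠ 0 → ∃ C ∈ s.comps, R ⊆ C) {u v : Fin n} {A B : Finset (Fin n)}
    (hA : A ∈ s.comps) (hB : B ∈ s.comps) (hu : u ∈ A) (hv : v ∈ B) (hAB : A ≠ B) :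
    z.paid s(u, v) = z.dualAt u + z.dualAt v := by
  rw [GWState.paid, GWState.dualAt, GWState.dualAt, Finset.sum_filter, Finset.sum_filter,
    Finset.sum_filter, ← Finset.sum_add_distrib]
  refine Finset.sum_congr rfl fun R _ => ?_
  by_cases hR : z.y R = 0
  · simp [hR]
  obtain ⟨C, hC, hRC⟩ := hz R hR
  have hnot : ¬ (u ∈ R ∧ v ∈ R) := by
    rintro ⟨h1, h2⟩
    exact hAB ((h.comps_eq A hA C hC u hu (hRC h1)).trans (h.comps_eq B hB C hC v hv (hRC h2)).symm)
  have hcut : Cuts R s(u, v) ↔ (u ∈ R ∨ v ∈ R) := by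
    constructor
    · rintro ⟨a, ha, b, hb, hab⟩
      rcases Sym2.eq_iff.1 hab with ⟨rfl, rfl⟩ | ⟨rfl, rfl⟩
      · exact Or.inl ha
      · exact Or.inr ha
    · rintro (h1 | h1)
      · exact ⟨u, h1, v, fun h2 => hnot ⟨h1, h2⟩, rfl⟩
      · exact ⟨v, h1, u, fun h2 => hnot ⟨h2, h1⟩, Sym2.eq_swap⟩
  by_cases h1 : u ∈ R <;> by_cases h2 : v ∈ R
  · exact absurd ⟨h1, h2⟩ hnot
  all_goals simp [hcut, h1, h2]

open scoped Classical in
theorem GWState.Inv.dualAt_grow (h : s.Inv I p) (d : ℝ) {v : Fin n} {C : Finset (Fin n)}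
    (hC : C ∈ s.comps) (hv : v ∈ C) :
    (s.grow d).dualAt v = s.dualAt v + d * if C ∈ s.active then 1 else 0 := by
  have : ∀ R, (s.grow d).y R = s.y R + if R ∈ s.active then d else 0 := by
    intro R; simp only [GWState.grow]; split_ifs <;> simp
  simp only [GWState.dualAt]
  simp_rw [this]
  rw [Finset.sum_add_distrib]
  congr 1
  rw [Finset.sum_ite, Finset.sum_const_zero, add_zero, Finset.sum_const, nsmul_eq_mul, mul_comm,
    Finset.filter_filter]
  congr 1
  split_ifs with hCa
  · rw [Nat.cast_eq_one, Finset.card_eq_one]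
    refine ⟨C, ?_⟩
    ext R
    simp only [Finset.mem_filter, Finset.mem_univ, true_and, Finset.mem_singleton]
    constructor
    · rintro ⟨h1, h2⟩
      exact h.comps_eq R (h.active_comps R h2) C hC v h1 hv
    · rintro rfl
      exact ⟨hv, hCa⟩
  · rw [Nat.cast_eq_zero, Finset.card_eq_zero, Finset.filter_eq_empty_iff]
    rintro R - ⟨h1, h2⟩
    have := h.comps_eq R (h.active_comps R h2) C hC v h1 hv
    exact hCa (this ▸ h2)

open scoped Classical in
theorem GWState.Inv.potential_grow (h : s.Inv I p) (d : ℝ) {C : Finset (Fin n)}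
    (hC : C ∈ s.comps) :
    (s.grow d).potential p C = s.potential p C - d * if C ∈ s.active then 1 else 0 := by
  have : ∀ R, (s.grow d).y R = s.y R + if R ∈ s.active then d else 0 := by
    intro R; simp only [GWState.grow]; split_ifs <;> simp
  simp only [GWState.potential]
  simp_rw [this]
  rw [Finset.sum_add_distrib, ← sub_sub]
  congr 1
  rw [Finset.sum_ite, Finset.sum_const_zero, add_zero, Finset.sum_const, nsmul_eq_mul, mul_comm]
  congr 1
  split_ifs with hCa
  · rw [Nat.cast_eq_one, Finset.card_eq_one]
    refine ⟨C, ?_⟩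
    ext R
    simp only [Finset.mem_filter, Finset.mem_powerset, Finset.mem_singleton]
    constructor
    · rintro ⟨h1, h2⟩
      exact h.comp_subset (h.active_comps R h2) hC h1
    · rintro rfl
      exact ⟨subset_rfl, hCa⟩
  · rw [Nat.cast_eq_zero, Finset.card_eq_zero, Finset.filter_eq_empty_iff]
    rintro R h1 h2
    have := h.comp_subset (h.active_comps R h2) hC (Finset.mem_powerset.1 h1)
    exact hCa (this ▸ h2)

open scoped Classical in
-- A support set inside the union lies in exactly one of the two components; non-emptiness excludes
-- counting it twice.
theorem GWState.Inv.potential_union (h : s.Inv I p) {A B : Finset (Fin n)} (hA : A ∈ s.comps)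
    (hB : B ∈ s.comps) (hAB : A ≠ B) :
    s.potential p (A ∪ B) = s.potential p A + s.potential p B := by
  have hdisj : Disjoint A B := Finset.disjoint_left.2 fun v h1 h2 =>
    hAB (h.comps_eq A hA B hB v h1 h2)
  have hps : ∀ S : Finset (Fin n), ∑ R ∈ S.powerset, s.y R = ∑ R, if R ⊆ S then s.y R else 0 := by
    intro S
    rw [← Finset.sum_filter]
    congr 1
    ext R
    simp only [Finset.mem_powerset, Finset.mem_filter, Finset.mem_univ, true_and]
  have : ∑ R ∈ (A ∪ B).powerset, s.y R =
      ∑ R ∈ A.powerset, s.y R + ∑ R ∈ B.powerset, s.y R := by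
    rw [hps, hps, hps, ← Finset.sum_add_distrib]
    refine Finset.sum_congr rfl fun R _ => ?_
    by_cases hR : s.y R = 0
    · simp [hR]
    obtain ⟨⟨x, hx⟩, -, C, hC, hRC⟩ := h.y_supp R hR
    by_cases hRA : R ⊆ A
    · have hRB : ¬ R ⊆ B := fun hRB => Finset.disjoint_left.1 hdisj (hRA hx) (hRB hx)
      simp [hRA, hRB, hRA.trans Finset.subset_union_left]
    by_cases hRB : R ⊆ B
    · simp [hRA, hRB, hRB.trans Finset.subset_union_right]
    have : ¬ R ⊆ A ∪ B := by
      intro hRAB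
      rcases Finset.mem_union.1 (hRAB hx) with hx' | hx'
      · have := h.comps_eq A hA C hC x hx' (hRC hx)
        exact hRA (this ▸ hRC)
      · have := h.comps_eq B hB C hC x hx' (hRC hx)
        exact hRB (this ▸ hRC)
    simp [hRA, hRB, this]
  rw [GWState.potential, GWState.potential, GWState.potential, this, Finset.sum_union hdisj]
  ring

theorem GWState.Inv.potential_nonneg (h : s.Inv I p) (S : Finset (Fin n)) :
    0 ≤ s.potential p S := sub_nonneg.2 (h.dual_le S)

/-- Bounds that do not depend on the state, such as this one and `dualAt_le`, keep the stored
numbers small. -/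
theorem GWState.Inv.potential_le (h : s.Inv I p) (hp : ∀ v, 0 ≤ p v) (S : Finset (Fin n)) :
    s.potential p S ≤ ∑ v, p v := by
  have h1 : 0 ≤ ∑ R ∈ S.powerset, s.y R := Finset.sum_nonneg fun R _ => h.y_nonneg R
  have h2 : ∑ v ∈ S, p v ≤ ∑ v, p v :=
    Finset.sum_le_sum_of_subset_of_nonneg (Finset.subset_univ _) fun v _ _ => hp v
  rw [GWState.potential]
  linarith

theorem GWState.Inv.dualAt_nonneg (h : s.Inv I p) (v : Fin n) : 0 ≤ s.dualAt v :=
  Finset.sum_nonneg fun R _ => h.y_nonneg R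

theorem GWState.Inv.dualAt_le (h : s.Inv I p) (v : Fin n) : s.dualAt v ≤ ∑ v, p v := by
  refine le_trans ?_ (h.dual_le Finset.univ)
  exact Finset.sum_le_sum_of_subset_of_nonneg (by intro R _; simp) fun R _ _ => h.y_nonneg R

end States

section Updates

variable {m m' : Mem} {s : GWState n}

theorem Represents.classOf_mem (hr : Represents p m s) (v : Fin n) :
    classOf (m.nats 7) v ∈ s.comps := (hr.comps _).2 ⟨v, rfl⟩

theorem Represents.mem_active (hr : Represents p m s) (v : Fin n) :
    1 ≤ m.reals 5 v ↔ classOf (m.nats 7) v ∈ s.active := by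
  rw [hr.active v]
  split_ifs with h <;> simp [h]

open scoped Classical in
/-- Growing by `d` is feasible if no edge between two components and no active component prevents
it. -/
theorem Represents.feasible_grow (hr : Represents p m s) (h : s.Inv I p) {d : ℝ}
    (hW : ∀ v : Fin n, classOf (m.nats 7) v ∈ s.active → d ≤ m.reals 3 v)
    (hE : ∀ u v : Fin n, I.graph.Adj u v → classOf (m.nats 7) u ∈ s.active →
      classOf (m.nats 7) u ≠ classOf (m.nats 7) v →
      m.reals 4 u + m.reals 4 v + d * (m.reals 5 u + m.reals 5 v) ≤ I.cost s(u, v)) :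
    (s.grow d).Feasible I p := by
  constructor
  · intro e he
    induction e using Sym2.ind with
    | _ u v =>
      have hadj : I.graph.Adj u v := he
      by_cases hsame : classOf (m.nats 7) u = classOf (m.nats 7) v
      · rw [GWState.Inv.paid_grow, Finset.filter_false_of_mem, Finset.card_empty]
        · simpa using h.paid_le _ he
        · rintro C hC ⟨a, ha, b, hb, hab⟩
          have key : ∀ a b, a ∈ C → b ∉ C → classOf (m.nats 7) a = classOf (m.nats 7) b → False := by
            intro a b ha hb hab
            have := h.comps_eq C (h.active_comps C hC) _ (hr.classOf_mem a) a ha (by simp)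
            rw [this, hab] at hb
            simp at hb
          rcases Sym2.eq_iff.1 hab with ⟨rfl, rfl⟩ | ⟨rfl, rfl⟩
          · exact key _ _ ha hb hsame
          · exact key _ _ ha hb hsame.symm
      · have key : ∀ u v, I.graph.Adj u v → classOf (m.nats 7) u ≠ classOf (m.nats 7) v →
            (s.grow d).paid s(u, v) =
              m.reals 4 u + m.reals 4 v + d * (m.reals 5 u + m.reals 5 v) := by
          intro u v huv hne
          have h1 : (s.grow d).paid s(u, v) = (s.grow d).dualAt u + (s.grow d).dualAt v := by
            refine GWState.paid_eq_of_supp h _ (fun R hR => ?_) (hr.classOf_mem u)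
              (hr.classOf_mem v) (by simp) (by simp) hne
            by_cases hRa : R ∈ s.active
            · exact ⟨R, h.active_comps R hRa, subset_rfl⟩
            · have : s.y R ≠ 0 := by simpa [GWState.grow, hRa] using hR
              exact (h.y_supp R this).2.2
          rw [h1, h.dualAt_grow d (hr.classOf_mem u) (by simp),
            h.dualAt_grow d (hr.classOf_mem v) (by simp), hr.dual u, hr.dual v, hr.active u,
            hr.active v]
          ring
        -- The hypothesis on edges has the active end first. If only the other end is active the
        -- edge is reversed; if neither is, growth does not affect it.
        by_cases hua : classOf (m.nats 7) u ∈ s.active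
        · rw [key u v hadj hsame]
          exact hE u v hadj hua hsame
        · by_cases hva : classOf (m.nats 7) v ∈ s.active
          · rw [Sym2.eq_swap, key v u hadj.symm (Ne.symm hsame)]
            exact hE v u hadj.symm hva (Ne.symm hsame)
          · have h1 := h.paid_le _ he
            rw [GWState.paid_eq_of_supp h s (fun R hR => (h.y_supp R hR).2.2) (hr.classOf_mem u)
              (hr.classOf_mem v) (by simp) (by simp) hsame] at h1
            rw [key u v hadj hsame, hr.dual u, hr.dual v, hr.active u, hr.active v, if_neg hua,
              if_neg hva]
            linarith
  · intro S hS
    have hS : S ∈ s.active := hS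
    obtain ⟨v, rfl⟩ := (hr.comps S).1 (h.active_comps S hS)
    rw [h.potential_grow d (hr.classOf_mem v), if_pos hS, ← hr.potential v]
    linarith [hW v hS]

theorem Represents.grow (hr : Represents p m s) (h : s.Inv I p) (d : ℝ)
    (hnat : ∀ a, a ∈ [7, 8, 9, 10] → m'.nats a = m.nats a) (h5 : m'.reals 5 = m.reals 5)
    (h34 : ∀ v : Fin n, m'.reals 4 v = m.reals 4 v + d * m.reals 5 v ∧
      m'.reals 3 v = m.reals 3 v - d * m.reals 5 v) : Represents p m' (s.grow d) := by
  have e7 := hnat 7 (by simp)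
  have e8 := hnat 8 (by simp)
  have e9 := hnat 9 (by simp)
  have e10 := hnat 10 (by simp)
  constructor
  · rw [e7]; exact hr.comps
  · rw [e7]; exact hr.name_lt
  · rw [e7, h5]; exact hr.active
  · intro v
    rw [e7, (h34 v).2, h.potential_grow d (hr.classOf_mem v), hr.potential v, hr.active v]
  · intro v
    rw [(h34 v).1, h.dualAt_grow d (hr.classOf_mem v) (by simp), hr.dual v, hr.active v]
  · rw [e9]; exact hr.labelled
  · rw [e8]; exact hr.label
  · rw [e10]; exact hr.forest

open scoped Classical in
theorem Represents.deactivate (hr : Represents p m s) (u : Fin n)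
    (hnat : ∀ a, a ∈ [7, 10] → m'.nats a = m.nats a)
    (h3 : m'.reals 3 = m.reals 3) (h4 : m'.reals 4 = m.reals 4)
    (h8 : ∀ v < n, ∀ w < n, m'.nats 8 (v * n + w) =
        if m.nats 9 v = 0 ∧ m.nats 7 v = m.nats 7 u ∧ m.nats 7 w = m.nats 7 u then 1
        else m.nats 8 (v * n + w))
    (h95 : ∀ v < n, m'.nats 9 v = (if m.nats 7 v = m.nats 7 u then 1 else m.nats 9 v) ∧
        m'.reals 5 v = if m.nats 7 v = m.nats 7 u then 0 else m.reals 5 v) :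
    Represents p m' (s.deactivate (classOf (m.nats 7) u)) := by
  have e7 := hnat 7 (by simp)
  have e10 := hnat 10 (by simp)
  constructor
  · rw [e7]; exact hr.comps
  · rw [e7]; exact hr.name_lt
  · intro v
    rw [e7, (h95 v v.2).2, hr.active v]
    simp only [GWState.deactivate, Finset.mem_erase, Ne, classOf_eq_iff]
    by_cases hvu : m.nats 7 v = m.nats 7 u <;> simp [hvu]
  · rw [e7, h3]; exact hr.potential
  · rw [h4]; exact hr.dual
  · intro v
    rw [(h95 v v.2).1, hr.labelled v]
    simp only [GWState.deactivate, mem_classOf]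
    by_cases hvu : m.nats 7 v = m.nats 7 u <;> by_cases hl : s.label v = none <;> simp [hvu, hl]
  · intro v w
    rw [h8 v v.2 w w.2, hr.label v w, hr.labelled v]
    simp only [GWState.deactivate, mem_classOf]
    by_cases hvu : m.nats 7 v = m.nats 7 u <;> by_cases hl : s.label v = none <;>
      simp [hvu, hl]
  · rw [e10]; exact hr.forest

open scoped Classical in
theorem Represents.merge (hr : Represents p m s) (h : s.Inv I p) {u v : Fin n}
    (huv : classOf (m.nats 7) u ≠ classOf (m.nats 7) v)
    (hnat : ∀ a, a ∈ [8, 9] → m'.nats a = m.nats a) (h4 : m'.reals 4 = m.reals 4)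
    (h735 : ∀ w < n,
        m'.nats 7 w = (if m.nats 7 w = m.nats 7 u ∨ m.nats 7 w = m.nats 7 v
          then m.nats 7 u else m.nats 7 w) ∧
        m'.reals 3 w = (if m.nats 7 w = m.nats 7 u ∨ m.nats 7 w = m.nats 7 v
          then m.reals 3 u + m.reals 3 v else m.reals 3 w) ∧
        m'.reals 5 w = if m.nats 7 w = m.nats 7 u ∨ m.nats 7 w = m.nats 7 v
          then (if m.nats 7 u = m.nats 7 I.root ∨ m.nats 7 v = m.nats 7 I.root
            then 0 else 1) else m.reals 5 w)
    (h10 : ∀ x < n, ∀ w < n, m'.nats 10 (x * n + w) =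
        if (x = u ∧ w = v) ∨ (x = v ∧ w = u) then 1 else m.nats 10 (x * n + w)) :
    Represents p m' (s.merge I (classOf (m.nats 7) u) (classOf (m.nats 7) v) s(u, v)) := by
  have e8 := hnat 8 (by simp)
  have e9 := hnat 9 (by simp)
  set A := classOf (m.nats 7) u with hA
  set B := classOf (m.nats 7) v with hB
  have hAc : A ∈ s.comps := hr.classOf_mem u
  have hBc : B ∈ s.comps := hr.classOf_mem v
  have huA : u ∈ A := by simp [hA]
  have hvB : v ∈ B := by simp [hB]
  have hin : ∀ w : Fin n, (m.nats 7 w = m.nats 7 u ∨ m.nats 7 w = m.nats 7 v) ↔ w ∈ A ∪ B := by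
    intro w; simp [hA, hB]
  have hcls : ∀ w, classOf (m'.nats 7) w = if w ∈ A ∪ B then A ∪ B else classOf (m.nats 7) w := by
    intro w
    ext x
    rw [mem_classOf, (h735 x x.2).1, (h735 w w.2).1]
    simp only [hin]
    have hx := hin x
    have hw := hin w
    by_cases h1 : x ∈ A ∪ B <;> by_cases h2 : w ∈ A ∪ B
    · simp only [if_pos h1, if_pos h2]; simp only [h1]
    · simp only [if_pos h1, if_neg h2, mem_classOf]
      have h3 := hw.not.2 h2
      push Not at h3
      refine ⟨fun h4 => absurd h4.symm h3.1, fun h4 => ?_⟩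
      rcases hx.2 h1 with h5 | h5
      · exact absurd (h4.symm.trans h5) h3.1
      · exact absurd (h4.symm.trans h5) h3.2
    · simp only [if_pos h2, h1, iff_false]
      exact fun h4 => h1 (hx.1 (Or.inl h4))
    · simp only [if_neg h1, if_neg h2, mem_classOf]
  have hne : ∀ w, w ∉ A ∪ B → classOf (m.nats 7) w ≠ A ∧ classOf (m.nats 7) w ≠ B ∧
      classOf (m.nats 7) w ≠ A ∪ B := by
    intro w hw
    have hself : w ∈ classOf (m.nats 7) w := by simp
    refine ⟨fun h1 => hw ?_, fun h1 => hw ?_, fun h1 => hw ?_⟩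
    · exact Finset.mem_union_left _ (h1 ▸ hself)
    · exact Finset.mem_union_right _ (h1 ▸ hself)
    · exact h1 ▸ hself
  -- This ensures that a union containing the root is not active by accident, as an old component.
  have hnotin : A ∪ B ∉ s.comps := by
    intro h1
    have h2 := h.comps_eq A hAc _ h1 u huA (Finset.mem_union_left _ huA)
    have h3 := h.comps_eq B hBc _ h1 v hvB (Finset.mem_union_right _ hvB)
    exact huv (h2.trans h3.symm)
  constructor
  · intro C
    simp only [GWState.merge, Finset.mem_insert, Finset.mem_erase, hr.comps]
    constructor
    · rintro (rfl | ⟨h1, h2, w, rfl⟩)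
      · exact ⟨u, by rw [hcls, if_pos (Finset.mem_union_left _ huA)]⟩
      · refine ⟨w, ?_⟩
        rw [hcls, if_neg]
        intro hw
        rcases (hin w).2 hw with h3 | h3
        · exact h2 (classOf_eq_iff.2 h3)
        · exact h1 (classOf_eq_iff.2 h3)
    · rintro ⟨w, rfl⟩
      rw [hcls]
      split_ifs with hw
      · exact Or.inl rfl
      · exact Or.inr ⟨(hne w hw).2.1, (hne w hw).1, w, rfl⟩
  · intro w
    rw [(h735 w w.2).1]
    split_ifs
    · exact hr.name_lt u
    · exact hr.name_lt w
  · intro w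
    rw [(h735 w w.2).2.2, hcls]
    simp only [hin]
    have hroot : (m.nats 7 u = m.nats 7 I.root ∨ m.nats 7 v = m.nats 7 I.root) ↔
        I.root ∈ A ∪ B := by
      rw [← hin]; constructor <;> rintro (h1 | h1) <;> simp [h1]
    simp only [hroot, GWState.merge]
    by_cases hw : w ∈ A ∪ B
    · simp only [if_pos hw]
      by_cases hr' : I.root ∈ A ∪ B
      · simp only [if_pos hr', Finset.mem_erase]
        rw [if_neg]
        exact fun h1 => hnotin (h.active_comps _ h1.2.2)
      · simp only [if_neg hr', Finset.mem_insert_self, if_true]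
    · simp only [if_neg hw]
      rw [hr.active w]
      obtain ⟨h1, h2, h3⟩ := hne w hw
      by_cases hr' : I.root ∈ A ∪ B
      · simp only [if_pos hr', Finset.mem_erase, ne_eq, h1, h2, not_false_eq_true, true_and]
      · simp only [if_neg hr', Finset.mem_insert, Finset.mem_erase, ne_eq, h1, h2, h3,
          not_false_eq_true, true_and, false_or]
  · intro w
    rw [(h735 w w.2).2.1, hcls]
    simp only [hin]
    change _ = s.potential p _
    split_ifs with hw
    · rw [h.potential_union hAc hBc huv, hr.potential u, hr.potential v]
    · exact hr.potential w
  · rw [h4]; exact hr.dual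
  · rw [e9]; exact hr.labelled
  · rw [e8]; exact hr.label
  · intro x w
    rw [h10 x x.2 w w.2, hr.forest x w]
    simp only [GWState.merge, Finset.mem_insert, Sym2.eq_iff, Fin.val_inj]
    by_cases h1 : (x = u ∧ w = v) ∨ (x = v ∧ w = u) <;> simp [h1]

end Updates

end PCST

/-! ### The growth phase as run by the program, with control of the numbers -/

namespace PCST

open GWProgram

variable {n : ℕ} {I : PCST n} {ε : ℝ} {L : Set ℝ} {N : ℕ}

/-- The penalties with which the growth phase is run. -/
noncomputable def scaledPenalty (I : PCST n) (ε : ℝ) (v : Fin n) : ℝ := 2 / ε * I.penalty v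

theorem scaledPenalty_nonneg (I : PCST n) (hε : 0 < ε) (v : Fin n) : 0 ≤ I.scaledPenalty ε v :=
  mul_nonneg (div_nonneg zero_le_two hε.le) (I.penalty_nonneg v)

open scoped Classical in
/-- A bound for all numbers that occur in the growth phase. -/
noncomputable def magnitude (I : PCST n) (ε : ℝ) : ℝ :=
  ∑ e with e ∈ I.graph.edgeSet, I.cost e + 2 * ∑ v, I.scaledPenalty ε v + 2

/-- A set of numbers that is large enough for the computation: the numbers that occur after `k`
iterations of the growth phase lie in the group `lat k`. -/
structure Regime (I : PCST n) (ε : ℝ) (L : Set ℝ) where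
  lat : ℕ → AddSubgroup ℝ
  mono : ∀ k x, x ∈ lat k → x ∈ lat (k + 1)
  half : ∀ k x, x ∈ lat k → x / 2 ∈ lat (k + 1)
  cost_mem : ∀ e ∈ I.graph.edgeSet, I.cost e ∈ lat 0
  penalty_mem : ∀ v, I.scaledPenalty ε v ∈ lat 0
  one_mem : (1 : ℝ) ∈ lat 0
  mem_of_abs_le : ∀ k ≤ 2 * n + 1, ∀ x ∈ lat k, |x| ≤ I.magnitude ε → x ∈ L
  scale_mem : 2 / ε ∈ L
  accuracy_mem : ε ∈ L
  input_penalty_mem : ∀ v, I.penalty v ∈ L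

/-- The input arrays of the memory are those of the initial memory. -/
structure HoldsInput (I : PCST n) (ε : ℝ) (m : Mem) : Prop where
  nats0 : m.nats 0 = (I.input ε).nats 0
  nats1 : m.nats 1 = (I.input ε).nats 1
  reals0 : m.reals 0 = (I.input ε).reals 0
  reals1 : m.reals 1 = (I.input ε).reals 1
  reals2 : m.reals 2 = (I.input ε).reals 2

section Input

variable {m : Mem}

theorem cell_lt (u v : Fin n) : (u : ℕ) * n + v < n * n := by
  have h1 := u.2
  have h2 := v.2
  calc (u : ℕ) * n + v < u * n + n := by omega
    _ = (u + 1) * n := by ring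
    _ ≤ n * n := Nat.mul_le_mul_right _ h1

theorem divNat_cell (u v : Fin n) :
    Fin.divNat (⟨(u : ℕ) * n + v, cell_lt u v⟩ : Fin (n * n)) = u := by
  have h1 := u.2
  have h2 := v.2
  ext
  simp only [Fin.coe_divNat]
  rw [mul_comm, Nat.mul_add_div (by omega), Nat.div_eq_of_lt h2, add_zero]

theorem modNat_cell (u v : Fin n) :
    Fin.modNat (⟨(u : ℕ) * n + v, cell_lt u v⟩ : Fin (n * n)) = v := by
  have h2 := v.2
  ext
  simp only [Fin.coe_modNat]
  rw [mul_comm, Nat.mul_add_mod, Nat.mod_eq_of_lt h2]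

theorem HoldsInput.card (h : HoldsInput I ε m) : m.nats 0 0 = n := by
  rw [h.nats0]; simp [input]

theorem HoldsInput.root (h : HoldsInput I ε m) : m.nats 0 1 = I.root := by
  rw [h.nats0]; simp [input]

theorem HoldsInput.accuracy (h : HoldsInput I ε m) : m.reals 0 0 = ε := by
  rw [h.reals0]; simp [input]

theorem HoldsInput.penalty (h : HoldsInput I ε m) (v : Fin n) : m.reals 2 v = I.penalty v := by
  rw [h.reals2]; simp [input]

open scoped Classical in
theorem HoldsInput.adj (h : HoldsInput I ε m) (u v : Fin n) :
    m.nats 1 (u * n + v) = if I.graph.Adj u v then 1 else 0 := by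
  rw [h.nats1]
  simp only [input, dif_pos (cell_lt u v), divNat_cell, modNat_cell]

open scoped Classical in
theorem HoldsInput.cost (h : HoldsInput I ε m) (u v : Fin n) :
    m.reals 1 (u * n + v) = if I.graph.Adj u v then I.cost s(u, v) else 0 := by
  rw [h.reals1]
  simp only [input, dif_pos (cell_lt u v), divNat_cell, modNat_cell]

theorem HoldsInput.of_frame {P : Prog} {m' : Mem} (h : HoldsInput I ε m) (hf : P.Frame m m')
    (h0 : P.writesNat 0 = false) (h1 : P.writesNat 1 = false) (h2 : P.writesReal 0 = false)
    (h3 : P.writesReal 1 = false) (h4 : P.writesReal 2 = false) : HoldsInput I ε m' where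
  nats0 := by rw [hf.1 0 h0, h.nats0]
  nats1 := by rw [hf.1 1 h1, h.nats1]
  reals0 := by rw [hf.2 0 h2, h.reals0]
  reals1 := by rw [hf.2 1 h3, h.reals1]
  reals2 := by rw [hf.2 2 h4, h.reals2]

end Input

namespace Regime

theorem lat_le (R : Regime I ε L) {j k : ℕ} (hjk : j ≤ k) {x : ℝ} (hx : x ∈ R.lat j) :
    x ∈ R.lat k := by
  induction hjk with
  | refl => exact hx
  | step _ ih => exact R.mono _ _ ih

open scoped Classical in
theorem edge_cost_le (I : PCST n) {e : Sym2 (Fin n)} (he : e ∈ I.graph.edgeSet) :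
    I.cost e ≤ ∑ e with e ∈ I.graph.edgeSet, I.cost e :=
  Finset.single_le_sum (f := I.cost) (fun e he => I.cost_nonneg e (Finset.mem_filter.1 he).2)
    (Finset.mem_filter.2 ⟨Finset.mem_univ e, he⟩)

open scoped Classical in
theorem edge_costs_nonneg (I : PCST n) : 0 ≤ ∑ e with e ∈ I.graph.edgeSet, I.cost e :=
  Finset.sum_nonneg fun e he => I.cost_nonneg e (Finset.mem_filter.1 he).2

theorem sum_scaledPenalty_nonneg (I : PCST n) (hε : 0 < ε) : 0 ≤ ∑ v, I.scaledPenalty ε v :=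
  Finset.sum_nonneg fun v _ => scaledPenalty_nonneg I hε v

theorem mem_of_le (R : Regime I ε L) {k : ℕ} (hk : k ≤ 2 * n + 1) {x : ℝ}
    (hx : x ∈ R.lat k) (h : |x| ≤ 2 * ∑ v, I.scaledPenalty ε v + 2) : x ∈ L :=
  R.mem_of_abs_le k hk x hx (h.trans (by
    have := edge_costs_nonneg I
    rw [magnitude]
    linarith))

theorem zero_mem (R : Regime I ε L) (hε : 0 < ε) : (0 : ℝ) ∈ L :=
  R.mem_of_le (Nat.zero_le _) (R.lat 0).zero_mem (by
    have := sum_scaledPenalty_nonneg I hε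
    rw [abs_zero]; linarith)

theorem one_mem_set (R : Regime I ε L) (hε : 0 < ε) : (1 : ℝ) ∈ L :=
  R.mem_of_le (Nat.zero_le _) R.one_mem (by
    have := sum_scaledPenalty_nonneg I hε
    rw [abs_one]; linarith)

theorem two_mem (R : Regime I ε L) (hε : 0 < ε) : (2 : ℝ) ∈ L :=
  R.mem_of_le (Nat.zero_le _) (one_add_one_eq_two (R := ℝ) ▸ (R.lat 0).add_mem R.one_mem R.one_mem)
    (by
    have := sum_scaledPenalty_nonneg I hε
    rw [abs_two]; linarith)

end Regime

/-- The real numbers in memory after `k` iterations of the growth phase are in `lat k`. -/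
def InLattice (n : ℕ) (A : AddSubgroup ℝ) (m : Mem) : Prop :=
  ∀ v : Fin n, m.reals 3 v ∈ A ∧ m.reals 4 v ∈ A

section Round

variable {m : Mem} {s : GWState n} {k : ℕ}

open scoped Classical in
-- The numerator lies in `lat k` and is bounded by the largest sum of costs and duals; the
-- denominator is 0, 1 or 2. Halving is the only source of new denominators, one factor of two per
-- round.
theorem slackAt_mem (R : Regime I ε L) (hε : 0 < ε) (hin : HoldsInput I ε m)
    (h : s.Inv I (I.scaledPenalty ε)) (hr : Represents (I.scaledPenalty ε) m s)
    (hk : k < 2 * n + 1) (hlat : InLattice n (R.lat k) m) (u v : Fin n) :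
    m.reals 1 (u * n + v) - m.reals 4 u ∈ L ∧
      m.reals 1 (u * n + v) - m.reals 4 u - m.reals 4 v ∈ L ∧
      m.reals 5 u + m.reals 5 v ∈ L ∧ slackAt n m u v ∈ L ∧ slackAt n m u v ∈ R.lat (k + 1) := by
  have hp := scaledPenalty_nonneg I hε
  set S := ∑ v, I.scaledPenalty ε v with hS
  have hS0 : 0 ≤ S := Regime.sum_scaledPenalty_nonneg I hε
  set c := m.reals 1 (u * n + v) with hc
  have hcl : c ∈ R.lat k := by
    rw [hc, hin.cost]
    split_ifs with hadj
    · exact R.lat_le (Nat.zero_le k) (R.cost_mem _ hadj)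
    · exact (R.lat k).zero_mem
  set E := ∑ e with e ∈ I.graph.edgeSet, I.cost e with hE
  have hE0 : 0 ≤ E := Regime.edge_costs_nonneg I
  have hc0 : 0 ≤ c ∧ c ≤ E := by
    rw [hc, hin.cost]
    split_ifs with hadj
    · exact ⟨I.cost_nonneg _ hadj, Regime.edge_cost_le I hadj⟩
    · exact ⟨le_rfl, hE0⟩
  have hu0 := h.dualAt_nonneg u
  have hv0 := h.dualAt_nonneg v
  have hu1 := h.dualAt_le u
  have hv1 := h.dualAt_le v
  rw [← hr.dual] at hu0 hv0 hu1 hv1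
  have hM : I.magnitude ε = E + 2 * S + 2 := rfl
  have l1 : c - m.reals 4 u ∈ R.lat k := (R.lat k).sub_mem hcl (hlat u).2
  have l2 : c - m.reals 4 u - m.reals 4 v ∈ R.lat k := (R.lat k).sub_mem l1 (hlat v).2
  have b2 : |c - m.reals 4 u - m.reals 4 v| ≤ I.magnitude ε := by
    rw [hM, abs_le]; constructor <;> linarith
  have b1 : |c - m.reals 4 u| ≤ I.magnitude ε := by
    rw [hM, abs_le]; constructor <;> linarith
  have hsum : m.reals 5 u + m.reals 5 v = 0 ∨ m.reals 5 u + m.reals 5 v = 1 ∨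
      m.reals 5 u + m.reals 5 v = 2 := by
    rw [hr.active u, hr.active v]
    split_ifs <;> norm_num
  have hslack : slackAt n m u v = (c - m.reals 4 u - m.reals 4 v) /
    (m.reals 5 u + m.reals 5 v) := rfl
  refine ⟨R.mem_of_abs_le k hk.le _ l1 b1, R.mem_of_abs_le k hk.le _ l2 b2, ?_, ?_⟩
  · rcases hsum with hs | hs | hs <;> rw [hs]
    · exact R.zero_mem hε
    · exact R.one_mem_set hε
    · exact R.two_mem hε
  · have key : slackAt n m u v ∈ R.lat (k + 1) ∧ |slackAt n m u v| ≤ I.magnitude ε := by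
      rw [hslack]
      rcases hsum with hs | hs | hs <;> rw [hs]
      -- Both ends are inactive; the quotient is 0 by convention and the program does not use it.
      · rw [div_zero, abs_zero]
        exact ⟨(R.lat _).zero_mem, by rw [hM]; linarith⟩
      · rw [div_one]
        exact ⟨R.mono _ _ l2, b2⟩
      · refine ⟨R.half _ _ l2, ?_⟩
        rw [abs_div, abs_two]
        have := abs_nonneg (c - m.reals 4 u - m.reals 4 v)
        linarith
    exact ⟨R.mem_of_abs_le (k + 1) (by omega) _ key.1 key.2, key.1⟩

theorem isCandidate_iff (hin : HoldsInput I ε m) {p : Fin n → ℝ} (hr : Represents p m s)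
    (u v : Fin n) :
    IsCandidate n m u v ↔ I.graph.Adj u v ∧ classOf (m.nats 7) u ≠ classOf (m.nats 7) v ∧
      classOf (m.nats 7) u ∈ s.active := by
  classical
  rw [IsCandidate, hin.adj, hr.mem_active, Ne, Ne, classOf_eq_iff]
  by_cases h : I.graph.Adj u v <;> simp [h]

/-- Specification of one iteration of the growth phase. -/
theorem round_spec (R : Regime I ε L) (hε : 0 < ε) (hN : 2 * n + 2 ≤ N)
    (h : s.Inv I (I.scaledPenalty ε)) (hin : HoldsInput I ε m)
    (hr : Represents (I.scaledPenalty ε) m s) (hk : k < 2 * n + 1)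
    (hlat : InLattice n (R.lat k) m) :
    GWProgram.round.wp N L (fun m' => ∃ s',
      ((s.active = ∅ ∧ s' = s) ∨ GWStep I (I.scaledPenalty ε) s s') ∧
      Represents (I.scaledPenalty ε) m' s' ∧ InLattice n (R.lat (k + 1)) m') m := by
  have hp := scaledPenalty_nonneg I hε
  have hS0 : 0 ≤ ∑ v, I.scaledPenalty ε v := Regime.sum_scaledPenalty_nonneg I hε
  have hpot0 : ∀ v : Fin n, 0 ≤ m.reals 3 v := fun v => hr.potential v ▸ h.potential_nonneg _
  have hpot1 : ∀ v : Fin n, m.reals 3 v ≤ ∑ v, I.scaledPenalty ε v :=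
    fun v => hr.potential v ▸ h.potential_le hp _
  refine Prog.wp_seq (selectVertex_spec hin.card (by omega) (R.one_mem_set hε)) ?_
  intro m₁ hf1 h1
  have n7 : m₁.nats 7 = m.nats 7 := hf1.1 7 rfl
  have n8 : m₁.nats 8 = m.nats 8 := hf1.1 8 rfl
  have n9 : m₁.nats 9 = m.nats 9 := hf1.1 9 rfl
  have n10 : m₁.nats 10 = m.nats 10 := hf1.1 10 rfl
  have n1 : m₁.nats 1 = m.nats 1 := hf1.1 1 rfl
  have r3 : m₁.reals 3 = m.reals 3 := hf1.2 3 rfl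
  have r4 : m₁.reals 4 = m.reals 4 := hf1.2 4 rfl
  have r5 : m₁.reals 5 = m.reals 5 := hf1.2 5 rfl
  have hr1 : Represents (I.scaledPenalty ε) m₁ s := by
    obtain ⟨q1, q2, q3, q4, q5, q6, q7, q8⟩ := hr
    constructor
    · rw [n7]; exact q1
    · rw [n7]; exact q2
    · rw [n7, r5]; exact q3
    · rw [n7, r3]; exact q4
    · rw [r4]; exact q5
    · rw [n9]; exact q6
    · rw [n8]; exact q7
    · rw [n10]; exact q8
  have hin1 := hin.of_frame hf1 rfl rfl rfl rfl rfl
  have hlat1 : InLattice n (R.lat k) m₁ := by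
    intro v; rw [r3, r4]; exact hlat v
  refine ⟨trivial, fun ht => ?_, fun ht => ?_⟩
  · have h13 : m₁.nats 13 0 = 0 := by simpa using ht
    rcases h1 with ⟨-, hno⟩ | ⟨h13', -⟩
    · refine ⟨s, Or.inl ⟨?_, rfl⟩, hr1, fun v => ⟨R.mono _ _ (hlat1 v).1, R.mono _ _ (hlat1 v).2⟩⟩
      refine Finset.eq_empty_of_forall_notMem fun C hC => ?_
      obtain ⟨v, rfl⟩ := (hr.comps C).1 (h.active_comps C hC)
      exact hno v v.2 ((hr.mem_active v).2 hC)
    · omega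
  · have h13 : ¬ m₁.nats 13 0 = 0 := by simpa using ht
    rcases h1 with ⟨h13', -⟩ | ⟨h13, h11, hact, hbd, hmin⟩
    · exact absurd h13' h13
    have hs := slackAt_mem R hε hin1 h hr1 hk hlat1
    refine Prog.wp_seq (selectEdge_spec hin1.card (by omega) (R.one_mem_set hε)
      (fun u hu v hv => ?_) h13 h11) ?_
    · obtain ⟨g1, g2, g3, g4, -⟩ := hs ⟨u, hu⟩ ⟨v, hv⟩
      exact ⟨g1, g2, g3, g4⟩
    rintro m₂ hf2 ⟨hsel, hle, hminE⟩
    set d := m₂.reals 6 0 with hd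
    set b : Fin n := ⟨m₁.nats 11 0, h11⟩ with hb
    have hr2 : Represents (I.scaledPenalty ε) m₂ s := by
      obtain ⟨q1, q2, q3, q4, q5, q6, q7, q8⟩ := hr1
      constructor
      · rw [hf2.1 7 rfl]; exact q1
      · rw [hf2.1 7 rfl]; exact q2
      · rw [hf2.1 7 rfl, hf2.2 5 rfl]; exact q3
      · rw [hf2.1 7 rfl, hf2.2 3 rfl]; exact q4
      · rw [hf2.2 4 rfl]; exact q5
      · rw [hf2.1 9 rfl]; exact q6
      · rw [hf2.1 8 rfl]; exact q7
      · rw [hf2.1 10 rfl]; exact q8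
    have e7 : m₂.nats 7 = m.nats 7 := by rw [hf2.1 7 rfl, n7]
    have e3 : m₂.reals 3 = m.reals 3 := by rw [hf2.2 3 rfl, r3]
    have e4 : m₂.reals 4 = m.reals 4 := by rw [hf2.2 4 rfl, r4]
    have e5 : m₂.reals 5 = m.reals 5 := by rw [hf2.2 5 rfl, r5]
    have hin2 := hin1.of_frame hf2 rfl rfl rfl rfl rfl
    have hsum_pos : ∀ u v : Fin n, IsCandidate n m₁ u v → 0 < m₁.reals 5 u + m₁.reals 5 v := by
      intro u v hc
      have h1 := hc.2.2
      have h2 : 0 ≤ m₁.reals 5 v := by rw [hr1.active v]; split_ifs <;> norm_num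
      linarith
    -- the growth is feasible
    have hd0 : 0 ≤ d := by
      rcases hsel with ⟨-, -, hd'⟩ | ⟨-, hu, hv, hc, hd'⟩
      · rw [hd', hbd]; exact hpot0 b
      · rw [hd']
        have hc' := (isCandidate_iff hin1 hr1 ⟨_, hu⟩ ⟨_, hv⟩).1 hc
        refine div_nonneg ?_ (hsum_pos ⟨_, hu⟩ ⟨_, hv⟩ hc).le
        have h3 := h.paid_le s(⟨_, hu⟩, ⟨_, hv⟩) hc'.1
        rw [GWState.paid_eq_of_supp h s (fun R hR => (h.y_supp R hR).2.2) (hr1.classOf_mem _)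
          (hr1.classOf_mem _) (by simp) (by simp) hc'.2.1, ← hr1.dual, ← hr1.dual] at h3
        have h4 := hin1.cost ⟨_, hu⟩ ⟨_, hv⟩
        rw [if_pos hc'.1] at h4
        have h5 : m₁.reals 1 (m₂.nats 11 0 * n + m₂.nats 12 0) =
          I.cost s(⟨_, hu⟩, ⟨_, hv⟩) := h4
        rw [h5]
        have h6 : m₁.reals 4 (m₂.nats 11 0) + m₁.reals 4 (m₂.nats 12 0) ≤
          I.cost s(⟨_, hu⟩, ⟨_, hv⟩) := h3
        linarith
    have hdW : ∀ v : Fin n, classOf (m.nats 7) v ∈ s.active → d ≤ m.reals 3 v := by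
      intro v hv
      exact hle.trans (hmin v v.2 ((hr.mem_active v).2 hv))
    -- A merge is chosen only if it comes before the least active potential is spent, so this holds
    -- whatever the edge costs are.
    have hdP : d ≤ ∑ v, I.scaledPenalty ε v := by
      rw [hbd] at hle
      exact hle.trans (hpot1 b)
    -- `d` is at most every active potential and every candidate slack, which is what
    -- `feasible_grow` asks for.
    have hfeas : (s.grow d).Feasible I (I.scaledPenalty ε) := by
      refine hr1.feasible_grow h (fun v hv => ?_) fun u v huv hu hne => ?_
      · rw [r3]; exact hdW v (n7 ▸ hv)
      · have hc := (isCandidate_iff hin1 hr1 u v).2 ⟨huv, hne, hu⟩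
        have h2 := hminE u u.2 v v.2 hc
        rw [slackAt, le_div_iff₀ (hsum_pos u v hc), hin1.cost u v, if_pos huv] at h2
        linarith
    have hg := h.grow hp hd0 hfeas
    have hdlat : d ∈ R.lat (k + 1) := by
      rcases hsel with ⟨-, -, hd'⟩ | ⟨-, hu, hv, hc, hd'⟩
      · rw [hd', hbd]; exact R.mono _ _ (hlat b).1
      · rw [hd']; exact (hs ⟨_, hu⟩ ⟨_, hv⟩).2.2.2.2
    have hda : ∀ v : Fin n, m₂.reals 6 0 * m₂.reals 5 v ∈ R.lat (k + 1) ∧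
        0 ≤ m₂.reals 6 0 * m₂.reals 5 v ∧
        m₂.reals 6 0 * m₂.reals 5 v ≤ ∑ v, I.scaledPenalty ε v := by
      intro v
      rw [hr2.active v, ← hd]
      split_ifs
      · rw [mul_one]; exact ⟨hdlat, hd0, hdP⟩
      · rw [mul_zero]; exact ⟨(R.lat _).zero_mem, le_rfl, hS0⟩
    have hnew : ∀ v : Fin n,
        m₂.reals 4 v + m₂.reals 6 0 * m₂.reals 5 v = (s.grow d).dualAt v ∧
        m₂.reals 3 v - m₂.reals 6 0 * m₂.reals 5 v =
          (s.grow d).potential (I.scaledPenalty ε) (classOf (m.nats 7) v) := by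
      intro v
      constructor
      · rw [h.dualAt_grow d (hr2.classOf_mem v) (by simp), hr2.dual v, hr2.active v]
      · rw [h.potential_grow d (hr.classOf_mem v), hr2.potential v, hr2.active v, e7]
    have hnewlat : ∀ v : Fin n,
        m₂.reals 4 v + m₂.reals 6 0 * m₂.reals 5 v ∈ R.lat (k + 1) ∧
        m₂.reals 3 v - m₂.reals 6 0 * m₂.reals 5 v ∈ R.lat (k + 1) := by
      intro v
      rw [e3, e4]
      exact ⟨(R.lat _).add_mem (R.mono _ _ (hlat v).2) (hda v).1,
        (R.lat _).sub_mem (R.mono _ _ (hlat v).1) (hda v).1⟩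
    refine Prog.wp_seq (growDuals_spec hin2.card (by omega) fun v hv => ?_) ?_
    · refine ⟨R.mem_of_le (by omega) (hda ⟨v, hv⟩).1 ?_,
        R.mem_of_le (by omega) (hnewlat ⟨v, hv⟩).1 ?_,
        R.mem_of_le (by omega) (hnewlat ⟨v, hv⟩).2 ?_⟩
      · rw [abs_of_nonneg (hda ⟨v, hv⟩).2.1]
        linarith [(hda ⟨v, hv⟩).2.2]
      · rw [(hnew ⟨v, hv⟩).1, abs_of_nonneg (hg.dualAt_nonneg _)]
        linarith [hg.dualAt_le ⟨v, hv⟩]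
      · rw [(hnew ⟨v, hv⟩).2, abs_of_nonneg (hg.potential_nonneg _)]
        linarith [hg.potential_le hp (classOf (m.nats 7) (⟨v, hv⟩ : Fin n))]
    · intro m₃ hf3 h3
      have hr3 : Represents (I.scaledPenalty ε) m₃ (s.grow d) := by
        refine hr2.grow h d (fun a ha => ?_) (hf3.2 5 rfl) fun v => h3 v v.2
        simp only [List.mem_cons, List.not_mem_nil, or_false] at ha
        rcases ha with rfl | rfl | rfl | rfl <;> exact hf3.1 _ rfl
      have hlat3 : InLattice n (R.lat (k + 1)) m₃ := by
        intro v
        obtain ⟨g1, g2⟩ := h3 v v.2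
        rw [g1, g2]
        exact ⟨(hnewlat v).2, (hnewlat v).1⟩
      have hin3 := hin2.of_frame hf3 rfl rfl rfl rfl rfl
      have f7 : m₃.nats 7 = m.nats 7 := by rw [hf3.1 7 rfl, e7]
      have f11 : m₃.nats 11 = m₂.nats 11 := hf3.1 11 rfl
      have f12 : m₃.nats 12 = m₂.nats 12 := hf3.1 12 rfl
      have f13 : m₃.nats 13 = m₂.nats 13 := hf3.1 13 rfl
      refine ⟨trivial, fun ht => ?_, fun ht => ?_⟩
      · have h13 : m₂.nats 13 0 ≤ 1 := by simpa [f13] using ht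
        rcases hsel with ⟨-, h11', hd'⟩ | ⟨h13', -⟩
        · have hb3 : m₃.nats 11 0 = b := by rw [f11, h11']
          refine Prog.wp_frame (deactivateComp_spec hin3.card (by omega) (R.zero_mem hε) ?_) ?_
          · rw [hb3]; exact hr3.name_lt b
          · rintro m₄ hf4 ⟨h8, h95⟩
            rw [hb3] at h8 h95
            refine ⟨_, Or.inr (GWStep.deactivate s d (classOf (m₃.nats 7) b) hd0 hfeas ?_ ?_),
              hr3.deactivate b (fun a ha => ?_) (hf4.2 3 rfl) (hf4.2 4 rfl) h8 h95, ?_⟩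
            · rw [f7]
              exact (hr.mem_active b).1 hact
            · have hca : classOf (m.nats 7) b ∈ s.active := (hr.mem_active b).1 hact
              rw [f7, h.potential_grow d (hr.classOf_mem b), if_pos hca, ← hr.potential b, hd',
                hbd]
              ring
            · simp only [List.mem_cons, List.not_mem_nil, or_false] at ha
              rcases ha with rfl | rfl <;> exact hf4.1 _ rfl
            · intro v
              rw [hf4.2 3 rfl, hf4.2 4 rfl]
              exact hlat3 v
        · omega
      · have h13 : ¬ m₂.nats 13 0 ≤ 1 := by simpa [f13] using ht
        rcases hsel with ⟨h13', -⟩ | ⟨-, hu, hv, hc, hd'⟩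
        · omega
        set u : Fin n := ⟨m₂.nats 11 0, hu⟩ with hu'
        set v : Fin n := ⟨m₂.nats 12 0, hv⟩ with hv'
        have hbu : m₃.nats 11 0 = u := by rw [f11]
        have hbv : m₃.nats 12 0 = v := by rw [f12]
        have hc' := (isCandidate_iff hin1 hr1 u v).1 hc
        rw [n7] at hc'
        refine Prog.wp_frame (mergeComps_spec hin3.card (by omega) (R.zero_mem hε)
          (R.one_mem_set hε) ?_ (fun v hv => hr3.name_lt ⟨v, hv⟩) ?_ ?_ hin3.root) ?_
        · rw [hbu, hbv]
          refine R.mem_of_le (k := k + 1) (by omega)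
            ((R.lat _).add_mem (hlat3 u).1 (hlat3 v).1) ?_
          rw [hr3.potential u, hr3.potential v,
            abs_of_nonneg (add_nonneg (hg.potential_nonneg _) (hg.potential_nonneg _))]
          linarith [hg.potential_le hp (classOf (m₃.nats 7) u),
            hg.potential_le hp (classOf (m₃.nats 7) v)]
        · rw [hbu]; exact u.2
        · rw [hbv]; exact v.2
        · rintro m₄ hf4 ⟨h735, h10⟩
          rw [hbu, hbv] at h735 h10
          refine ⟨_, Or.inr (GWStep.merge s d (classOf (m₃.nats 7) u) (classOf (m₃.nats 7) v) u v
            hd0 hfeas ?_ ?_ ?_ ?_ ?_ ?_ hc'.1 ?_),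
            hr3.merge hg ?_ (fun a ha => ?_) (hf4.2 4 rfl) h735 h10, ?_⟩
          · rw [f7]; exact hr.classOf_mem u
          · rw [f7]; exact hr.classOf_mem v
          · rw [f7]; exact hc'.2.1
          · rw [f7]; exact Or.inl hc'.2.2
          · simp
          · simp
          · rw [GWState.paid_eq_of_supp hg _ (fun R hR => (hg.y_supp R hR).2.2)
              (hr.classOf_mem u) (hr.classOf_mem v) (by simp) (by simp) hc'.2.1,
              h.dualAt_grow d (hr.classOf_mem u) (by simp),
              h.dualAt_grow d (hr.classOf_mem v) (by simp), ← hr.active u, ← hr.active v,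
              ← hr.dual u, ← hr.dual v]
            have h4 := hin1.cost u v
            rw [if_pos hc'.1] at h4
            have h5 : d * (m₁.reals 5 u + m₁.reals 5 v) =
                m₁.reals 1 (u * n + v) - m₁.reals 4 u - m₁.reals 4 v := by
              rw [hd']
              exact div_mul_cancel₀ _ (hsum_pos u v hc).ne'
            rw [h4, r4, r5] at h5
            linarith
          · rw [f7]; exact hc'.2.1
          · simp only [List.mem_cons, List.not_mem_nil, or_false] at ha
            rcases ha with rfl | rfl <;> exact hf4.1 _ rfl
          · intro w
            rw [hf4.2 4 rfl, (h735 w w.2).2.1]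
            refine ⟨?_, (hlat3 w).2⟩
            split_ifs
            · exact (R.lat _).add_mem (hlat3 u).1 (hlat3 v).1
            · exact (hlat3 w).1

/-- The number of iterations that may still follow. -/
def GWState.measure (s : GWState n) : ℕ := s.comps.card + s.active.card

open scoped Classical in
-- A merge lowers the number of components and does not raise the number of active ones, since at
-- least one of the two merged was active. A deactivation lowers only the latter number.
theorem GWStep.measure_lt {p : Fin n → ℝ} {s s' : GWState n}
    (hs : GWStep I p s s') : s'.measure < s.measure := by
  cases hs with
  | merge d A B u v hd hf hA hB hAB hact hu hv huv ht =>
    have hA : A ∈ s.comps := hA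
    have hB : B ∈ s.comps := hB
    have e1 : ((s.comps.erase A).erase B).card + 2 = s.comps.card := by
      have h1 := Finset.card_erase_add_one (Finset.mem_erase.2 ⟨hAB.symm, hB⟩)
      have h2 := Finset.card_erase_add_one hA
      omega
    have e2 : ((s.active.erase A).erase B).card + 1 ≤ s.active.card := by
      rcases hact with ha | hb
      · have h1 := Finset.card_erase_add_one ha
        have h2 := Finset.card_erase_le (s := s.active.erase A) (a := B)
        omega
      · rw [Finset.erase_right_comm]
        have h1 := Finset.card_erase_add_one hb
        have h2 := Finset.card_erase_le (s := s.active.erase B) (a := A)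
        omega
    have e3 := Finset.card_insert_le (A ∪ B) ((s.comps.erase A).erase B)
    have e4 := Finset.card_insert_le (A ∪ B) ((s.active.erase A).erase B)
    have e5 : (if I.root ∈ A ∪ B then (s.active.erase A).erase B
      else insert (A ∪ B) ((s.active.erase A).erase B)).card ≤ s.active.card := by
      split_ifs <;> omega
    change (insert (A ∪ B) ((s.comps.erase A).erase B)).card + (if I.root ∈ A ∪ B then
      (s.active.erase A).erase B else insert (A ∪ B) ((s.active.erase A).erase B)).card <
      s.comps.card + s.active.card
    omega
  | deactivate d S hd hf hS he =>
    have := Finset.card_erase_add_one (s := s.active) hS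
    change s.comps.card + (s.active.erase S).card < s.comps.card + s.active.card
    omega

/-- Specification of the growth phase. -/
theorem growth_spec (R : Regime I ε L) (hε : 0 < ε) (hN : 2 * n + 2 ≤ N) (hin : HoldsInput I ε m)
    (hr : Represents (I.scaledPenalty ε) m I.gwStart) (hlat : InLattice n (R.lat 0) m) :
    growth.wp N L (fun m' => ∃ s,
      Relation.ReflTransGen (GWStep I (I.scaledPenalty ε)) I.gwStart s ∧ s.active = ∅ ∧
      Represents (I.scaledPenalty ε) m' s) m := by
  have hp := scaledPenalty_nonneg I hε
  -- Either the growth has stopped or `k` steps have been made, each lowering a measure that starts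
  -- at no more than `n + n`.
  refine Prog.wp_forLoop (n + n) (fun k m' => ∃ s,
      Relation.ReflTransGen (GWStep I (I.scaledPenalty ε)) I.gwStart s ∧
      (s.active = ∅ ∨ s.measure + k ≤ n + n) ∧
      Represents (I.scaledPenalty ε) m' s ∧ InLattice n (R.lat k) m') (by omega) rfl ?_ ?_ ?_ ?_ ?_
  · intro m' hf
    simp [hf.1 0 rfl, hin.card]
  · rintro k m' x ⟨s, h1, h2, h3, h4⟩
    refine ⟨s, h1, h2, ?_, h4⟩
    obtain ⟨q1, q2, q3, q4, q5, q6, q7, q8⟩ := h3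
    constructor <;> simpa
  · refine ⟨_, Relation.ReflTransGen.refl, Or.inr ?_, hr, hlat⟩
    have h1 : (I.gwStart).comps.card ≤ n := by
      refine Finset.card_image_le.trans ?_
      simp
    have h2 : (I.gwStart).active.card ≤ n := by
      refine Finset.card_image_le.trans (Finset.card_erase_le.trans ?_)
      simp
    rw [GWState.measure]
    omega
  · rintro k hk m' hf - ⟨s, h1, h2, h3, h4⟩
    have hs := GWState.Inv.of_run hp h1
    refine Prog.wp_mono (round_spec R hε hN hs (hin.of_frame hf rfl rfl rfl rfl rfl) h3 (by omega)
      h4) ?_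
    rintro m'' ⟨s', h5, h6, h7⟩
    rcases h5 with ⟨h5, rfl⟩ | h5
    · exact ⟨_, h1, Or.inl h5, h6, h7⟩
    · refine ⟨s', h1.tail h5, ?_, h6, h7⟩
      have := h5.measure_lt
      rcases h2 with h2 | h2
      · exfalso
        cases h5 with
        | merge d A B u v hd hf hA hB hAB hact hu hv huv ht => simp [h2] at hact
        | deactivate d S hd hf hS he => simp [h2] at hS
      · exact Or.inr (by omega)
  · rintro m' hf ⟨s, h1, h2, h3, -⟩
    refine ⟨s, h1, ?_, h3⟩
    rcases h2 with h2 | h2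
    · exact h2
    · rw [GWState.measure] at h2
      exact Finset.card_eq_zero.1 (by omega)

end Round

end PCST

theorem Prog.Frame.forLoop {i : ℕ} {e : NatExpr} {P : Prog} {m m' : Mem} (h : P.Frame m m') :
    (Prog.forLoop i e P).Frame m m' := by
  refine ⟨fun a ha => h.1 a ?_, fun a ha => h.2 a ?_⟩
  · rw [Prog.forLoop] at ha
    simp only [Prog.writesNat, Bool.or_eq_false_iff] at ha
    exact ha.2.1
  · rw [Prog.forLoop] at ha
    simp only [Prog.writesReal, Bool.or_eq_false_iff] at ha
    exact ha.2.1

/-! ### Closing a set under a relation -/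

namespace GWProgram

variable {N n : ℕ} {L : Set ℝ} {m : Mem}

/-- `n` rounds of propagation along a relation `r` close the set `S` under `r`. -/
theorem saturate {B : Prog} (hn : n ≤ N) (r : Fin n → Fin n → Prop) [DecidableRel r]
    (S : Mem → Finset (Fin n)) (G : Mem → Prop)
    (h4 : B.writesNat 4 = false) (h5 : B.writesNat 5 = false) (h6 : B.writesNat 6 = false)
    (he : ∀ m', (Prog.forLoop 6 (.var 0) (.forLoop 4 (.var 0) (.forLoop 5 (.var 0) B))).Frame m m' →
      m'.nats 0 0 = n)
    (hst : ∀ m' a x, a ∈ [4, 5, 6] → G m' → G (m'.setNat a 0 x) ∧ S (m'.setNat a 0 x) = S m')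
    (h0 : G m)
    (hstep : ∀ (i j : Fin n) (m' : Mem),
      (Prog.forLoop 6 (.var 0) (.forLoop 4 (.var 0) (.forLoop 5 (.var 0) B))).Frame m m' →
      m'.nats 4 0 = i → m'.nats 5 0 = j → G m' → B.wp N L (fun m'' => G m'' ∧
        S m'' = if i ∈ S m' ∧ r i j then insert j (S m') else S m') m') :
    (Prog.forLoop 6 (.var 0) (.forLoop 4 (.var 0) (.forLoop 5 (.var 0) B))).wp N L (fun m' =>
      G m' ∧ S m ⊆ S m' ∧ ∀ i j, i ∈ S m' → r i j → j ∈ S m') m := by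
  have h6' : (Prog.forLoop 4 (.var 0) (.forLoop 5 (.var 0) B)).writesNat 6 = false := by
    simp [Prog.forLoop, Prog.writesNat, h6]
  -- A round that starts from a set not yet closed adds an element. So after `k` rounds the set is
  -- closed or has at least `k` elements, and with `n` elements it is everything.
  refine Prog.wp_forLoop n (fun k m' => G m' ∧ S m ⊆ S m' ∧
    ((∀ i j, i ∈ S m' → r i j → j ∈ S m') ∨ k ≤ (S m').card)) hn h6' (fun m' hf => by simp [he m' hf])
    ?_ ⟨h0, subset_rfl, Or.inr (Nat.zero_le _)⟩ ?_ ?_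
  · rintro k m' x ⟨g1, g2, g3⟩
    obtain ⟨q1, q2⟩ := hst m' 6 x (by simp) g1
    rw [q2]
    exact ⟨q1, g2, g3⟩
  · rintro k hk m₁ hf1 - ⟨g1, g2, g3⟩
    -- Progress is measured against the set at the start of the round, which only grows; the last
    -- clause says that a closed set is left unchanged.
    refine Prog.wp_forLoop_forLoop n (fun a b m' => G m' ∧ S m₁ ⊆ S m' ∧
      (∀ i j : Fin n, ((i : ℕ) < a ∨ (i : ℕ) = a ∧ (j : ℕ) < b) → i ∈ S m₁ → r i j → j ∈ S m') ∧
      ((∀ i j, i ∈ S m₁ → r i j → j ∈ S m₁) → S m' = S m₁)) hn (by decide) h4 h5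
      (fun m' hf => by simp [he m' (hf1.trans hf.forLoop)]) ?_ ?_ ?_ ?_ ?_ ?_
    · rintro a b m' x ⟨q1, q2, q3, q4⟩
      obtain ⟨q5, q6⟩ := hst m' 4 x (by simp) q1
      rw [q6]
      exact ⟨q5, q2, q3, q4⟩
    · rintro a b m' x ⟨q1, q2, q3, q4⟩
      obtain ⟨q5, q6⟩ := hst m' 5 x (by simp) q1
      rw [q6]
      exact ⟨q5, q2, q3, q4⟩
    · exact ⟨g1, subset_rfl, fun i j hij => by omega, fun _ => rfl⟩
    · rintro a ha b hb m' hf hi hj ⟨q1, q2, q3, q4⟩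
      refine Prog.wp_mono (hstep ⟨a, ha⟩ ⟨b, hb⟩ m' (hf1.trans hf.forLoop) hi hj q1) ?_
      rintro m'' ⟨q5, q6⟩
      have hsub : S m' ⊆ S m'' := by
        rw [q6]
        split_ifs
        · exact Finset.subset_insert _ _
        · exact subset_rfl
      refine ⟨q5, q2.trans hsub, fun i j hij his hrij => ?_, fun hc => ?_⟩
      · by_cases hold : (i : ℕ) < a ∨ (i : ℕ) = a ∧ (j : ℕ) < b
        · exact hsub (q3 i j hold his hrij)
        · obtain rfl : i = ⟨a, ha⟩ := Fin.ext (by simp; omega)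
          obtain rfl : j = ⟨b, hb⟩ := Fin.ext (by simp; omega)
          rw [q6, if_pos ⟨q2 his, hrij⟩]
          exact Finset.mem_insert_self _ _
      · have hS := q4 hc
        rw [q6]
        split_ifs with hcond
        · rw [hS] at hcond ⊢
          exact Finset.insert_eq_of_mem (hc _ _ hcond.1 hcond.2)
        · exact hS
    · rintro a ha m' ⟨q1, q2, q3, q4⟩
      exact ⟨q1, q2, fun i j hij => q3 i j (by omega), q4⟩
    · rintro m' hf ⟨q1, q2, q3, q4⟩
      refine ⟨q1, g2.trans q2, ?_⟩
      by_cases hc : ∀ i j, i ∈ S m₁ → r i j → j ∈ S m₁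
      · left
        rw [q4 hc]
        exact hc
      · right
        have g3 := g3.resolve_left hc
        push Not at hc
        obtain ⟨i, j, hi, hij, hj⟩ := hc
        have hj' := q3 i j (Or.inl i.2) hi hij
        have : (S m₁).card < (S m').card :=
          Finset.card_lt_card ⟨q2, fun h => hj (h hj')⟩
        omega
  · rintro m' hf ⟨g1, g2, g3⟩
    refine ⟨g1, g2, ?_⟩
    rcases g3 with g3 | g3
    · exact g3
    · have : S m' = Finset.univ := by
        rw [← Finset.card_eq_iff_eq_univ]
        exact le_antisymm (by simpa using Finset.card_le_univ (S m')) (by simpa using g3)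
      intro i j _ _
      simp [this]

end GWProgram

/-! ### The deletion phase: parents, closure, minimality -/

namespace PCST

open GWProgram

variable {n : ℕ} {I : PCST n} {ε : ℝ} {L : Set ℝ} {N : ℕ} {m : Mem} {p : Fin n → ℝ}
  {s : GWState n}

theorem GWState.Inv.not_reachable_erase (h : s.Inv I p) {a b : Fin n} (hab : s(a, b) ∈ s.forest) :
    ¬ (SimpleGraph.fromEdgeSet ((s.forest.erase s(a, b) : Finset (Sym2 (Fin n))) :
      Set (Sym2 (Fin n)))).Reachable a b := by
  have hne : a ≠ b := (show I.graph.Adj a b from h.forest_edge _ hab).ne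
  have hb := SimpleGraph.isAcyclic_iff_forall_adj_isBridge.1 h.forest_acyclic
    (v := a) (w := b) (by simp [hne, hab])
  rw [SimpleGraph.isBridge_iff] at hb
  intro hr
  refine hb (hr.mono ?_)
  intro x y hxy
  simp only [SimpleGraph.fromEdgeSet_adj, Finset.coe_erase, Set.mem_sdiff, Finset.mem_coe,
    Set.mem_singleton_iff, SimpleGraph.deleteEdges_adj] at hxy ⊢
  tauto

/-- The parent pointers in array 14 lead to the root. -/
def HoldsParents (I : PCST n) (F : Finset (Sym2 (Fin n))) (m : Mem) : Prop :=
  m.nats 14 I.root = I.root ∧ ∀ v, I.RootConnected F v → v ≠ I.root →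
    ∃ u : Fin n, m.nats 14 v = u ∧ s(u, v) ∈ F ∧ ¬ I.RootConnected (F.erase s(u, v)) v

open scoped Classical in
theorem findParents_spec (hN : n + 2 ≤ N) (h : s.Inv I p) (hin : HoldsInput I ε m)
    (hfor : ∀ v w : Fin n, m.nats 10 (v * n + w) = if s(v, w) ∈ s.forest then 1 else 0)
    (h15 : m.nats 15 = fun _ => 0) :
    findParents.wp N L (HoldsParents I s.forest) m := by
  have hr := I.root.2
  refine ⟨by simp; omega, by simp [hin.root]; omega, ?_⟩
  simp only [NatExpr.eval, Mem.setNat_nats_of_ne, ne_eq, OfNat.zero_ne_ofNat, not_false_eq_true,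
    hin.root]
  set m₀ := (m.setNat 15 I.root 1).setNat 14 I.root I.root with hm₀
  have e0 : m₀.nats 0 = m.nats 0 := by simp [hm₀]
  have e10 : m₀.nats 10 = m.nats 10 := by simp [hm₀]
  have e15 : ∀ v : Fin n, 1 ≤ m₀.nats 15 v ↔ v = I.root := by
    intro v
    simp only [hm₀, Mem.setNat_nats_of_ne, ne_eq, Nat.reduceEqDiff,
      not_false_eq_true, Mem.setNat_nats_self, h15, Function.update_apply, Fin.val_inj]
    split_ifs with hv <;> simp [hv]
  set S : Mem → Finset (Fin n) := fun m' => Finset.univ.filter fun v => 1 ≤ m'.nats 15 v with hS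
  have hmem : ∀ m' v, v ∈ S m' ↔ 1 ≤ m'.nats 15 v := by simp [hS]
  -- By the last clause, a reached vertex stays connected to the root when an edge with an unreached
  -- end is erased.
  set G : Mem → Prop := fun m' => 1 ≤ m'.nats 15 I.root ∧ m'.nats 14 I.root = I.root ∧
    (∀ v : Fin n, 1 ≤ m'.nats 15 v → v ≠ I.root → ∃ u : Fin n, m'.nats 14 v = u ∧
      s(u, v) ∈ s.forest ∧ ¬ I.RootConnected (s.forest.erase s(u, v)) v) ∧
    ∀ v : Fin n, 1 ≤ m'.nats 15 v → ∀ a b : Fin n, ¬ 1 ≤ m'.nats 15 b →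
      I.RootConnected (s.forest.erase s(a, b)) v with hG
  refine Prog.wp_mono (saturate (m := m₀) (by omega) (fun i j => s(i, j) ∈ s.forest) S G rfl rfl rfl
    ?_ ?_ ?_ ?_) ?_
  · intro m' hf
    rw [hf.1 0 rfl, e0, hin.card]
  · intro m' a x ha hg
    simp only [List.mem_cons, List.not_mem_nil, or_false] at ha
    rcases ha with rfl | rfl | rfl
    all_goals
      refine ⟨?_, ?_⟩
      · simpa [hG] using hg
      · simp [hS]
  · refine ⟨(e15 _).2 rfl, by simp [hm₀], fun v hv hne => absurd ((e15 v).1 hv) hne, ?_⟩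
    intro v hv a b _
    rw [(e15 v).1 hv]
    exact rootConnected_root _
  · rintro i j m' hf hi hj ⟨g1, g2, g3, g4⟩
    have q0 : m'.nats 0 0 = n := by rw [hf.1 0 rfl, e0, hin.card]
    have q10 : m'.nats 10 (i * n + j) = if s(i, j) ∈ s.forest then 1 else 0 := by
      rw [hf.1 10 rfl, e10, hfor]
    have hi' := i.2
    refine ⟨by simp, fun ht => ?_, fun ht => ?_⟩
    · have ht' : 1 ≤ m'.nats 15 i ∧ m'.nats 15 j = 0 ∧ s(i, j) ∈ s.forest := by
        have : 1 ≤ m'.nats 15 i ∧ m'.nats 15 j = 0 ∧ 1 ≤ m'.nats 10 (i * n + j) := by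
          simpa [hi, hj, q0] using ht
        rw [q10] at this
        refine ⟨this.1, this.2.1, ?_⟩
        by_contra hno
        simp [hno] at this
      obtain ⟨t1, t2, t3⟩ := ht'
      refine ⟨by simp; omega, by simp [hi]; omega, ?_⟩
      simp only [NatExpr.eval, NatExpr.var, Mem.setNat_nats_of_ne, ne_eq, Nat.reduceEqDiff,
        not_false_eq_true, hi, hj]
      set m₁ := (m'.setNat 15 j 1).setNat 14 j i with hm₁
      have r15 : ∀ v : Fin n, 1 ≤ m₁.nats 15 v ↔ v = j ∨ 1 ≤ m'.nats 15 v := by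
        intro v
        simp only [hm₁, Mem.setNat_nats_of_ne, ne_eq, Nat.reduceEqDiff, not_false_eq_true,
          Mem.setNat_nats_self, Function.update_apply, Fin.val_inj]
        split_ifs with hv <;> simp [hv]
      have r14 : ∀ v : Fin n, m₁.nats 14 v = if v = j then (i : ℕ) else m'.nats 14 v := by
        intro v
        simp only [hm₁, Mem.setNat_nats_of_ne, ne_eq, Nat.reduceEqDiff, not_false_eq_true,
          Mem.setNat_nats_self, Function.update_apply, Fin.val_inj]
      have hjroot : I.root ≠ j := by
        rintro hh
        rw [hh] at g1
        omega
      have hmid : ∀ a b : Fin n, ¬ 1 ≤ m'.nats 15 b → s(a, b) ≠ s(i, j) →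
          I.RootConnected (s.forest.erase s(a, b)) j := by
        intro a b hb hne
        exact (g4 i t1 a b hb).of_mem (Finset.mem_erase.2 ⟨hne.symm, t3⟩)
      refine ⟨⟨(r15 _).2 (Or.inr g1), ?_, fun v hv hne => ?_, fun v hv a b hb => ?_⟩, ?_⟩
      · rw [r14, if_neg hjroot, g2]
      · rw [r14]
        by_cases hvj : v = j
        · subst hvj
          -- The end `i` survives erasure of the new edge because the other end was unreached. If
          -- that end survived too, the edge would close a cycle in the forest.
          refine ⟨i, by simp, t3, fun hrc => ?_⟩
          exact h.not_reachable_erase t3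
            ((SimpleGraph.Reachable.symm (g4 i t1 i v (by omega))).trans hrc)
        · rw [if_neg hvj]
          exact g3 v (((r15 v).1 hv).resolve_left hvj) hne
      · have hb' := (r15 b).not.1 hb
        push Not at hb'
        rcases (r15 v).1 hv with rfl | hv
        · refine hmid a b (by omega) fun heq => ?_
          rcases Sym2.eq_iff.1 heq with ⟨-, hbj⟩ | ⟨-, hbi⟩
          · exact hb'.1 hbj
          · rw [hbi] at hb'
            omega
        · exact g4 v hv a b (by omega)
      · rw [if_pos ⟨(hmem _ _).2 t1, t3⟩]
        ext v
        rw [Finset.mem_insert, hmem, hmem, r15]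
    · have ht' : ¬ (1 ≤ m'.nats 15 i ∧ m'.nats 15 j = 0 ∧ s(i, j) ∈ s.forest) := by
        rintro ⟨t1, t2, t3⟩
        refine ht ?_
        rw [if_pos t3] at q10
        simp [hi, hj, q0, t1, t2, q10]
      refine ⟨⟨g1, g2, g3, g4⟩, ?_⟩
      split_ifs with hc
      · rw [Finset.insert_eq_of_mem]
        rw [hmem]
        by_contra hj0
        exact ht' ⟨(hmem _ _).1 hc.1, by omega, hc.2⟩
      · rfl
  · rintro m' ⟨⟨g1, g2, g3, -⟩, -, hclosed⟩
    refine ⟨g2, fun v hv hne => g3 v ?_ hne⟩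
    have := hv.mem_of_closed (Z := {v | v ∈ S m'}) ((hmem _ _).2 g1)
      fun x hx y hxy => hclosed x y hx hxy
    exact (hmem _ _).1 this

/-- The vertex `v` belongs to every feasible outcome of the deletion phase. -/
def IsRequired (I : PCST n) (s : GWState n) (v : Fin n) : Prop :=
  ∀ F, F ⊆ s.forest → I.KeepsRequired s F → I.RootConnected F v

/-- The condition of the deletion phase compares labels, the program tests membership. A vertex of
`A` has a label inside `A`, so membership suffices. -/
theorem IsRequired.of_label (h : s.Inv I p) {v w : Fin n} {A : Finset (Fin n)}
    (hv : I.IsRequired s v) (hA : s.label w = some A) (hvA : v ∈ A) : I.IsRequired s w := by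
  intro F hF hk
  obtain ⟨B, hBA, hB⟩ := h.label_sub w A hA v hvA
  exact hk.2 v w B A hB hA hBA (hv F hF hk)

/-- Every feasible edge set must contain the edge to the parent, as the rest of the forest does not
connect `v`. -/
theorem IsRequired.of_parent {v u : Fin n} (hv : I.IsRequired s v)
    (hnr : ¬ I.RootConnected (s.forest.erase s(u, v)) v) : I.IsRequired s u := by
  intro F hF hk
  have h1 := hv F hF hk
  have h2 : s(u, v) ∈ F := by
    by_contra h3
    exact hnr (h1.mono fun e he => Finset.mem_erase.2 ⟨fun h4 => h3 (by rw [← h4]; exact he), hF he⟩)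
  exact h1.of_mem (by rwa [Sym2.eq_swap])

theorem GWState.Inv.label_root_eq_none (h : s.Inv I p) : s.label I.root = none := by
  rcases hl : s.label I.root with _ | A
  · rfl
  · exact absurd (h.label_mem _ _ hl) (h.label_root _ _ hl)

/-- The complete forest is a feasible outcome of the deletion phase. -/
theorem GWState.Inv.keepsRequired_forest (h : s.Inv I p) (ha : s.active = ∅) :
    I.KeepsRequired s s.forest := by
  -- At the end, the vertices connected to the root are those of its component, all other components
  -- are inactive and fully labelled, and a label never crosses components.
  obtain ⟨C, hC, hrC⟩ := h.comps_cover I.root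
  have hconn : ∀ v ∈ C, I.RootConnected s.forest v := fun v hv => h.forest_conn C hC _ hrC v hv
  have hmem : ∀ v, I.RootConnected s.forest v → v ∈ C := by
    intro v hv
    refine hv.mem_of_closed (Z := (C : Set (Fin n))) hrC fun x hx y hxy => ?_
    obtain ⟨D, hD, hDe⟩ := h.forest_comp _ hxy
    have := h.comps_eq C hC D hD x hx (hDe x (by simp))
    exact this ▸ hDe y (by simp)
  refine ⟨fun v hv => ?_, fun v w A B hA hB hAB hv => ?_⟩
  · obtain ⟨D, hD, hvD⟩ := h.comps_cover v
    by_cases hrD : I.root ∈ D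
    · exact hconn v (h.comps_eq C hC D hD _ hrC hrD ▸ hvD)
    · obtain ⟨B, -, hB⟩ := h.inactive D hD (by simp [ha]) hrD v hvD
      rw [hv] at hB
      cases hB
  · have hvC := hmem v hv
    have hvB : v ∈ B := hAB (h.label_mem v A hA)
    obtain ⟨D, hD, hBD, -⟩ := h.label_comp w B hB
    have := h.comps_eq C hC D hD v hvC (hBD hvB)
    exact hconn w (this ▸ hBD (h.label_mem w B hB))

open scoped Classical in
/-- Specification of the computation of the output vertices. -/
theorem closeVertices_spec (hN : n + 2 ≤ N) (h : s.Inv I p) (hact : s.active = ∅)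
    (hin : HoldsInput I ε m) (hpar : HoldsParents I s.forest m)
    (hlabelled : ∀ v : Fin n, m.nats 9 v = if s.label v = none then 0 else 1)
    (hlabel : ∀ v w : Fin n, m.nats 8 (v * n + w) =
      if ∃ A, s.label v = some A ∧ w ∈ A then 1 else 0)
    (h2 : m.nats 2 = fun _ => 0) :
    closeVertices.wp N L (fun m' => ∃ X : Finset (Fin n),
      (∀ v : Fin n, m'.nats 2 v = if v ∈ X then 1 else 0) ∧ (∀ v ∈ X, I.IsRequired s v) ∧
      (∀ v, s.label v = none → v ∈ X) ∧
      (∀ v w A, v ∈ X → s.label w = some A → v ∈ A → w ∈ X) ∧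
      ∀ v ∈ X, ∀ u : Fin n, m.nats 14 v = u → u ∈ X) m := by
  have hparReq : ∀ v u : Fin n, I.IsRequired s v → m.nats 14 v = u → I.IsRequired s u := by
    intro v u hv hu
    by_cases hvr : v = I.root
    · rw [hvr, hpar.1, Fin.val_inj] at hu
      rw [← hu]
      exact fun F _ _ => rootConnected_root F
    · obtain ⟨u', hu', -, hnr⟩ := hpar.2 v (hv _ subset_rfl (h.keepsRequired_forest hact)) hvr
      rw [hu', Fin.val_inj] at hu
      exact hu ▸ hv.of_parent hnr
  refine Prog.wp_seq (Q := fun m' => ∀ v : Fin n, m'.nats 2 v = if s.label v = none then 1 else 0)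
    ?_ ?_
  · refine Prog.wp_forLoop n (fun k m' => ∀ v : Fin n, m'.nats 2 v =
      if (v : ℕ) < k ∧ s.label v = none then 1 else 0) (by omega) rfl ?_ ?_ ?_ ?_ ?_
    · intro m' hf
      simp [hf.1 0 rfl, hin.card]
    · intro k m' x hx
      simpa using hx
    · simp [h2]
    · intro k hk m' hf hi hinv
      have q9 : m'.nats 9 k = if s.label (⟨k, hk⟩ : Fin n) = none then 0 else 1 := by
        rw [hf.1 9 rfl]; exact hlabelled ⟨k, hk⟩
      have hk' : ∀ v : Fin n, (v : ℕ) = k ↔ v = ⟨k, hk⟩ := fun v => by simp [Fin.ext_iff]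
      refine ⟨by simp, fun ht => ?_, fun ht => ?_⟩
      · have hl : s.label (⟨k, hk⟩ : Fin n) ≠ none := by
          intro hl
          simp [hi, q9, hl] at ht
        intro v
        rw [hinv v]
        congr 1
        rw [eq_iff_iff]
        by_cases hv : v = ⟨k, hk⟩
        · simp [hv, hl]
        · have := (hk' v).not.2 hv
          have : (v : ℕ) < k ↔ (v : ℕ) < k + 1 := by omega
          rw [this]
      · have hl : s.label (⟨k, hk⟩ : Fin n) = none := by
          by_contra hl
          simp [hi, q9, hl] at ht
        refine ⟨by simp; omega, fun v => ?_⟩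
        simp only [NatExpr.eval, NatExpr.var, hi, Mem.setNat_nats_self, Function.update_apply, hk']
        by_cases hv : v = ⟨k, hk⟩
        · simp [hv, hl]
        · have := (hk' v).not.2 hv
          have : (v : ℕ) < k ↔ (v : ℕ) < k + 1 := by omega
          rw [if_neg hv, hinv v]; simp only [this]
    · intro m' hf hinv v
      simpa using hinv v
  · intro m₁ hf1 hm1
    set S : Mem → Finset (Fin n) := fun m' => Finset.univ.filter fun v => 1 ≤ m'.nats 2 v with hS
    have hmem : ∀ m' v, v ∈ S m' ↔ 1 ≤ m'.nats 2 v := by simp [hS]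
    refine Prog.wp_mono (saturate (m := m₁) (by omega)
      -- Both ways of propagating preserve being required, so the closure never exceeds what every
      -- feasible edge set must connect.
      (fun i j => (∃ A, s.label j = some A ∧ i ∈ A) ∨ m.nats 14 i = j) S
      (fun m' => (∀ v : Fin n, m'.nats 2 v ≤ 1) ∧ ∀ v : Fin n, 1 ≤ m'.nats 2 v → I.IsRequired s v)
      rfl rfl rfl ?_ ?_ ?_ ?_) ?_
    · intro m' hf
      rw [hf.1 0 rfl, hf1.1 0 rfl, hin.card]
    · intro m' a x ha hg
      simp only [List.mem_cons, List.not_mem_nil, or_false] at ha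
      rcases ha with rfl | rfl | rfl
      all_goals
        refine ⟨?_, ?_⟩
        · simpa using hg
        · simp [hS]
    · refine ⟨fun v => ?_, fun v hv F hF hk => hk.1 v ?_⟩
      · rw [hm1 v]; split_ifs <;> simp
      · rw [hm1 v] at hv
        by_contra hl
        simp [hl] at hv
    · rintro i j m' hf hi hj ⟨g1, g2⟩
      have q0 : m'.nats 0 0 = n := by rw [hf.1 0 rfl, hf1.1 0 rfl, hin.card]
      have q8 : m'.nats 8 (j * n + i) = if ∃ A, s.label j = some A ∧ i ∈ A then 1 else 0 := by
        rw [hf.1 8 rfl, hf1.1 8 rfl, hlabel]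
      have q14 : m'.nats 14 = m.nats 14 := by rw [hf.1 14 rfl, hf1.1 14 rfl]
      have htest : (TestExpr.conj (positive (natAt 2 4)) (disj (positive (.get 8 (cellIndex 5 4)))
          (natEq (natAt 14 4) (.var 5)))).Holds m' ↔ (i ∈ S m' ∧
          ((∃ A, s.label j = some A ∧ i ∈ A) ∨ m.nats 14 i = j)) := by
        rw [hmem]
        have h8 : 1 ≤ m'.nats 8 (j * n + i) ↔ ∃ A, s.label j = some A ∧ i ∈ A := by
          rw [q8]; split_ifs with hc <;> simp [hc]
        simp only [TestExpr.Holds, positive, natAt, disj, natEq, cellIndex, NatExpr.eval,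
          NatExpr.var, hi, hj, q0, q14, h8, ← le_antisymm_iff,
          not_and_or, not_not]
      refine ⟨by simp, fun ht => ?_, fun ht => ?_⟩
      · rw [htest] at ht
        refine ⟨by simp; omega, ?_⟩
        simp only [NatExpr.eval, NatExpr.var, hj]
        have r2 : ∀ v : Fin n, (m'.setNat 2 j 1).nats 2 v = if v = j then 1 else m'.nats 2 v := by
          intro v
          simp only [Mem.setNat_nats_self, Function.update_apply, Fin.val_inj]
        have hjr : I.IsRequired s j := by
          have hir := g2 i ((hmem _ _).1 ht.1)
          rcases ht.2 with ⟨A, hA, hiA⟩ | hp'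
          · exact hir.of_label h hA hiA
          · exact hparReq i j hir hp'
        refine ⟨⟨fun v => ?_, fun v hv => ?_⟩, ?_⟩
        · rw [r2]; split_ifs
          · exact le_rfl
          · exact g1 v
        · rw [r2] at hv
          split_ifs at hv with hvj
          · exact hvj ▸ hjr
          · exact g2 v hv
        · rw [if_pos ht]
          ext v
          rw [Finset.mem_insert, hmem, hmem, r2]
          split_ifs with hvj <;> simp [hvj]
      · rw [htest] at ht
        exact ⟨⟨g1, g2⟩, by rw [if_neg ht]⟩
    · rintro m' ⟨⟨g1, g2⟩, hsub, hclosed⟩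
      refine ⟨S m', fun v => ?_, fun v hv => g2 v ((hmem _ _).1 hv), fun v hv => hsub ?_,
        fun v w A hv hA hvA => hclosed v w hv (Or.inl ⟨A, hA, hvA⟩),
        fun v hv u hu => hclosed v u hv (Or.inr hu)⟩
      · have := g1 v
        split_ifs with hv
        · have := (hmem _ _).1 hv
          omega
        · have := (hmem _ _).not.1 hv
          omega
      · rw [hmem, hm1 v, if_pos hv]

open scoped Classical in
/-- The closure of the unlabelled vertices spans the minimal outcome of the deletion phase. -/
theorem minimal_of_closure (h : s.Inv I p) (hact : s.active = ∅) (hpar : HoldsParents I s.forest m)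
    {X : Finset (Fin n)} (hX : ∀ v ∈ X, I.IsRequired s v) (hX0 : ∀ v, s.label v = none → v ∈ X)
    (hXl : ∀ v w A, v ∈ X → s.label w = some A → v ∈ A → w ∈ X)
    (hXp : ∀ v ∈ X, ∀ u : Fin n, m.nats 14 v = u → u ∈ X) :
    Minimal (fun F' => F' ⊆ s.forest ∧ I.KeepsRequired s F')
      (s.forest.filter fun e => ∀ v ∈ e, v ∈ X) ∧
    ∀ v, I.RootConnected (s.forest.filter fun e => ∀ v ∈ e, v ∈ X) v ↔ v ∈ X := by
  set F := s.forest.filter fun e => ∀ v ∈ e, v ∈ X with hF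
  have hFs : F ⊆ s.forest := Finset.filter_subset _ _
  have hrootX : I.root ∈ X := hX0 _ h.label_root_eq_none
  -- Induction on the distance from the root in the forest. A shortest path to `v` must use the
  -- parent edge, so the parent, which lies in `X`, is strictly closer.
  have hdist : ∀ d v, v ∈ X → (SimpleGraph.fromEdgeSet (s.forest : Set (Sym2 (Fin n)))).dist
      I.root v = d → I.RootConnected F v := by
    intro d
    induction d using Nat.strong_induction_on with
    | _ d ih =>
      intro v hv hd
      by_cases hvr : v = I.root
      · rw [hvr]; exact rootConnected_root F
      have hrc : I.RootConnected s.forest v := hX v hv _ subset_rfl (h.keepsRequired_forest hact)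
      obtain ⟨u, hu, huv, hnr⟩ := hpar.2 v hrc hvr
      have huX := hXp v hv u hu
      have huF : s(u, v) ∈ F := by
        rw [hF, Finset.mem_filter]
        refine ⟨huv, fun w hw => ?_⟩
        rcases Sym2.mem_iff.1 hw with rfl | rfl
        · exact huX
        · exact hv
      refine RootConnected.of_mem (ih _ ?_ u huX rfl) huF
      obtain ⟨w, hw⟩ := SimpleGraph.Reachable.exists_walk_length_eq_dist hrc
      have hedge : s(u, v) ∈ w.edges := by
        by_contra hno
        refine hnr ⟨w.transfer _ fun e he => ?_⟩
        have h1 := w.edges_subset_edgeSet he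
        rw [SimpleGraph.edgeSet_fromEdgeSet] at h1 ⊢
        refine ⟨?_, h1.2⟩
        rw [Finset.coe_erase]
        exact ⟨h1.1, fun h2 => hno (h2 ▸ he)⟩
      have hus : u ∈ w.support := w.fst_mem_support_of_mem_edges hedge
      have hne : u ≠ v := (show I.graph.Adj u v from h.forest_edge _ huv).ne
      calc (SimpleGraph.fromEdgeSet (s.forest : Set (Sym2 (Fin n)))).dist I.root u
          ≤ (w.takeUntil u hus).length := SimpleGraph.dist_le _
        _ < w.length := SimpleGraph.Walk.length_takeUntil_lt_length hus hne
        _ = d := by rw [hw, hd]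
  have hiff : ∀ v, I.RootConnected F v ↔ v ∈ X := by
    intro v
    refine ⟨fun hv => ?_, fun hv => hdist _ v hv rfl⟩
    refine hv.mem_of_closed (Z := (X : Set (Fin n))) hrootX fun x hx y hxy => ?_
    exact (Finset.mem_filter.1 hxy).2 y (by simp)
  refine ⟨⟨⟨hFs, fun v hv => (hiff v).2 (hX0 v hv), fun v w A B hA hB hAB hv => (hiff w).2 ?_⟩, ?_⟩,
    hiff⟩
  · exact hXl v w B ((hiff v).1 hv) hB (hAB (h.label_mem v A hA))
  -- A feasible `F'` connects both ends of `e` to the root, because they are required. If `e` were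
  -- missing, they would be joined in the forest without `e`, contradicting acyclicity.
  · rintro F' ⟨hF's, hk⟩ hle e he
    by_contra hne
    induction e using Sym2.ind with
    | _ a b =>
      have ha := hX a ((Finset.mem_filter.1 he).2 a (by simp)) F' hF's hk
      have hb := hX b ((Finset.mem_filter.1 he).2 b (by simp)) F' hF's hk
      refine h.not_reachable_erase (hFs he) (SimpleGraph.Reachable.mono
        (SimpleGraph.fromEdgeSet_mono ?_) ((SimpleGraph.Reachable.symm ha).trans hb))
      intro f hf
      rw [Finset.coe_erase]
      exact ⟨hF's hf, fun h1 => hne (h1 ▸ hf)⟩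

theorem writeEdges_spec (hN : n + 2 ≤ N) (hn : m.nats 0 0 = n) (h2 : ∀ v < n, m.nats 2 v ≤ 1)
    (h10 : ∀ v < n, ∀ w < n, m.nats 10 (v * n + w) ≤ 1) :
    writeEdges.wp N L (fun m' => ∀ v < n, ∀ w < n, m'.nats 3 (v * n + w) =
      m.nats 2 v * m.nats 2 w * m.nats 10 (v * n + w)) m := by
  refine Prog.wp_forLoop_forLoop n (fun a b m' => ∀ v < n, ∀ w < n, (v < a ∨ v = a ∧ w < b) →
      m'.nats 3 (v * n + w) = m.nats 2 v * m.nats 2 w * m.nats 10 (v * n + w)) (by omega)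
      (by decide) rfl rfl ?_ ?_ ?_ ?_ ?_ ?_ ?_
  · intro m' hf
    simp [hf.1 0 rfl, hn]
  · intro a b m' x h
    simpa using h
  · intro a b m' x h
    simpa using h
  · intro v hv w hw h
    omega
  · intro a ha b hb m' hf hi hj h
    have q0 : m'.nats 0 0 = n := by rw [hf.1 0 rfl, hn]
    have q2 : m'.nats 2 = m.nats 2 := hf.1 2 rfl
    have q10 : m'.nats 10 = m.nats 10 := hf.1 10 rfl
    simp only [Prog.wp, cellIndex, natAt, NatExpr.eval, NatExpr.var, hi, hj, q0, q2, q10]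
    constructor
    · have := Nat.mul_le_mul (Nat.mul_le_mul (h2 a ha) (h2 b hb)) (h10 a ha b hb)
      omega
    · intro v hv w hw hvw
      simp only [Mem.setNat_nats_self, Function.update_apply, cell_inj hw hb]
      split_ifs with hc
      · rw [hc.1, hc.2]
      · exact h v hv w hw (by omega)
  · intro a ha m' h v hv w hw hvw
    exact h v hv w hw (by omega)
  · intro m' hf h v hv w hw
    exact h v hv w hw (Or.inl hv)

end PCST

/-! ### Correctness of the whole program -/

namespace PCST

open GWProgram

section Program

variable {n N : ℕ} {L : Set ℝ} {I : PCST n} {ε : ℝ} {m : Mem}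

theorem input_bounded (R : Regime I ε L) (hε : 0 < ε) (hN : n + 1 ≤ N) :
    (I.input ε).Bounded N L := by
  have h0 := R.zero_mem hε
  have hr := I.root.2
  refine ⟨fun a k => ?_, fun a k => ?_⟩
  · rcases a with _ | _ | a
    · simp only [input]; split_ifs <;> omega
    · simp only [input]; split_ifs <;> omega
    · simp [input]
  · rcases a with _ | _ | _ | a
    · simp only [input]
      split_ifs
      · exact R.accuracy_mem
      · exact h0
    · simp only [input]
      split_ifs with _ hadj
      · refine R.mem_of_abs_le 0 (Nat.zero_le _) _ (R.cost_mem _ hadj) ?_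
        rw [abs_of_nonneg (I.cost_nonneg _ hadj), magnitude]
        have h1 := Regime.edge_cost_le I ((SimpleGraph.mem_edgeSet _).2 hadj)
        have h2 := Regime.sum_scaledPenalty_nonneg I hε
        linarith
      · exact h0
      · exact h0
    · simp only [input]
      split_ifs
      · exact R.input_penalty_mem _
      · exact h0
    · simpa [input] using h0

theorem represents_gwStart {p : Fin n → ℝ} (h7 : ∀ v : Fin n, m.nats 7 v = v)
    (h3 : ∀ v : Fin n, m.reals 3 v = p v)
    (h5 : ∀ v : Fin n, m.reals 5 v = if v = I.root then 0 else 1) (h4 : m.reals 4 = fun _ => 0)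
    (h9 : m.nats 9 = fun _ => 0) (h8 : m.nats 8 = fun _ => 0) (h10 : m.nats 10 = fun _ => 0) :
    Represents p m I.gwStart := by
  have hc : ∀ v : Fin n, classOf (m.nats 7) v = {v} := by
    intro v
    ext w
    simp [h7, Fin.ext_iff]
  refine ⟨fun C => ?_, fun v => ?_, fun v => ?_, fun v => ?_, fun v => ?_, fun v => ?_,
    fun v w => ?_, fun v w => ?_⟩
  · simp [gwStart, hc, eq_comm]
  · rw [h7]; exact v.2
  · rw [h5, hc]
    by_cases hv : v = I.root <;> simp [gwStart, hv]
  · rw [h3, hc]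
    simp [GWState.potential, gwStart]
  · simp [h4, GWState.dualAt, gwStart]
  · simp [h9, gwStart]
  · simp [h8, gwStart]
  · simp [h10, gwStart]

/-- The subgraph with vertex set `X` and edge set `F`. -/
def subgraphOf (I : PCST n) (X : Finset (Fin n)) (F : Finset (Sym2 (Fin n)))
    (hF : ∀ e ∈ F, e ∈ I.graph.edgeSet) (hX : ∀ e ∈ F, ∀ v ∈ e, v ∈ X) : I.graph.Subgraph where
  verts := X
  Adj u v := s(u, v) ∈ F
  adj_sub h := hF _ h
  edge_vert h := hX _ h _ (Sym2.mem_mk_left _ _)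
  symm := ⟨fun u v h => by rwa [Sym2.eq_swap]⟩

/-- The program carries out the algorithm. -/
theorem program_spec (R : Regime I ε L) (hε : 0 < ε) (hN : 2 * n + 2 ≤ N) :
    program.wp N L (fun m' => ∃ T, I.IsGWOutput (I.scaledPenalty ε) T ∧ I.IsOutput m' T)
      (I.input ε) := by
  classical
  have hin : HoldsInput I ε (I.input ε) := ⟨rfl, rfl, rfl, rfl, rfl⟩
  have hpL : ∀ v, I.scaledPenalty ε v ∈ L := by
    intro v
    refine R.mem_of_le (Nat.zero_le _) (R.penalty_mem v) ?_
    rw [abs_of_nonneg (scaledPenalty_nonneg I hε v)]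
    have h1 := Finset.single_le_sum (f := I.scaledPenalty ε)
      (fun v _ => scaledPenalty_nonneg I hε v) (Finset.mem_univ v)
    have h2 := Regime.sum_scaledPenalty_nonneg I hε
    linarith
  refine Prog.wp_seq (setup_spec hin.card (by omega) hin.root (R.zero_mem hε) (R.one_mem_set hε)
    (R.two_mem hε) (by rw [hin.accuracy]; exact R.scale_mem) fun v hv => ?_) ?_
  · rw [hin.accuracy, hin.penalty ⟨v, hv⟩]
    exact hpL _
  intro m₁ hf1 h1
  have hin1 := hin.of_frame hf1 rfl rfl rfl rfl rfl
  have hp1 : ∀ v : Fin n, m₁.reals 3 v = I.scaledPenalty ε v := by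
    intro v
    rw [(h1 v v.2).2.1, hin.accuracy, hin.penalty, scaledPenalty]
  have h4 : m₁.reals 4 = fun _ => 0 := hf1.2 4 rfl
  have hr1 : Represents (I.scaledPenalty ε) m₁ I.gwStart :=
    represents_gwStart (fun v => (h1 v v.2).1) hp1
      (fun v => by rw [(h1 v v.2).2.2]; simp [Fin.ext_iff]) h4 (hf1.1 9 rfl) (hf1.1 8 rfl)
      (hf1.1 10 rfl)
  have hlat : InLattice n (R.lat 0) m₁ := by
    intro v
    rw [hp1, h4]
    exact ⟨R.penalty_mem v, (R.lat 0).zero_mem⟩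
  refine Prog.wp_seq (growth_spec R hε hN hin1 hr1 hlat) ?_
  rintro m₂ hf2 ⟨s, hrun, hact, hr2⟩
  have hinv : s.Inv I (I.scaledPenalty ε) :=
    GWState.Inv.of_run (scaledPenalty_nonneg I hε) hrun
  have hin2 := hin1.of_frame hf2 rfl rfl rfl rfl rfl
  refine Prog.wp_seq (findParents_spec (by omega) hinv hin2 hr2.forest ?_) ?_
  · rw [hf2.1 15 rfl, hf1.1 15 rfl]; rfl
  intro m₃ hf3 hpar
  have hin3 := hin2.of_frame hf3 rfl rfl rfl rfl rfl
  refine Prog.wp_seq (closeVertices_spec (by omega) hinv hact hin3 hpar ?_ ?_ ?_) ?_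
  · rw [hf3.1 9 rfl]; exact hr2.labelled
  · rw [hf3.1 8 rfl]; exact hr2.label
  · rw [hf3.1 2 rfl, hf2.1 2 rfl, hf1.1 2 rfl]; rfl
  rintro m₄ hf4 ⟨X, h2, hreq, hX0, hXl, hXp⟩
  have hin4 := hin3.of_frame hf4 rfl rfl rfl rfl rfl
  have h10 : ∀ v w : Fin n, m₄.nats 10 (v * n + w) = if s(v, w) ∈ s.forest then 1 else 0 := by
    rw [hf4.1 10 rfl, hf3.1 10 rfl]; exact hr2.forest
  obtain ⟨hmin, hconn⟩ := minimal_of_closure hinv hact hpar hreq hX0 hXl hXp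
  refine Prog.wp_frame (writeEdges_spec (by omega) hin4.card (fun v hv => ?_)
    fun v hv w hw => ?_) ?_
  · rw [h2 ⟨v, hv⟩]; split_ifs <;> simp
  · rw [h10 ⟨v, hv⟩ ⟨w, hw⟩]; split_ifs <;> simp
  intro m₅ hf5 h3
  set F := s.forest.filter fun e => ∀ v ∈ e, v ∈ X with hF
  have hFX : ∀ e ∈ F, ∀ v ∈ e, v ∈ X := fun e he => (Finset.mem_filter.1 he).2
  refine ⟨I.subgraphOf X F (fun e he => hinv.forest_edge _ (Finset.mem_filter.1 he).1) hFX,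
    ⟨s, F, hrun, hact, hmin, ?_, ?_⟩, fun i => ?_, fun i j => ?_⟩
  · ext e
    induction e with
    | _ u v => rfl
  · ext v
    exact (hconn v).symm
  · rw [hf5.1 2 rfl, h2]
    simp [subgraphOf]
  · rw [h3 i i.2 j j.2, h2, h2, h10]
    have : s(i, j) ∈ F ↔ i ∈ X ∧ j ∈ X ∧ s(i, j) ∈ s.forest := by
      simp [hF]; tauto
    simp only [subgraphOf, this]
    by_cases a : i ∈ X <;> by_cases b : j ∈ X <;> simp [a, b]

end Program

end PCST

/-! ### Bit lengths on rational input -/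

theorem bitSize_ratCast (q : ℚ) : bitSize (q : ℝ) = ratSize q := by
  have h : ∃ q' : ℚ, (q' : ℝ) = q := ⟨q, rfl⟩
  rw [bitSize, dif_pos h, Rat.cast_injective h.choose_spec]

/-- Cancelling common factors does not enlarge numerator or denominator, so any representation as a
fraction bounds the charge. -/
theorem bitSize_intCast_div_le (a : ℤ) {b : ℕ} (hb : b ≠ 0) :
    bitSize ((a : ℝ) / b) ≤ a.natAbs.size + b.size := by
  have h : ((a : ℝ) / b) = ((a / b : ℚ) : ℝ) := by push_cast; rfl
  rw [h, bitSize_ratCast, ratSize]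
  refine Nat.add_le_add (Nat.size_le_size ?_) (Nat.size_le_size ?_)
  · by_cases ha : a = 0
    · simp [ha]
    · refine Nat.le_of_dvd (Int.natAbs_pos.2 ha) (Int.natAbs_dvd_natAbs.2 ?_)
      have := Rat.num_dvd a (b := (b : ℤ)) (by exact_mod_cast hb)
      rwa [Rat.divInt_eq_div] at this
  · refine Nat.le_of_dvd (Nat.pos_of_ne_zero hb) ?_
    have := Rat.den_dvd a b
    exact_mod_cast this

theorem Polynomial.eval_mono_nat (p : Polynomial ℕ) : Monotone fun x => p.eval x := by
  intro x y hxy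
  simp only [Polynomial.eval_eq_sum_range]
  exact Finset.sum_le_sum fun i _ => Nat.mul_le_mul_left _ (Nat.pow_le_pow_left hxy i)

theorem ratSize_pos (q : ℚ) : 0 < ratSize q :=
  Nat.add_pos_right _ (Nat.size_pos.2 q.pos)

theorem Rat.le_two_pow_ratSize (q : ℚ) : (q : ℝ) ≤ 2 ^ ratSize q := by
  have h1 : q ≤ q.num.natAbs := by
    have h := Rat.num_div_den q
    have hd : (1 : ℚ) ≤ q.den := by exact_mod_cast q.pos
    have hn : (q.num : ℚ) ≤ q.num.natAbs := by
      rw [Nat.cast_natAbs]; exact_mod_cast le_abs_self _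
    rw [← h, Rat.num_div_den]
    calc q = q.num / q.den := h.symm
      _ ≤ q.num.natAbs / q.den := by gcongr
      _ ≤ q.num.natAbs := div_le_self (Nat.cast_nonneg _) hd
  have h2 : q.num.natAbs ≤ 2 ^ ratSize q :=
    (Nat.lt_size_self _).le.trans (Nat.pow_le_pow_right two_pos (Nat.le_add_right _ _))
  calc (q : ℝ) ≤ (q.num.natAbs : ℝ) := by exact_mod_cast h1
    _ ≤ 2 ^ ratSize q := by exact_mod_cast h2

namespace PCST

variable {n : ℕ} {I : PCST n} {ε : ℝ}

/-- No restriction on the numbers that occur. -/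
def Regime.univ (I : PCST n) (ε : ℝ) : Regime I ε Set.univ where
  lat _ := ⊤
  mono _ _ _ := trivial
  half _ _ _ := trivial
  cost_mem _ _ := trivial
  penalty_mem _ := trivial
  one_mem := trivial
  mem_of_abs_le _ _ _ _ _ := trivial
  scale_mem := trivial
  accuracy_mem := trivial
  input_penalty_mem _ := trivial

section Bits

open scoped Classical in
theorem bitSize_cost_le (I : PCST n) (ε : ℝ) {e : Sym2 (Fin n)} (he : e ∈ I.graph.edgeSet) :
    bitSize (I.cost e) ≤ I.inputBits ε := by
  have : bitSize (I.cost e) ≤ ∑ e with e ∈ I.graph.edgeSet, bitSize (I.cost e) :=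
    Finset.single_le_sum (f := fun e => bitSize (I.cost e)) (fun _ _ => Nat.zero_le _)
    (Finset.mem_filter.2 ⟨Finset.mem_univ e, he⟩)
  rw [inputBits]
  omega

theorem bitSize_penalty_le (I : PCST n) (ε : ℝ) (v : Fin n) :
    bitSize (I.penalty v) ≤ I.inputBits ε := by
  have := Finset.single_le_sum (f := fun v => bitSize (I.penalty v)) (fun _ _ => Nat.zero_le _)
    (Finset.mem_univ v)
  rw [inputBits]
  omega

theorem bitSize_accuracy_le (I : PCST n) (ε : ℝ) : bitSize ε ≤ I.inputBits ε := by
  rw [inputBits]; omega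

theorem card_le_inputBits (I : PCST n) (ε : ℝ) : n ≤ I.inputBits ε := by
  rw [inputBits]; omega

theorem le_two_pow_bitSize {x : ℝ} (hx : ∃ q : ℚ, (q : ℝ) = x) : x ≤ 2 ^ bitSize x := by
  obtain ⟨q, rfl⟩ := hx
  rw [bitSize_ratCast]
  exact q.le_two_pow_ratSize

theorem two_div_accuracy_le (hε : 0 < ε) (hr : ∃ q : ℚ, (q : ℝ) = ε) :
    2 / ε ≤ 2 * 2 ^ bitSize ε := by
  obtain ⟨q, rfl⟩ := hr
  have hq : 0 < q := by exact_mod_cast hε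
  have hn : (1 : ℝ) ≤ q.num := by exact_mod_cast Rat.num_pos.2 hq
  have h2 : q.den ≤ 2 ^ ratSize q :=
    (Nat.lt_size_self _).le.trans (Nat.pow_le_pow_right two_pos (Nat.le_add_left _ _))
  rw [bitSize_ratCast, Rat.cast_def, div_div_eq_mul_div]
  calc (2 : ℝ) * q.den / q.num ≤ 2 * q.den := div_le_self (by positivity) hn
    _ ≤ 2 * 2 ^ ratSize q := by gcongr; exact_mod_cast h2

open scoped Classical in
theorem magnitude_le (hε : 0 < ε) (hr : I.IsRationalInput ε) :
    I.magnitude ε ≤ 2 ^ (3 * I.inputBits ε + 3) := by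
  set B := I.inputBits ε with hB
  have hpow : ∀ {k}, k ≤ B → (2 : ℝ) ^ k ≤ 2 ^ B := fun h => pow_le_pow_right₀ one_le_two h
  have hBB : (B : ℝ) ≤ 2 ^ B := by exact_mod_cast Nat.lt_two_pow_self.le
  have h1 : (1 : ℝ) ≤ 2 ^ B := one_le_pow₀ one_le_two
  have hE : ∑ e with e ∈ I.graph.edgeSet, I.cost e ≤ 2 ^ B * 2 ^ B := by
    -- Every cost, even 0, takes at least one bit, so the encoding length bounds the number of
    -- edges.
    have hcard : (Finset.univ.filter fun e => e ∈ I.graph.edgeSet).card ≤ B := by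
      have : ∑ e with e ∈ I.graph.edgeSet, 1 ≤ ∑ e with e ∈ I.graph.edgeSet, bitSize (I.cost e) := by
        refine Finset.sum_le_sum fun e he => ?_
        obtain ⟨q, hq⟩ := hr.2.1 e (Finset.mem_filter.1 he).2
        rw [← hq, bitSize_ratCast]
        exact ratSize_pos q
      rw [Finset.card_eq_sum_ones]
      rw [hB, inputBits]
      omega
    calc ∑ e with e ∈ I.graph.edgeSet, I.cost e ≤ ∑ e with e ∈ I.graph.edgeSet, 2 ^ B := by
          refine Finset.sum_le_sum fun e he => ?_
          have he' := (Finset.mem_filter.1 he).2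
          exact (le_two_pow_bitSize (hr.2.1 e he')).trans (hpow (bitSize_cost_le I ε he'))
      _ = (Finset.univ.filter fun e => e ∈ I.graph.edgeSet).card * 2 ^ B := by
          rw [Finset.sum_const, nsmul_eq_mul]
      _ ≤ 2 ^ B * 2 ^ B := by
          gcongr
          exact (Nat.cast_le.2 hcard).trans hBB
  have hP : ∑ v, I.scaledPenalty ε v ≤ 2 ^ B * (2 * 2 ^ B * 2 ^ B) := by
    calc ∑ v, I.scaledPenalty ε v ≤ ∑ v : Fin n, 2 * 2 ^ B * 2 ^ B := by
          refine Finset.sum_le_sum fun v _ => ?_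
          rw [scaledPenalty]
          have g1 := (two_div_accuracy_le hε hr.1).trans
            (mul_le_mul_of_nonneg_left (hpow (bitSize_accuracy_le I ε)) zero_le_two)
          have g2 := (le_two_pow_bitSize (hr.2.2 v)).trans (hpow (bitSize_penalty_le I ε v))
          exact mul_le_mul g1 g2 (I.penalty_nonneg v) (by positivity)
      _ = n * (2 * 2 ^ B * 2 ^ B) := by simp
      _ ≤ 2 ^ B * (2 * 2 ^ B * 2 ^ B) := by
          gcongr
          exact (Nat.cast_le.2 (card_le_inputBits I ε)).trans hBB
  -- The three summands are at most 1, 4 and 2 times the cube of `2 ^ B`, and `1 + 4 + 2 ≤ 2 ^ 3`.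
  rw [magnitude, pow_add, pow_mul', show ((2 : ℝ) ^ B) ^ 3 = 2 ^ B * 2 ^ B * 2 ^ B by ring]
  have h3 : (2 : ℝ) ^ B * 2 ^ B ≤ 2 ^ B * 2 ^ B * 2 ^ B := le_mul_of_one_le_right (by positivity) h1
  have h4 : (1 : ℝ) ≤ 2 ^ B * 2 ^ B * 2 ^ B := one_le_mul_of_one_le_of_one_le
    (one_le_mul_of_one_le_of_one_le h1 h1) h1
  nlinarith

/-- A common denominator of the costs and of the scaled penalties. -/
theorem exists_common_denominator (hε : 0 < ε) (hr : I.IsRationalInput ε) :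
    ∃ D : ℕ, 0 < D ∧ D ≤ 2 ^ I.inputBits ε ∧
      (∀ e ∈ I.graph.edgeSet, ∃ z : ℤ, I.cost e = z / D) ∧
      ∀ v, ∃ z : ℤ, I.scaledPenalty ε v = z / D := by
  classical
  obtain ⟨⟨q, hq⟩, hc, hp⟩ := hr
  choose! c hc using hc
  choose p hp using hp
  have hq0 : 0 < q := by rw [← hq] at hε; exact_mod_cast hε
  have hn0 : 0 < q.num := Rat.num_pos.2 hq0
  set E := Finset.univ.filter fun e => e ∈ I.graph.edgeSet with hE
  -- The numerator of `ε` enters because the scaled penalties are divided by `ε`. Each factor is at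
  -- most two to the bit length of its number, hence `D` is at most two to the encoding length.
  set D := q.num.natAbs * (∏ e ∈ E, (c e).den) * ∏ v, (p v).den with hD
  have hnum : ((q.num.natAbs : ℕ) : ℝ) = q.num := by
    rw [← Int.cast_natCast, Int.natAbs_of_nonneg hn0.le]
  have hDpos : 0 < D := Nat.mul_pos (Nat.mul_pos (Int.natAbs_pos.2 hn0.ne')
    (Finset.prod_pos fun e _ => (c e).pos)) (Finset.prod_pos fun v _ => (p v).pos)
  refine ⟨D, hDpos, ?_, fun e he => ?_, fun v => ?_⟩
  · have hb : I.inputBits ε = n + ratSize q + ∑ e ∈ E, bitSize (I.cost e) +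
        ∑ v, ratSize (p v) := by
      rw [inputBits, ← hq, bitSize_ratCast]
      simp only [← hp, bitSize_ratCast, hE]
    have hb2 : ∑ e ∈ E, bitSize (I.cost e) = ∑ e ∈ E, ratSize (c e) :=
      Finset.sum_congr rfl fun e he => by
        rw [← hc e (Finset.mem_filter.1 he).2, bitSize_ratCast]
    have hden : ∀ x : ℚ, x.den ≤ 2 ^ ratSize x := fun x =>
      (Nat.lt_size_self _).le.trans (Nat.pow_le_pow_right two_pos (Nat.le_add_left _ _))
    calc D ≤ 2 ^ ratSize q * (∏ e ∈ E, 2 ^ ratSize (c e)) * ∏ v, 2 ^ ratSize (p v) := by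
          rw [hD]
          gcongr with e he v hv
          · exact (Nat.lt_size_self _).le.trans
              (Nat.pow_le_pow_right two_pos (Nat.le_add_right _ _))
          · exact hden _
          · exact hden _
      _ = 2 ^ (ratSize q + ∑ e ∈ E, ratSize (c e) + ∑ v, ratSize (p v)) := by
          rw [pow_add, pow_add, Finset.prod_pow_eq_pow_sum, Finset.prod_pow_eq_pow_sum]
      _ ≤ 2 ^ I.inputBits ε := Nat.pow_le_pow_right two_pos (by omega)
  · obtain ⟨k, hk⟩ : (c e).den ∣ D := by
      refine Dvd.dvd.mul_right (Dvd.dvd.mul_left ?_ _) _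
      exact Finset.dvd_prod_of_mem (fun e => (c e).den)
        (Finset.mem_filter.2 ⟨Finset.mem_univ e, he⟩)
    have hk0 : (k : ℝ) ≠ 0 := by
      rw [hk] at hDpos
      exact_mod_cast (Nat.pos_of_mul_pos_left hDpos).ne'
    refine ⟨(c e).num * k, ?_⟩
    rw [← hc e he, hk, Rat.cast_def]
    push_cast
    rw [mul_div_mul_right _ _ hk0]
  · obtain ⟨k, hk⟩ : (p v).den ∣ ∏ v, (p v).den :=
      Finset.dvd_prod_of_mem (fun v => (p v).den) (Finset.mem_univ v)
    have hk0 : (k : ℝ) ≠ 0 := by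
      rw [hD, hk] at hDpos
      exact_mod_cast (Nat.pos_of_mul_pos_left (Nat.pos_of_mul_pos_left hDpos)).ne'
    have hE0 : ((∏ e ∈ E, (c e).den : ℕ) : ℝ) ≠ 0 := by
      exact_mod_cast (Finset.prod_pos fun e _ => (c e).pos).ne'
    refine ⟨2 * q.den * (p v).num * (∏ e ∈ E, (c e).den : ℕ) * k, ?_⟩
    have hnum0 : (q.num : ℝ) ≠ 0 := by exact_mod_cast hn0.ne'
    have hDr : (D : ℝ) = q.num * (∏ e ∈ E, (c e).den : ℕ) * ((p v).den * k) := by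
      rw [hD, hk, Nat.cast_mul, Nat.cast_mul, Nat.cast_mul, hnum]
    have hd1 : (q.den : ℝ) ≠ 0 := by exact_mod_cast q.pos.ne'
    have hd2 : ((p v).den : ℝ) ≠ 0 := by exact_mod_cast (p v).pos.ne'
    rw [scaledPenalty, ← hq, ← hp v, hDr, Rat.cast_def q, Rat.cast_def (p v)]
    simp only [Int.cast_mul, Int.cast_natCast, Int.cast_ofNat]
    field_simp

/-- On rational input, only numbers of polynomially many bits occur. -/
theorem exists_regime_of_isRationalInput (hε : 0 < ε) (hr : I.IsRationalInput ε) :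
    Nonempty (Regime I ε {x | bitSize x ≤ 9 * I.inputBits ε + 7}) := by
  obtain ⟨D, hD0, hD, hc, hp⟩ := exists_common_denominator hε hr
  have hDr : (D : ℝ) ≠ 0 := by exact_mod_cast hD0.ne'
  have hmem0 : ∀ z : ℤ, (z : ℝ) / D ∈ AddSubgroup.zmultiples (1 / ((D : ℝ) * 2 ^ 0)) := by
    intro z
    refine AddSubgroup.mem_zmultiples_iff.2 ⟨z, ?_⟩
    rw [zsmul_eq_mul]
    field_simp
  -- The denominator doubles with each round, matching the one possible halving.
  refine ⟨⟨fun k => AddSubgroup.zmultiples (1 / ((D : ℝ) * 2 ^ k)), ?_, ?_, ?_, ?_, ?_, ?_, ?_,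
    ?_, ?_⟩⟩
  · rintro k x hx
    obtain ⟨z, rfl⟩ := AddSubgroup.mem_zmultiples_iff.1 hx
    refine AddSubgroup.mem_zmultiples_iff.2 ⟨2 * z, ?_⟩
    rw [zsmul_eq_mul, zsmul_eq_mul]
    push_cast
    field_simp
    ring
  · rintro k x hx
    obtain ⟨z, rfl⟩ := AddSubgroup.mem_zmultiples_iff.1 hx
    refine AddSubgroup.mem_zmultiples_iff.2 ⟨z, ?_⟩
    rw [zsmul_eq_mul, zsmul_eq_mul]
    field_simp
    ring
  · intro e he
    obtain ⟨z, hz⟩ := hc e he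
    rw [hz]; exact hmem0 z
  · intro v
    obtain ⟨z, hz⟩ := hp v
    rw [hz]; exact hmem0 z
  · have := hmem0 D
    rwa [Int.cast_natCast, div_self hDr] at this
  · intro k hk x hx hxm
    obtain ⟨z, rfl⟩ := AddSubgroup.mem_zmultiples_iff.1 hx
    set B := I.inputBits ε with hB
    have hnB : n ≤ B := card_le_inputBits I ε
    -- The number of rounds enters the exponent, but `k ≤ 2 * n + 1 ≤ 2 * B + 1`.
    have hb : D * 2 ^ k ≤ 2 ^ (3 * B + 1) :=
      calc D * 2 ^ k ≤ 2 ^ B * 2 ^ k := Nat.mul_le_mul_right _ hD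
        _ = 2 ^ (B + k) := (pow_add _ _ _).symm
        _ ≤ 2 ^ (3 * B + 1) := Nat.pow_le_pow_right two_pos (by omega)
    have hb0 : D * 2 ^ k ≠ 0 := by positivity
    have hx' : z • (1 / ((D : ℝ) * 2 ^ k)) = (z : ℝ) / ((D * 2 ^ k : ℕ) : ℝ) := by
      rw [zsmul_eq_mul]; push_cast; ring
    rw [hx'] at hxm ⊢
    have hz : z.natAbs ≤ 2 ^ (6 * B + 4) := by
      have hbr : (0 : ℝ) < ((D * 2 ^ k : ℕ) : ℝ) := by exact_mod_cast Nat.pos_of_ne_zero hb0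
      have h1 : |(z : ℝ)| ≤ 2 ^ (3 * B + 3) * 2 ^ (3 * B + 1) := by
        rw [abs_div, abs_of_pos hbr, div_le_iff₀ hbr] at hxm
        refine hxm.trans (mul_le_mul (magnitude_le hε hr) ?_ hbr.le (by positivity))
        exact_mod_cast hb
      rw [← pow_add, ← Int.cast_abs, ← Nat.cast_natAbs] at h1
      have h2 : z.natAbs ≤ 2 ^ (3 * B + 3 + (3 * B + 1)) := by exact_mod_cast h1
      exact h2.trans (Nat.pow_le_pow_right two_pos (by omega))
    have h1 : z.natAbs.size ≤ 6 * B + 5 :=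
      Nat.size_le.2 (hz.trans_lt (Nat.pow_lt_pow_right one_lt_two (by omega)))
    have h2 : (D * 2 ^ k).size ≤ 3 * B + 2 :=
      Nat.size_le.2 (hb.trans_lt (Nat.pow_lt_pow_right one_lt_two (by omega)))
    -- At most `6 * B + 5` bits of numerator and `3 * B + 2` bits of denominator give the bound `9 *
    -- B + 7`.
    exact (bitSize_intCast_div_le z hb0).trans (by omega)
  · obtain ⟨q, hq⟩ := hr.1
    have hB := bitSize_accuracy_le I ε
    have hq0 : 0 < q := by rw [← hq] at hε; exact_mod_cast hε
    have hn0 : 0 < q.num := Rat.num_pos.2 hq0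
    have h : 2 / ε = ((2 * q.den : ℤ) : ℝ) / (q.num.natAbs : ℕ) := by
      have hnum : ((q.num.natAbs : ℕ) : ℝ) = q.num := by
        rw [← Int.cast_natCast, Int.natAbs_of_nonneg hn0.le]
      rw [hnum, ← hq, Rat.cast_def, div_div_eq_mul_div]
      push_cast
      rfl
    have h1 : (2 * q.den : ℤ).natAbs.size ≤ q.den.size + 1 := by
      have := q.den.lt_size_self
      rw [Nat.size_le, pow_succ, Int.natAbs_mul, Int.natAbs_natCast]
      simp only [Int.reduceAbs]
      omega
    rw [← hq, bitSize_ratCast, ratSize, hq] at hB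
    rw [Set.mem_ofPred_eq, h]
    exact (bitSize_intCast_div_le _ (Int.natAbs_pos.2 hn0.ne').ne').trans (by omega)
  · exact (bitSize_accuracy_le I ε).trans (by omega)
  · intro v
    exact (bitSize_penalty_le I ε v).trans (by omega)

end Bits

end PCST

/-! ### The theorem -/

theorem theorem3 :
    ∃ C : ℝ, 0 < C ∧
      -- every output of the algorithm with penalties scaled by `2 / ε` has the guarantee
      (∀ (n : ℕ) (I : PCST n) (ε : ℝ), 0 < ε → ε ≤ 1 →
        ∀ T : I.graph.Subgraph, I.IsGWOutput (fun v => 2 / ε * I.penalty v) T →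
          I.IsSolution T ∧ I.totalCost T ≤ C / ε * I.opt ∧
          ∃ T' : I.graph.Subgraph, I.IsSolution T' ∧
            (∃ U : Set (Fin n), U ⊆ T'.verts ∧ U ⊆ T.verts ∧
              I.length T' + I.penaltyOutside U ≤ (1 + ε) * I.opt) ∧
            (I.TerminalsAreLeaves →
              I.totalCost T' ≤ (1 + ε) * I.opt ∧
              ∀ v ∈ T'.verts, I.penalty v ≠ 0 → v ∈ T.verts)) ∧
      -- one program carries out the algorithm on all inputs in polynomial time
      ∃ (P : Prog) (q : Polynomial ℕ),
        ∀ (n : ℕ) (I : PCST n) (ε : ℝ), 0 < ε → ε ≤ 1 →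
          ∃ (m : Mem) (T : I.graph.Subgraph),
            I.IsGWOutput (fun v => 2 / ε * I.penalty v) T ∧ I.IsOutput m T ∧
            (∃ t : ℕ, Runs unitSize P (I.input ε) m t ∧ t ≤ q.eval n) ∧
            (I.IsRationalInput ε →
              ∃ t : ℕ, Runs bitSize P (I.input ε) m t ∧ t ≤ q.eval (I.inputBits ε)) := by
  refine ⟨6, by norm_num, fun n I ε hε hε1 T hT => hT.guarantee hε hε1, GWProgram.program,
    -- `2 * n + 2` bounds natural numbers and loop counts, and `9 * X + 8` is one more than the bit
    -- bound for real numbers.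
    GWProgram.program.timeBound.comp (2 * Polynomial.X + 2) * (9 * Polynomial.X + 8),
    fun n I ε hε hε1 => ?_⟩
  have hq : ∀ x, (GWProgram.program.timeBound.comp (2 * Polynomial.X + 2) *
      (9 * Polynomial.X + 8)).eval x =
      GWProgram.program.timeBound.eval (2 * x + 2) * (9 * x + 8) := by
    intro x; simp
  obtain ⟨m, t, hrun, ht, -, T, hT, hout⟩ := Prog.wp_sound (sz := unitSize) (K := 0)
    (fun _ _ => le_rfl) _ (PCST.input_bounded (PCST.Regime.univ I ε) hε (by omega))
    (PCST.program_spec (PCST.Regime.univ I ε) hε le_rfl)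
  refine ⟨m, T, hT, hout, ⟨t, hrun, ht.trans ?_⟩, fun hr => ?_⟩
  · rw [hq]
    exact Nat.mul_le_mul_left _ (by omega)
  · obtain ⟨R⟩ := PCST.exists_regime_of_isRationalInput hε hr
    obtain ⟨m', t', hrun', ht', -⟩ := Prog.wp_sound (sz := bitSize)
      (K := 9 * I.inputBits ε + 7) (fun _ h => h) _ (PCST.input_bounded R hε (by omega))
      (PCST.program_spec R hε le_rfl)
    -- The two ways of charging give the same final memory, so the output already chosen serves for
    -- both time bounds.
    refine ⟨t', hrun.deterministic hrun' ▸ hrun', ht'.trans ?_⟩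
    rw [hq]
    have := PCST.card_le_inputBits I ε
    exact Nat.mul_le_mul_right _ (Polynomial.eval_mono_nat _ (by omega))
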